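/- Let $N\ge 2$ be an integer and $m>0$. There are constants $C_1,C_2>0$ depending only on $N$ and $m$ such that the following holds. Let $\Omega\subset\mathbb{R}^N$ be a bounded open set, $T>0$, $\Omega_T=\Omega\times(0,T)$, and let $\mu:\Omega_T\to\mathbb{R}$ and $\sigma:\Omega\to\mathbb{R}$ be continuous and bounded. Let $u\in L^\infty(\Omega_T)$ be a weak solution of $$u_t-\Delta(|u|^{m-1}u)=\mu\ \text{ in }\Omega_T,\qquad u=0\ \text{ on }\partial\Omega\times(0,T),\qquad u(0)=\sigma\ \text{ in }\Omega,$$ that is, $u\in C([0,T];L^2(\Omega))$, $|u|^m\in L^2((0,T);H^1_0(\Omega))$, the weak spatial gradient $\nabla(|u|^{m-1}u)$ exists in $L^1_{\rm loc}(\Omega_T)$, and for every $\varphi\in C^{2,1}_c(\Omega\times[0,T))$ (twice continuously differentiable in $x$, once in $t$, with compact support in $\Omega\times[0,T)$) $$-\int_{\Omega_T}u\,\varphi_t\,dx\,dt+\int_{\Omega_T}\nabla(|u|^{m-1}u)\cdot\nabla\varphi\,dx\,dt=\int_{\Omega_T}\varphi\,\mu\,dx\,dt+\int_\Omega\varphi(x,0)\,\sigma(x)\,dx.$$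 Put $M=\int_\Omega|\sigma|\,dx+\int_{\Omega_T}|\mu|\,dx\,dt$ and, for $p>0$ and measurable $f$ on $\Omega_T$, $\|f\|_{L^{p,\infty}(\Omega_T)}=\sup_{k>0}k\,|\{z\in\Omega_T:|f(z)|>k\}|^{1/p}$. Then $$\|u\|_{L^\infty((0,T);L^1(\Omega))}\le M,$$ $$\|u\|_{L^{m+2/N,\infty}(\Omega_T)}\le C_1\,M^{\frac{N+2}{mN+2}},$$ $$\big\|\,|\nabla(|u|^{m-1}u)|\,\big\|_{L^{\frac{mN+2}{mN+1},\infty}(\Omega_T)}\le C_2\,M^{\frac{m(N+1)+1}{mN+2}}.$$ -/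

import Mathlib

open MeasureTheory Set
open scoped ENNReal ContDiff InnerProductSpace

noncomputable section

namespace PorousMedium

/-- The space `ℝ^N` with its Euclidean norm and Lebesgue measure. -/
abbrev Space (N : ℕ) : Type := EuclideanSpace ℝ (Fin N)

/-- The cylinder `Ω_T = Ω × (0,T)`. -/
def cyl {N : ℕ} (Ω : Set (Space N)) (T : ℝ) : Set (Space N × ℝ) := Ω ×ˢ Ioo 0 T

/-- `f ∈ C_b(s)`: continuous and bounded on `s`. -/
def IsCb {X : Type*} [TopologicalSpace X] (s : Set X) (f : X → ℝ) : Prop :=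
  ContinuousOn f s ∧ ∃ B : ℝ, ∀ x ∈ s, |f x| ≤ B

/-- `f ∈ H¹₀(Ω)` with gradient `A`: the pair `(f, A)` is the limit in `L²(Ω)` of pairs `(φ, ∇φ)`
with `φ ∈ C_c^∞(Ω)`. -/
def IsH10WithGradient {N : ℕ} (Ω : Set (Space N)) (f : Space N → ℝ) (A : Space N → Space N) :
    Prop :=
  MemLp f 2 (volume.restrict Ω) ∧ MemLp A 2 (volume.restrict Ω) ∧
    ∀ ε : ℝ≥0∞, 0 < ε → ∃ φ : Space N → ℝ,
      ContDiff ℝ ∞ φ ∧ HasCompactSupport φ ∧ tsupport φ ⊆ Ω ∧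
      eLpNorm (fun x => φ x - f x) 2 (volume.restrict Ω) ≤ ε ∧
      eLpNorm (fun x => gradient φ x - A x) 2 (volume.restrict Ω) ≤ ε

/-- `f ∈ L²((0,T); H¹₀(Ω))`: `f` and its spatial gradient `A` are (jointly measurable and) square
integrable on `Ω_T`, and `f(·,t) ∈ H¹₀(Ω)` with gradient `A(·,t)` for almost every `t ∈ (0,T)`. -/
def IsL2H10 {N : ℕ} (Ω : Set (Space N)) (T : ℝ) (f : Space N × ℝ → ℝ) : Prop :=
  MemLp f 2 (volume.restrict (cyl Ω T)) ∧
    ∃ A : Space N × ℝ → Space N, MemLp A 2 (volume.restrict (cyl Ω T)) ∧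
      ∀ᵐ t ∂(volume.restrict (Ioo 0 T)),
        IsH10WithGradient Ω (fun x => f (x, t)) (fun x => A (x, t))

/-- `u ∈ C([0,T]; L²(Ω))`: `u(·,t)` agrees for almost every `t` with a continuous curve in
`L²(Ω)`. -/
def IsCL2 {N : ℕ} (Ω : Set (Space N)) (T : ℝ) (u : Space N × ℝ → ℝ) : Prop :=
  ∃ v : ℝ → Lp ℝ 2 (volume.restrict Ω), ContinuousOn v (Icc 0 T) ∧
    ∀ᵐ t ∂(volume.restrict (Ioo 0 T)), (fun x => u (x, t)) =ᵐ[volume.restrict Ω] v t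

/-- `G` is the weak (distributional) spatial gradient of `w` on `Ω_T`, both being locally
integrable functions on `Ω_T`. -/
def HasWeakGradient {N : ℕ} (Ω : Set (Space N)) (T : ℝ) (w : Space N × ℝ → ℝ)
    (G : Space N × ℝ → Space N) : Prop :=
  LocallyIntegrableOn w (cyl Ω T) ∧ LocallyIntegrableOn G (cyl Ω T) ∧
    ∀ φ : Space N × ℝ → ℝ, ContDiff ℝ ∞ φ → HasCompactSupport φ → tsupport φ ⊆ cyl Ω T →
      ∀ e : Space N,
        ∫ z in cyl Ω T, w z * fderiv ℝ φ z (e, 0) = -∫ z in cyl Ω T, ⟪G z, e⟫_ℝ * φ z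

/-- The time derivative `φ_t`. -/
def dt {N : ℕ} (φ : Space N × ℝ → ℝ) (z : Space N × ℝ) : ℝ :=
  deriv (fun s => φ (z.1, s)) z.2

/-- The spatial gradient `∇φ` of a function that is differentiable in `x`. -/
def gradx {N : ℕ} (φ : Space N × ℝ → ℝ) (z : Space N × ℝ) : Space N :=
  gradient (fun y => φ (y, z.2)) z.1

/-- `φ ∈ C_c^{2,1}(Ω × [0,T))`: twice continuously differentiable in `x`, once in `t`, with compact
support in `Ω × [0,T)`. Such a function, with its derivatives, is understood as the restriction
to `t ≥ 0` of a function of the same kind on `ℝ^N × ℝ`, supported in `Ω × (-∞,T)`. -/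
structure IsTest {N : ℕ} (Ω : Set (Space N)) (T : ℝ) (φ : Space N × ℝ → ℝ) : Prop where
  compact : HasCompactSupport φ
  support : tsupport φ ⊆ Ω ×ˢ Iio T
  cont : Continuous φ
  diff_t : ∀ x, Differentiable ℝ (fun t => φ (x, t))
  cont_t : Continuous (dt φ)
  diff_x : ∀ t, ContDiff ℝ 2 (fun x => φ (x, t))
  cont_x : Continuous (fun z : Space N × ℝ => fderiv ℝ (fun y => φ (y, z.2)) z.1)
  cont_xx : Continuous (fun z : Space N × ℝ => iteratedFDeriv ℝ 2 (fun y => φ (y, z.2)) z.1)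

/-- The nonlinearity `s ↦ |s|^{m-1} s`. -/
def sgnPow (m s : ℝ) : ℝ := |s| ^ (m - 1) * s

/-- `u` is a weak solution of `u_t - Δ(|u|^{m-1}u) = μ` in `Ω_T`, `u = 0` on `∂Ω × (0,T)`,
`u(0) = σ` in `Ω`, for data `μ`, `σ` that are functions. -/
structure IsWeakSolution {N : ℕ} (m : ℝ) (Ω : Set (Space N)) (T : ℝ) (μ : Space N × ℝ → ℝ)
    (σ : Space N → ℝ) (u : Space N × ℝ → ℝ) : Prop where
  cont : IsCL2 Ω T u
  energy : IsL2H10 Ω T (fun z => |u z| ^ m)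
  eqn : ∃ G : Space N × ℝ → Space N, HasWeakGradient Ω T (fun z => sgnPow m (u z)) G ∧
    ∀ φ : Space N × ℝ → ℝ, IsTest Ω T φ →
      -(∫ z in cyl Ω T, u z * dt φ z) + ∫ z in cyl Ω T, ⟪G z, gradx φ z⟫_ℝ
        = (∫ z in cyl Ω T, φ z * μ z) + ∫ x in Ω, φ (x, 0) * σ x

/-- The norm of `L^∞((0,T); L¹(Ω))`. -/
def normLinftyL1 {N : ℕ} (Ω : Set (Space N)) (T : ℝ) (u : Space N × ℝ → ℝ) : ℝ≥0∞ :=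
  essSup (fun t => eLpNorm (fun x => u (x, t)) 1 (volume.restrict Ω)) (volume.restrict (Ioo 0 T))

/-- The Marcinkiewicz (weak Lebesgue) quasi-norm of `L^{p,∞}(s)`,
`sup_{k>0} k |{z ∈ s : ‖f z‖ > k}|^{1/p}`. -/
def weakNorm {N : ℕ} {F : Type*} [NormedAddCommGroup F] (p : ℝ) (s : Set (Space N × ℝ))
    (f : Space N × ℝ → F) : ℝ≥0∞ :=
  ⨆ (k : ℝ) (_ : 0 < k), ENNReal.ofReal k * volume {z ∈ s | k < ‖f z‖} ^ (1 / p)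

/-- The total mass `|σ|(Ω) + |μ|(Ω_T)` of the data. -/
def mass {N : ℕ} (Ω : Set (Space N)) (T : ℝ) (μ : Space N × ℝ → ℝ) (σ : Space N → ℝ) : ℝ :=
  (∫ x in Ω, |σ x|) + ∫ z in cyl Ω T, |μ z|

end PorousMedium

end

open Filter Topology

noncomputable section

namespace PorousMedium

/-! ### Dominated convergence, translations and mollification in `L^p` -/

section

/-! Write w = |u|^{m-1}u and M for the mass of the data. Everything follows from one energy
inequality. For a smooth ρ ≥ 0 with compact support in (0,∞), test the equation with ψ = sgn(w)
∫₀^{|w|} ρ, whose spatial gradient is ρ(|w|)∇w. Let J be the primitive of r ↦ sgn(r) ∫₀^{|r|^m} ρ.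
Since |ψ| ≤ ∫ρ and J(s) ≤ |s| ∫ρ, this gives ∫ J(u(τ)) + ∫∫ ρ(|w|)|∇w|² ≤ M ∫ρ (`energy`,
`energy_le`).

Different ρ give different estimates. If ρ has mass one near 0, then J approximates the absolute
value and the L¹ bound follows (`integral_abs_le`). If ρ is a plateau up to height l, the result is
∫∫_{|w| ≤ l} |∇w|² ≤ 2lM (`lintegral_sublevel_le`). For the weak bound on u, apply Sobolev's
inequality on a time slice to ∫₀^{|w|} ρ, with ρ supported above k^m/4. Its gradient lives where |u|
is at least a multiple of k, a set of measure O(M/k) by the L¹ bound. Hölder's inequality then gains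
(M/k)^{2/N}, and integration in time bounds |{|u| > k}| by C M^{1+2/N} k^{-(m+2/N)}
(`measure_slice_le`, `measure_superlevel_le`). The set {|∇w| > λ} is split at |u| = k and k is
optimized (`measure_gradient_le'`).

The real work is to justify the test function. It is |u|^m, not w, that is assumed to be in L²(H¹₀),
with gradient A say, while the weak gradient G of w is only locally integrable. Differentiating w² =
(|u|^m)² in two ways gives wG = |u|^m A (`smul_weak_ae_eq`), and G = 0 where u = 0 (`weak_eq_zero`),
so that |G| ≤ |A|. Since ψ vanishes where |u|^m is small, cutting it off with functions of test
functions approximating |u|^m shows ψ(t) ∈ H¹₀ for almost every t (`slices_test`).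

No regularity of u_t is needed. The slice ψ(t) is held fixed and the equation is used between times
s and t. Convexity of J gives J(u(t)) − J(u(s)) ≤ (u(t) − u(s)) ψ(t) (`energy_sub_le`). Taking s = t
− d, integrating in t and differentiating at d = 0 yields the energy inequality, because time
translations are continuous in L². -/

/-- Dominated convergence in `L^p`. -/
theorem tendsto_eLpNorm_zero_of_dominated {α F : Type*} [MeasurableSpace α] {μ : Measure α}
    [NormedAddCommGroup F] {p : ℝ≥0∞} (hp0 : p ≠ 0) (hp : p ≠ ⊤) {H : ℕ → α → F} {g : α → ℝ}
    (hH : ∀ n, AEStronglyMeasurable (H n) μ) (hg : MemLp g p μ)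
    (hb : ∀ n, ∀ᵐ x ∂μ, ‖H n x‖ ≤ g x)
    (hl : ∀ᵐ x ∂μ, Tendsto (fun n => H n x) atTop (𝓝 0)) :
    Tendsto (fun n => eLpNorm (H n) p μ) atTop (𝓝 0) := by
  have hpr : 0 < p.toReal := ENNReal.toReal_pos hp0 hp
  simp_rw [eLpNorm_eq_lintegral_rpow_enorm_toReal hp0 hp]
  have h1 : Tendsto (fun n => ∫⁻ x, ‖H n x‖ₑ ^ p.toReal ∂μ) atTop (𝓝 (∫⁻ _, 0 ∂μ)) := by
    refine tendsto_lintegral_of_dominated_convergence' (fun x => ‖g x‖ₑ ^ p.toReal)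
      (fun n => (hH n).enorm.pow_const _) (fun n => ?_) ?_ ?_
    · filter_upwards [hb n] with x hx
      gcongr
      rw [← ofReal_norm, ← ofReal_norm]
      exact ENNReal.ofReal_le_ofReal (hx.trans (Real.le_norm_self _))
    · exact (lintegral_rpow_enorm_lt_top_of_eLpNorm_lt_top hp0 hp hg.2).ne
    · filter_upwards [hl] with x hx
      have := ((hx.enorm).ennrpow_const p.toReal)
      simpa [hpr] using this
  have h2 := h1.ennrpow_const (1 / p.toReal)
  simpa [hpr] using h2

section Translation

variable {X F : Type*} [NormedAddCommGroup X] [NormedSpace ℝ X] [FiniteDimensional ℝ X]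
  [MeasurableSpace X] [BorelSpace X] {μ : Measure X} [μ.IsAddHaarMeasure]
  [NormedAddCommGroup F]

/-- Translations act continuously on `L^p`. -/
theorem tendsto_eLpNorm_translate {p : ℝ≥0∞} [Fact (1 ≤ p)] (hp : p ≠ ⊤) {f : X → F}
    (hf : MemLp f p μ) :
    Tendsto (fun y => eLpNorm (fun x => f (x - y) - f x) p μ) (𝓝 0) (𝓝 0) := by
  have : ProperSpace X := FiniteDimensional.proper ℝ X
  let g : X → C(X, X) := fun y => ⟨fun x => x - y, by fun_prop⟩
  have hgc : Continuous g := by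
    refine ContinuousMap.continuous_of_continuous_uncurry _ ?_
    simp only [g, Function.uncurry_def, ContinuousMap.coe_mk]
    fun_prop
  have hgm : ∀ y, MeasurePreserving (g y) μ μ := fun y => measurePreserving_sub_right μ y
  have hc : Continuous fun y => Lp.compMeasurePreserving (g y) (hgm y) (hf.toLp f) :=
    continuous_const.compMeasurePreservingLp hgc hgm hp
  have h0 := hc.tendsto 0
  rw [Lp.tendsto_Lp_iff_tendsto_eLpNorm'] at h0
  refine h0.congr fun y => eLpNorm_congr_ae ?_
  have e1 : ∀ z, (Lp.compMeasurePreserving (g z) (hgm z) (hf.toLp f) : X → F) =ᵐ[μ]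
      fun x => f (x - z) := fun z => by
    refine (Lp.coeFn_compMeasurePreserving _ (hgm z)).trans ?_
    exact (hgm z).quasiMeasurePreserving.ae_eq_comp hf.coeFn_toLp
  filter_upwards [e1 y, e1 0] with x h1 h2
  rw [Pi.sub_apply, h1, h2, sub_zero]

variable [NormedSpace ℝ F] [CompleteSpace F]
open ContinuousLinearMap in
open scoped Convolution in
/-- Mollification converges in `L^p`. -/
theorem exists_eLpNorm_normed_convolution_sub_le {p : ℝ≥0∞} [Fact (1 ≤ p)] (hp : p ≠ ⊤) {f : X → F}
    (hf : MemLp f p μ) {ε : ℝ≥0∞} (hε : 0 < ε) :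
    ∃ δ > 0, ∀ φ : ContDiffBump (0 : X), φ.rOut ≤ δ →
      eLpNorm (fun x => (φ.normed μ ⋆[lsmul ℝ ℝ, μ] f) x - f x) p μ ≤ ε := by
  have hp1 : 1 ≤ p := Fact.out
  have hp0 : p ≠ 0 := (one_pos.trans_le hp1).ne'
  have hpr : 0 < p.toReal := ENNReal.toReal_pos hp0 hp
  obtain ⟨δ, hδ, hT⟩ := Metric.eventually_nhds_iff.1
    ((tendsto_eLpNorm_translate hp hf).eventually (ge_mem_nhds hε))
  refine ⟨δ, hδ, fun φ hφ => ?_⟩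
  -- Convolution with the bump is averaging over the probability measure ν, so the monotonicity of
  -- `L^p` norms in the exponent plays the role of Jensen's inequality. Tonelli then leaves an
  -- average of translation errors over shifts of length less than δ.
  let ν : Measure X := μ.withDensity fun y => ENNReal.ofReal (φ.normed μ y)
  have hφm : Measurable fun y => ENNReal.ofReal (φ.normed μ y) :=
    (φ.continuous_normed.measurable).ennreal_ofReal
  have hν1 : ν univ = 1 := by
    simp only [ν, withDensity_apply _ MeasurableSet.univ, Measure.restrict_univ]
    rw [← ofReal_integral_eq_lintegral_ofReal φ.integrable_normed
      (ae_of_all _ φ.nonneg_normed), φ.integral_normed, ENNReal.ofReal_one]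
  have : IsProbabilityMeasure ν := ⟨hν1⟩
  -- replace `f` by a strongly measurable representative
  obtain ⟨f', hf'm, hff'⟩ := hf.1
  have hconv : (φ.normed μ ⋆[lsmul ℝ ℝ, μ] f) = (φ.normed μ ⋆[lsmul ℝ ℝ, μ] f') :=
    convolution_congr _ (ae_eq_refl _) hff'
  have hfp : MemLp f' p μ := hf.ae_eq hff'
  have hkey : ∀ x, ‖(φ.normed μ ⋆[lsmul ℝ ℝ, μ] f') x - f' x‖ₑ ^ p.toReal
      ≤ ∫⁻ y, ‖f' (x - y) - f' x‖ₑ ^ p.toReal ∂ν := by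
    intro x
    have hli : LocallyIntegrable f' μ := hfp.locallyIntegrable hp1
    have hci : Integrable (fun y => φ.normed μ y • f' (x - y)) μ := by
      have := (φ.hasCompactSupport_normed (μ := μ)).convolutionExists_left (lsmul ℝ ℝ)
        φ.continuous_normed hli x
      simpa using this.integrable
    have e1 : (φ.normed μ ⋆[lsmul ℝ ℝ, μ] f') x - f' x
        = ∫ y, φ.normed μ y • (f' (x - y) - f' x) ∂μ := by
      simp_rw [smul_sub]
      rw [integral_sub hci (φ.integrable_normed.smul_const _), φ.integral_normed_smul]
      simp [convolution_def]
    have e2 : ‖(φ.normed μ ⋆[lsmul ℝ ℝ, μ] f') x - f' x‖ₑ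
        ≤ ∫⁻ y, ‖f' (x - y) - f' x‖ₑ ∂ν := by
      rw [e1]
      refine (enorm_integral_le_lintegral_enorm _).trans_eq ?_
      rw [lintegral_withDensity_eq_lintegral_mul₀ hφm.aemeasurable]
      · refine lintegral_congr fun y => ?_
        simp [enorm_smul, Real.enorm_eq_ofReal (φ.nonneg_normed y)]
      · exact ((hf'm.comp_measurable (measurable_const.sub measurable_id)).sub
          stronglyMeasurable_const).enorm.aemeasurable
    have e3 := eLpNorm_le_eLpNorm_of_exponent_le (μ := ν) hp1
      (f := fun y => f' (x - y) - f' x)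
      ((hf'm.comp_measurable (measurable_const.sub measurable_id)).sub
          stronglyMeasurable_const).aestronglyMeasurable
    rw [eLpNorm_one_eq_lintegral_enorm, eLpNorm_eq_lintegral_rpow_enorm_toReal hp0 hp] at e3
    have e4 := ENNReal.rpow_le_rpow (e2.trans e3) hpr.le
    rwa [← ENNReal.rpow_mul, one_div_mul_cancel hpr.ne', ENNReal.rpow_one] at e4
  have hmeas : Measurable (Function.uncurry fun x y => ‖f' (x - y) - f' x‖ₑ ^ p.toReal) := by
    refine (StronglyMeasurable.enorm ?_).pow_const _
    exact (hf'm.comp_measurable (measurable_fst.sub measurable_snd)).sub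
      (hf'm.comp_measurable measurable_fst)
  have hfin : ∫⁻ x, ‖(φ.normed μ ⋆[lsmul ℝ ℝ, μ] f') x - f' x‖ₑ ^ p.toReal ∂μ
      ≤ ε ^ p.toReal := by
    calc _ ≤ ∫⁻ x, ∫⁻ y, ‖f' (x - y) - f' x‖ₑ ^ p.toReal ∂ν ∂μ := lintegral_mono hkey
      _ = ∫⁻ y, ∫⁻ x, ‖f' (x - y) - f' x‖ₑ ^ p.toReal ∂μ ∂ν :=
          lintegral_lintegral_swap hmeas.aemeasurable
      _ ≤ ∫⁻ y, ε ^ p.toReal ∂ν := by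
          refine lintegral_mono_ae ?_
          have hsupp : ∀ᵐ y ∂ν, φ.normed μ y ≠ 0 := by
            rw [ae_withDensity_iff hφm]
            filter_upwards with y hy h
            simp [h] at hy
          filter_upwards [hsupp] with y hy
          have hyb : y ∈ Metric.ball (0 : X) φ.rOut := by
            rw [← φ.support_normed_eq (μ := μ)]; exact hy
          have h1 := hT (lt_of_lt_of_le hyb hφ)
          have h2 : eLpNorm (fun x => f' (x - y) - f' x) p μ ≤ ε := by
            refine le_trans (le_of_eq (eLpNorm_congr_ae ?_)) h1
            have := (measurePreserving_sub_right μ y).quasiMeasurePreserving.ae_eq_comp hff'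
            filter_upwards [hff', this] with x h3 h4
            simp only [Function.comp] at h4
            rw [h3, h4]
          rw [eLpNorm_eq_lintegral_rpow_enorm_toReal hp0 hp] at h2
          have e4 := ENNReal.rpow_le_rpow h2 hpr.le
          rwa [← ENNReal.rpow_mul, one_div_mul_cancel hpr.ne', ENNReal.rpow_one] at e4
      _ = ε ^ p.toReal := by simp
  have hae : (fun x => (φ.normed μ ⋆[lsmul ℝ ℝ, μ] f) x - f x)
      =ᵐ[μ] fun x => (φ.normed μ ⋆[lsmul ℝ ℝ, μ] f') x - f' x := by
    rw [hconv]; filter_upwards [hff'] with x hx; rw [hx]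
  rw [eLpNorm_congr_ae hae, eLpNorm_eq_lintegral_rpow_enorm_toReal hp0 hp]
  calc _ ≤ (ε ^ p.toReal) ^ (1 / p.toReal) := ENNReal.rpow_le_rpow hfin (by positivity)
    _ = ε := by rw [← ENNReal.rpow_mul, mul_one_div_cancel hpr.ne', ENNReal.rpow_one]

end Translation

end

/-! ### Test functions and the space `H¹₀(Ω)`: closedness, chain rule, Sobolev inequality -/

section

/-- `φ ∈ C_c^∞(U)`. -/
structure IsSmoothTest {X : Type*} [NormedAddCommGroup X] [NormedSpace ℝ X] (U : Set X)
    (φ : X → ℝ) : Prop where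
  smooth : ContDiff ℝ ∞ φ
  compact : HasCompactSupport φ
  support : tsupport φ ⊆ U

section Basic

variable {X : Type*} [NormedAddCommGroup X] [NormedSpace ℝ X] {U : Set X} {φ ψ : X → ℝ}

theorem IsSmoothTest.continuous (h : IsSmoothTest U φ) : Continuous φ := h.smooth.continuous

theorem IsSmoothTest.differentiable (h : IsSmoothTest U φ) : Differentiable ℝ φ :=
  h.smooth.differentiable (by simp)

theorem IsSmoothTest.continuous_fderiv (h : IsSmoothTest U φ) : Continuous (fderiv ℝ φ) :=
  h.smooth.continuous_fderiv (by simp)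

theorem IsSmoothTest.mul_left (h : IsSmoothTest U φ) (hψ : ContDiff ℝ ∞ ψ) :
    IsSmoothTest U (fun x => ψ x * φ x) :=
  ⟨hψ.mul h.smooth, h.compact.mul_left, (tsupport_mul_subset_right).trans h.support⟩

theorem IsSmoothTest.comp (h : IsSmoothTest U φ) {g : ℝ → ℝ} (hg : ContDiff ℝ ∞ g) (h0 : g 0 = 0) :
    IsSmoothTest U (fun x => g (φ x)) :=
  ⟨hg.comp h.smooth, h.compact.comp_left h0,
    (closure_mono (Function.support_comp_subset h0 φ)).trans h.support⟩

theorem IsSmoothTest.exists_bound (h : IsSmoothTest U φ) : ∃ B, ∀ x, |φ x| ≤ B :=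
  h.compact.exists_bound_of_continuous h.continuous

variable [MeasurableSpace X] [BorelSpace X] {μ : Measure X} [IsFiniteMeasureOnCompacts μ]

theorem IsSmoothTest.memLp (h : IsSmoothTest U φ) (p : ℝ≥0∞) : MemLp φ p μ :=
  h.continuous.memLp_of_hasCompactSupport h.compact

theorem IsSmoothTest.memLp_fderiv [FiniteDimensional ℝ X] (h : IsSmoothTest U φ) (p : ℝ≥0∞) (e : X) :
    MemLp (fun x => fderiv ℝ φ x e) p μ := by
  refine Continuous.memLp_of_hasCompactSupport (h.continuous_fderiv.clm_apply continuous_const) ?_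
  exact (h.compact.fderiv ℝ).comp_left (g := fun L : X →L[ℝ] ℝ => L e) rfl

end Basic

/-- Cauchy–Schwarz for the `L²` inner product. -/
theorem enorm_integral_inner_le {α F : Type*} [MeasurableSpace α] {μ : Measure α}
    [NormedAddCommGroup F] [InnerProductSpace ℝ F] {f g : α → F}
    (hf : AEStronglyMeasurable f μ) (hg : AEStronglyMeasurable g μ) :
    ‖∫ x, ⟪f x, g x⟫_ℝ ∂μ‖ₑ ≤ eLpNorm f 2 μ * eLpNorm g 2 μ := by
  refine (enorm_integral_le_lintegral_enorm _).trans ?_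
  rw [← eLpNorm_one_eq_lintegral_enorm]
  simpa using eLpNorm_le_eLpNorm_mul_eLpNorm_of_nnnorm (p := 2) (q := 2) (r := 1) hf hg
    (fun x y => ⟪x, y⟫_ℝ) 1 (ae_of_all _ fun x => by simpa using nnnorm_inner_le_nnnorm _ _)

theorem integrable_inner_of_memLp {α F : Type*} [MeasurableSpace α] {μ : Measure α}
    [NormedAddCommGroup F] [InnerProductSpace ℝ F] {f g : α → F}
    (hf : MemLp f 2 μ) (hg : MemLp g 2 μ) : Integrable (fun x => ⟪f x, g x⟫_ℝ) μ :=
  ⟨hf.1.inner hg.1, by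
    rw [hasFiniteIntegral_iff_enorm, ← eLpNorm_one_eq_lintegral_enorm]
    refine lt_of_le_of_lt (eLpNorm_le_eLpNorm_mul_eLpNorm_of_nnnorm (p := 2) (q := 2) (r := 1)
      hf.1 hg.1 (fun x y => ⟪x, y⟫_ℝ) 1
      (ae_of_all _ fun x => by simpa using nnnorm_inner_le_nnnorm _ _)) ?_
    exact ENNReal.mul_lt_top (ENNReal.mul_lt_top (by simp) hf.2) hg.2⟩

/-- `L²` inner products pass to the limit. -/
theorem tendsto_integral_inner {α F : Type*} [MeasurableSpace α] {μ : Measure α}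
    [NormedAddCommGroup F] [InnerProductSpace ℝ F] {ι : Type*} {l : Filter ι} {f : ι → α → F}
    {f₀ g : α → F} (hf : ∀ n, MemLp (f n) 2 μ) (hf₀ : MemLp f₀ 2 μ) (hg : MemLp g 2 μ)
    (h : Tendsto (fun n => eLpNorm (fun x => f n x - f₀ x) 2 μ) l (𝓝 0)) :
    Tendsto (fun n => ∫ x, ⟪f n x, g x⟫_ℝ ∂μ) l (𝓝 (∫ x, ⟪f₀ x, g x⟫_ℝ ∂μ)) := by
  rw [tendsto_iff_edist_tendsto_0]
  have h1 : Tendsto (fun n => eLpNorm (fun x => f n x - f₀ x) 2 μ * eLpNorm g 2 μ) l (𝓝 0) := by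
    simpa using ENNReal.Tendsto.mul_const h (Or.inr hg.2.ne)
  refine tendsto_of_tendsto_of_tendsto_of_le_of_le tendsto_const_nhds h1 (fun _ => zero_le)
    fun n => ?_
  rw [edist_eq_enorm_sub, ← integral_sub (integrable_inner_of_memLp (hf n) hg)
    (integrable_inner_of_memLp hf₀ hg)]
  simp_rw [← inner_sub_left]
  exact enorm_integral_inner_le ((hf n).1.sub hf₀.1) hg.1

section Slice

variable {N : ℕ} {Ω : Set (Space N)} {f : Space N → ℝ} {A : Space N → Space N}

theorem norm_gradient (φ : Space N → ℝ) (x : Space N) : ‖gradient φ x‖ = ‖fderiv ℝ φ x‖ := by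
  simp [gradient]

theorem IsSmoothTest.continuous_gradient {φ : Space N → ℝ} (h : IsSmoothTest Ω φ) :
    Continuous (gradient φ) :=
  (InnerProductSpace.toDual ℝ (Space N)).symm.continuous.comp h.continuous_fderiv

theorem IsSmoothTest.memLp_gradient {φ : Space N → ℝ} (h : IsSmoothTest Ω φ) (p : ℝ≥0∞)
    {μ : Measure (Space N)} [IsFiniteMeasureOnCompacts μ] : MemLp (gradient φ) p μ := by
  refine h.continuous_gradient.memLp_of_hasCompactSupport ?_
  exact (h.compact.fderiv ℝ).comp_left (map_zero (InnerProductSpace.toDual ℝ (Space N)).symm)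

theorem gradient_comp {φ : Space N → ℝ} {g : ℝ → ℝ} {x : Space N} (hφ : DifferentiableAt ℝ φ x)
    (hg : DifferentiableAt ℝ g (φ x)) :
    gradient (fun y => g (φ y)) x = deriv g (φ x) • gradient φ x := by
  have h := hg.hasDerivAt.comp_hasFDerivAt x hφ.hasFDerivAt
  simp only [gradient]
  rw [show (fun y => g (φ y)) = g ∘ φ from rfl, h.fderiv, map_smul]

theorem IsH10WithGradient.exists_seq (h : IsH10WithGradient Ω f A) :
    ∃ φ : ℕ → Space N → ℝ, (∀ n, IsSmoothTest Ω (φ n)) ∧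
      Tendsto (fun n => eLpNorm (fun x => φ n x - f x) 2 (volume.restrict Ω)) atTop (𝓝 0) ∧
      Tendsto (fun n => eLpNorm (fun x => gradient (φ n) x - A x) 2 (volume.restrict Ω))
        atTop (𝓝 0) ∧
      ∀ᵐ x ∂(volume.restrict Ω), Tendsto (fun n => φ n x) atTop (𝓝 (f x)) := by
  obtain ⟨hf, hA, h⟩ := h
  have hpos : ∀ n : ℕ, (0 : ℝ≥0∞) < ((n : ℝ≥0∞) + 1)⁻¹ := fun n => by simp
  choose φ h1 h2 h3 h4 h5 using fun n : ℕ => h _ (hpos n)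
  have hlim : Tendsto (fun n : ℕ => ((n : ℝ≥0∞) + 1)⁻¹) atTop (𝓝 0) := by
    have := ENNReal.tendsto_inv_nat_nhds_zero.comp (tendsto_add_atTop_nat 1)
    refine this.congr fun n => ?_
    simp
  have hφ : ∀ n, IsSmoothTest Ω (φ n) := fun n => ⟨h1 n, h2 n, h3 n⟩
  have l1 : Tendsto (fun n => eLpNorm (fun x => φ n x - f x) 2 (volume.restrict Ω)) atTop (𝓝 0) :=
    tendsto_of_tendsto_of_tendsto_of_le_of_le tendsto_const_nhds hlim (fun _ => zero_le) h4
  have l2 : Tendsto (fun n => eLpNorm (fun x => gradient (φ n) x - A x) 2 (volume.restrict Ω))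
      atTop (𝓝 0) :=
    tendsto_of_tendsto_of_tendsto_of_le_of_le tendsto_const_nhds hlim (fun _ => zero_le) h5
  obtain ⟨ns, hns, hae⟩ := (tendstoInMeasure_of_tendsto_eLpNorm (p := 2) (by simp)
    (fun n => (hφ n).continuous.aestronglyMeasurable) hf.1 l1).exists_seq_tendsto_ae
  exact ⟨fun n => φ (ns n), fun n => hφ _, l1.comp hns.tendsto_atTop,
    l2.comp hns.tendsto_atTop, hae⟩

theorem IsH10WithGradient.of_tendsto (hf : MemLp f 2 (volume.restrict Ω))
    (hA : MemLp A 2 (volume.restrict Ω)) {φ : ℕ → Space N → ℝ} (hφ : ∀ n, IsSmoothTest Ω (φ n))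
    (h1 : Tendsto (fun n => eLpNorm (fun x => φ n x - f x) 2 (volume.restrict Ω)) atTop (𝓝 0))
    (h2 : Tendsto (fun n => eLpNorm (fun x => gradient (φ n) x - A x) 2 (volume.restrict Ω))
        atTop (𝓝 0)) : IsH10WithGradient Ω f A := by
  refine ⟨hf, hA, fun ε hε => ?_⟩
  obtain ⟨n, hn1, hn2⟩ := ((h1.eventually (ge_mem_nhds hε)).and
    (h2.eventually (ge_mem_nhds hε))).exists
  exact ⟨φ n, (hφ n).smooth, (hφ n).compact, (hφ n).support, hn1, hn2⟩

/-- The set of pairs `(f, ∇f)`, `f ∈ H¹₀(Ω)`, is closed in `L²`. -/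
theorem IsH10WithGradient.of_approx (hf : MemLp f 2 (volume.restrict Ω))
    (hA : MemLp A 2 (volume.restrict Ω)) {f' : ℕ → Space N → ℝ} {A' : ℕ → Space N → Space N}
    (hφ : ∀ n, IsH10WithGradient Ω (f' n) (A' n))
    (h1 : Tendsto (fun n => eLpNorm (fun x => f' n x - f x) 2 (volume.restrict Ω)) atTop (𝓝 0))
    (h2 : Tendsto (fun n => eLpNorm (fun x => A' n x - A x) 2 (volume.restrict Ω))
        atTop (𝓝 0)) : IsH10WithGradient Ω f A := by
  refine ⟨hf, hA, fun ε hε => ?_⟩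
  have hε2 : 0 < ε / 2 := ENNReal.half_pos hε.ne'
  obtain ⟨n, hn1, hn2⟩ := ((h1.eventually (ge_mem_nhds hε2)).and
    (h2.eventually (ge_mem_nhds hε2))).exists
  obtain ⟨φ, p1, p2, p3, p4, p5⟩ := (hφ n).2.2 _ hε2
  have hφt : IsSmoothTest Ω φ := ⟨p1, p2, p3⟩
  refine ⟨φ, p1, p2, p3, ?_, ?_⟩
  · calc eLpNorm (fun x => φ x - f x) 2 (volume.restrict Ω)
        = eLpNorm ((fun x => φ x - f' n x) + fun x => f' n x - f x) 2 (volume.restrict Ω) := by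
          congr 1; ext x; simp
      _ ≤ _ := eLpNorm_add_le (hφt.continuous.aestronglyMeasurable.sub (hφ n).1.1)
          ((hφ n).1.1.sub hf.1) (by simp)
      _ ≤ ε / 2 + ε / 2 := add_le_add p4 hn1
      _ = ε := ENNReal.add_halves ε
  · calc eLpNorm (fun x => gradient φ x - A x) 2 (volume.restrict Ω)
        = eLpNorm ((fun x => gradient φ x - A' n x) + fun x => A' n x - A x) 2
          (volume.restrict Ω) := by
          congr 1; ext x; simp
      _ ≤ _ := eLpNorm_add_le (hφt.continuous_gradient.aestronglyMeasurable.sub (hφ n).2.1.1)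
          ((hφ n).2.1.1.sub hA.1) (by simp)
      _ ≤ ε / 2 + ε / 2 := add_le_add p5 hn2
      _ = ε := ENNReal.add_halves ε

/-- The chain rule in `H¹₀`. -/
theorem IsH10WithGradient.comp (h : IsH10WithGradient Ω f A) {g : ℝ → ℝ} (hg : ContDiff ℝ ∞ g)
    (h0 : g 0 = 0) {C : ℝ} (hC : ∀ s, |deriv g s| ≤ C) :
    IsH10WithGradient Ω (fun x => g (f x)) (fun x => deriv g (f x) • A x) := by
  obtain ⟨φ, hφ, l1, l2, l3⟩ := h.exists_seq
  obtain ⟨hf, hA, -⟩ := h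
  have hC0 : 0 ≤ C := (abs_nonneg _).trans (hC 0)
  have hgd : Differentiable ℝ g := hg.differentiable (by simp)
  have hg'c : Continuous (deriv g) := hg.continuous_deriv (by simp)
  have hlip : ∀ s t, |g s - g t| ≤ C * |s - t| := fun s t => by
    have := Convex.norm_image_sub_le_of_norm_deriv_le (𝕜 := ℝ) (f := g) (C := C) (s := univ)
      (fun x _ => hgd x) (fun x _ => hC x) convex_univ (mem_univ t) (mem_univ s)
    simpa using this
  have m1 : MemLp (fun x => g (f x)) 2 (volume.restrict Ω) := by
    refine (hf.const_mul C).mono (hg.continuous.comp_aestronglyMeasurable hf.1)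
      (ae_of_all _ fun x => ?_)
    have := hlip (f x) 0
    simp only [h0, sub_zero] at this
    rw [Real.norm_eq_abs, Real.norm_eq_abs, abs_mul, abs_of_nonneg hC0]
    exact this
  have m2 : MemLp (fun x => deriv g (f x) • A x) 2 (volume.restrict Ω) := by
    refine (hA.const_smul C).mono ((hg'c.comp_aestronglyMeasurable hf.1).smul hA.1)
      (ae_of_all _ fun x => ?_)
    simp only [norm_smul, Pi.smul_apply, Real.norm_eq_abs, abs_of_nonneg hC0]
    gcongr
    exact hC _
  refine IsH10WithGradient.of_tendsto m1 m2 (fun n => (hφ n).comp hg h0) ?_ ?_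
  · have hb : Tendsto (fun n => ENNReal.ofReal C *
        eLpNorm (fun x => φ n x - f x) 2 (volume.restrict Ω)) atTop (𝓝 0) := by
      simpa using ENNReal.Tendsto.const_mul l1 (Or.inr ENNReal.ofReal_ne_top)
    refine tendsto_of_tendsto_of_tendsto_of_le_of_le tendsto_const_nhds hb (fun _ => zero_le)
      fun n => ?_
    exact eLpNorm_le_mul_eLpNorm_of_ae_le_mul (ae_of_all _ fun x => hlip _ _) _
  · have hb : Tendsto (fun n => ENNReal.ofReal C *
        eLpNorm (fun x => gradient (φ n) x - A x) 2 (volume.restrict Ω)) atTop (𝓝 0) := by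
      simpa using ENNReal.Tendsto.const_mul l2 (Or.inr ENNReal.ofReal_ne_top)
    -- Here `deriv g` is only continuous, so there is no rate: almost everywhere convergence of `φ
    -- n` and the majorant 2C‖A‖ are used instead.
    have hd : Tendsto (fun n => eLpNorm (fun x => (deriv g (φ n x) - deriv g (f x)) • A x) 2
        (volume.restrict Ω)) atTop (𝓝 0) := by
      refine tendsto_eLpNorm_zero_of_dominated (by simp) (by simp) (g := fun x => 2 * C * ‖A x‖)
        (fun n => ?_) (hA.norm.const_mul (2 * C)) (fun n => ae_of_all _ fun x => ?_) ?_
      · exact ((hg'c.comp (hφ n).continuous).aestronglyMeasurable.sub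
          (hg'c.comp_aestronglyMeasurable hf.1)).smul hA.1
      · rw [norm_smul]
        gcongr
        refine (norm_sub_le _ _).trans ?_
        have h1 := hC (φ n x)
        have h2 := hC (f x)
        simp only [Real.norm_eq_abs]
        linarith
      · filter_upwards [l3] with x hx
        have h1 : Tendsto (fun n => deriv g (φ n x)) atTop (𝓝 (deriv g (f x))) :=
          (hg'c.tendsto _).comp hx
        have := (h1.sub_const (deriv g (f x))).smul_const (A x)
        simpa using this
    have hsum := hb.add hd
    rw [add_zero] at hsum
    refine tendsto_of_tendsto_of_tendsto_of_le_of_le tendsto_const_nhds hsum (fun _ => zero_le)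
      fun n => ?_
    -- Moving the gradient first and the coefficient second separates the error into a part
    -- controlled by the bound on `deriv g` and a part controlled by dominated convergence.
    have e : (fun x => gradient (fun y => g (φ n y)) x - deriv g (f x) • A x)
        = (fun x => deriv g (φ n x) • (gradient (φ n) x - A x))
          + fun x => (deriv g (φ n x) - deriv g (f x)) • A x := by
      ext1 x
      rw [gradient_comp ((hφ n).differentiable x) (hgd _), Pi.add_apply, smul_sub, sub_smul]
      abel
    simp only []
    rw [e]
    refine (eLpNorm_add_le ?_ ?_ (by simp)).trans ?_
    · exact (hg'c.comp (hφ n).continuous).aestronglyMeasurable.smul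
        ((hφ n).continuous_gradient.aestronglyMeasurable.sub hA.1)
    · exact ((hg'c.comp (hφ n).continuous).aestronglyMeasurable.sub
          (hg'c.comp_aestronglyMeasurable hf.1)).smul hA.1
    · gcongr
      refine eLpNorm_le_mul_eLpNorm_of_ae_le_mul (ae_of_all _ fun x => ?_) _
      rw [norm_smul]
      gcongr
      exact hC _

theorem integral_mul_fderiv_of_isSmoothTest {φ ζ : Space N → ℝ} (hφ : IsSmoothTest Ω φ)
    (hζ : IsSmoothTest Ω ζ) (e : Space N) :
    ∫ x in Ω, φ x * fderiv ℝ ζ x e = -∫ x in Ω, ⟪gradient φ x, e⟫_ℝ * ζ x := by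
  have h := integral_mul_fderiv_eq_neg_fderiv_mul_of_integrable (μ := (volume : Measure (Space N)))
    (f := φ) (g := ζ) (v := e)
    ((hφ.memLp_fderiv 2 e).integrable_mul (hζ.memLp 2))
    ((hφ.memLp 2).integrable_mul (hζ.memLp_fderiv 2 e))
    ((hφ.memLp 2).integrable_mul (hζ.memLp 2)) (fun x _ => hφ.differentiable x)
    (fun x _ => hζ.differentiable x)
  rw [setIntegral_eq_integral_of_forall_compl_eq_zero, setIntegral_eq_integral_of_forall_compl_eq_zero, h]
  · congr 1
    refine integral_congr_ae (ae_of_all _ fun x => ?_)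
    simp [inner_gradient_left]
  · intro x hx
    rw [image_eq_zero_of_notMem_tsupport (fun h => hx (hζ.support h)), mul_zero]
  · intro x hx
    rw [image_eq_zero_of_notMem_tsupport (fun h => hx (hφ.support h)), zero_mul]

theorem IsH10WithGradient.integral_mul_fderiv (h : IsH10WithGradient Ω f A) {ζ : Space N → ℝ}
    (hζ : IsSmoothTest Ω ζ) (e : Space N) :
    ∫ x in Ω, f x * fderiv ℝ ζ x e = -∫ x in Ω, ⟪A x, e⟫_ℝ * ζ x := by
  obtain ⟨φ, hφ, l1, l2, -⟩ := h.exists_seq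
  have t1 := tendsto_integral_inner (fun n => (hφ n).memLp 2) h.1
    (hζ.memLp_fderiv 2 e (μ := volume.restrict Ω)) l1
  have hmζ : MemLp (fun x => ζ x • e) 2 (volume.restrict Ω) := by
    refine Continuous.memLp_of_hasCompactSupport (hζ.continuous.smul continuous_const) ?_
    exact hζ.compact.smul_right
  have t2 := tendsto_integral_inner (fun n => (hφ n).memLp_gradient 2) h.2.1 hmζ l2
  have hn : ∀ n, ∫ x in Ω, ⟪φ n x, fderiv ℝ ζ x e⟫_ℝ
      = -∫ x in Ω, ⟪gradient (φ n) x, ζ x • e⟫_ℝ := fun n => by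
    have := integral_mul_fderiv_of_isSmoothTest (hφ n) hζ e
    simp only [inner_smul_right]
    simpa [mul_comm] using this
  simp_rw [hn] at t1
  have := tendsto_nhds_unique t1 t2.neg
  simp only [inner_smul_right] at this
  simpa [mul_comm] using this

/-- The exponent `p` with `1/p = 1/2 + 1/N`. -/
def sobolevExp (N : ℕ) : NNReal := 2 * N / (N + 2)

/-- The constant in the Sobolev inequality on `ℝ^N`. -/
def sobolevConst (N : ℕ) : ℝ≥0∞ :=
  eLpNormLESNormFDerivOfEqInnerConst (volume : Measure (Space N)) (sobolevExp N)

theorem sobolevConst_ne_top (N : ℕ) : sobolevConst N ≠ ⊤ := ENNReal.coe_ne_top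

/-- The exponent whose Sobolev conjugate is 2 is at least 1 exactly when the dimension is at least
2. -/
theorem one_le_sobolevExp (hN : 2 ≤ N) : 1 ≤ sobolevExp N := by
  have hN' : (2 : NNReal) ≤ N := by exact_mod_cast hN
  unfold sobolevExp
  rw [le_div_iff₀ (by positivity), one_mul, two_mul]
  gcongr

theorem sobolevExp_le_two (N : ℕ) : sobolevExp N ≤ 2 := by
  unfold sobolevExp
  rw [div_le_iff₀ (by positivity)]
  gcongr
  exact le_self_add

/-- The Sobolev inequality in `H¹₀(Ω)`, `Ω` bounded. -/
theorem IsH10WithGradient.sobolev (h : IsH10WithGradient Ω f A) (hN : 2 ≤ N)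
    (hΩ : Bornology.IsBounded Ω) :
    eLpNorm f 2 (volume.restrict Ω)
      ≤ sobolevConst N * eLpNorm A (sobolevExp N) (volume.restrict Ω) := by
  obtain ⟨φ, hφ, l1, l2, -⟩ := h.exists_seq
  have hfin : IsFiniteMeasure (volume.restrict Ω) :=
    ⟨by rw [Measure.restrict_apply_univ]; exact hΩ.measure_lt_top⟩
  set p : ℝ≥0∞ := (sobolevExp N : ℝ≥0∞) with hp
  have hp1 : 1 ≤ p := by rw [hp]; exact_mod_cast one_le_sobolevExp hN
  have hp2 : p ≤ 2 := by rw [hp]; exact_mod_cast sobolevExp_le_two N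
  -- Hölder's factor between the exponents p and 2 on a bounded set. It multiplies only the
  -- approximation error, so it is absent from the final inequality.
  set c : ℝ≥0∞ := volume.restrict Ω univ ^ (1 / p.toReal - 1 / (2 : ℝ≥0∞).toReal) with hc
  have hcf : c ≠ ⊤ := by
    refine ENNReal.rpow_ne_top_of_nonneg ?_ (measure_ne_top _ _)
    rw [sub_nonneg]
    refine one_div_le_one_div_of_le (ENNReal.toReal_pos (one_pos.trans_le hp1).ne' (by simp [hp])) ?_
    exact ENNReal.toReal_mono (by simp) hp2
  have key : ∀ n, eLpNorm f 2 (volume.restrict Ω)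
      ≤ eLpNorm (fun x => φ n x - f x) 2 (volume.restrict Ω)
        + sobolevConst N * (eLpNorm A p (volume.restrict Ω)
          + eLpNorm (fun x => gradient (φ n) x - A x) 2 (volume.restrict Ω) * c) := by
    intro n
    have hφm : AEStronglyMeasurable (φ n) (volume.restrict Ω) :=
      (hφ n).continuous.aestronglyMeasurable
    have s1 : eLpNorm f 2 (volume.restrict Ω)
        ≤ eLpNorm (fun x => φ n x - f x) 2 (volume.restrict Ω)
          + eLpNorm (φ n) 2 (volume.restrict Ω) := by
      have e : f = (fun x => f x - φ n x) + φ n := by ext x; simp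
      conv_lhs => rw [e]
      refine (eLpNorm_add_le (h.1.1.sub hφm) hφm (by simp)).trans (le_of_eq ?_)
      congr 1
      exact eLpNorm_sub_comm _ _ _ _
    have s2 : eLpNorm (φ n) 2 (volume.restrict Ω)
        ≤ sobolevConst N * eLpNorm (gradient (φ n)) p (volume.restrict Ω) := by
      have hN0 : (0 : ℝ) < N := by exact_mod_cast (by omega : 0 < N)
      have := eLpNorm_le_eLpNorm_fderiv_of_eq_inner (μ := (volume : Measure (Space N)))
        ((hφ n).smooth.of_le (by simp)) (hφ n).compact (p := sobolevExp N) (p' := 2)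
        (one_le_sobolevExp hN) (by simp; omega)
        (by
          simp only [finrank_euclideanSpace, Fintype.card_fin, sobolevExp]
          push_cast
          field_simp
          ring)
      have hr : eLpNorm (gradient (φ n)) p (volume.restrict Ω)
          = eLpNorm (fderiv ℝ (φ n)) p volume := by
        rw [eLpNorm_restrict_eq_of_support_subset]
        · exact eLpNorm_congr_norm_ae (ae_of_all _ fun x => norm_gradient _ _)
        · intro x hx
          apply (hφ n).support
          apply support_fderiv_subset ℝ
          intro h0
          apply hx
          rw [← norm_eq_zero, norm_gradient, h0, norm_zero]
      rw [hr]
      exact (eLpNorm_mono_measure _ Measure.restrict_le_self).trans (by exact_mod_cast this)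
    have s3 : eLpNorm (gradient (φ n)) p (volume.restrict Ω) ≤ eLpNorm A p (volume.restrict Ω)
          + eLpNorm (fun x => gradient (φ n) x - A x) 2 (volume.restrict Ω) * c := by
      have hm := (hφ n).continuous_gradient.aestronglyMeasurable (μ := volume.restrict Ω)
      have e : gradient (φ n) = A + fun x => gradient (φ n) x - A x := by ext1 x; simp
      conv_lhs => rw [e]
      refine (eLpNorm_add_le h.2.1.1 (hm.sub h.2.1.1) hp1).trans ?_
      gcongr
      exact eLpNorm_le_eLpNorm_mul_rpow_measure_univ hp2 (hm.sub h.2.1.1)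
    refine s1.trans ?_
    gcongr
    exact s2.trans (by gcongr)
  refine ge_of_tendsto' (x := atTop) ?_ key
  have t1 : Tendsto (fun n => eLpNorm (fun x => gradient (φ n) x - A x) 2 (volume.restrict Ω) * c)
      atTop (𝓝 0) := by
    simpa using ENNReal.Tendsto.mul_const l2 (Or.inr hcf)
  have t2 := l1.add (ENNReal.Tendsto.const_mul (t1.const_add (eLpNorm A p (volume.restrict Ω)))
    (Or.inr (sobolevConst_ne_top N)))
  simpa using t2

end Slice

end

/-! ### Mollification and calculus of weak derivatives -/

section

section Mollify

variable {X F : Type*} [NormedAddCommGroup X] [NormedSpace ℝ X] [FiniteDimensional ℝ X]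
  [MeasurableSpace X] [BorelSpace X] {μ : Measure X} [μ.IsAddHaarMeasure]
  [NormedAddCommGroup F] [NormedSpace ℝ F]

open ContinuousLinearMap in
open scoped Convolution in
/-- The mollification of `f` by a normalized bump function. -/
def mollify (μ : Measure X) (φ : ContDiffBump (0 : X)) (f : X → F) : X → F :=
  φ.normed μ ⋆[lsmul ℝ ℝ, μ] f

theorem mollify_apply (φ : ContDiffBump (0 : X)) (f : X → F) (x : X) :
    mollify μ φ f x = ∫ y, φ.normed μ (x - y) • f y ∂μ := by
  simp [mollify, convolution_eq_swap]

theorem contDiff_mollify [CompleteSpace F] (φ : ContDiffBump (0 : X)) {f : X → F}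
    (hf : LocallyIntegrable f μ) : ContDiff ℝ ∞ (mollify μ φ f) :=
  φ.hasCompactSupport_normed.contDiff_convolution_left _ (n := ⊤) φ.contDiff_normed hf

theorem fderiv_mollify (φ : ContDiffBump (0 : X)) {f : X → ℝ} (hf : LocallyIntegrable f μ)
    (x v : X) :
    fderiv ℝ (mollify μ φ f) x v = ∫ y, fderiv ℝ (φ.normed μ) (x - y) v * f y ∂μ := by
  have hc := φ.contDiff_normed (μ := μ) (n := 1)
  have h := (φ.hasCompactSupport_normed (μ := μ)).hasFDerivAt_convolution_right
    (ContinuousLinearMap.lsmul ℝ ℝ).flip hf hc x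
  rw [convolution_flip] at h
  unfold mollify
  rw [h.fderiv, convolution_precompR_apply _ hf (φ.hasCompactSupport_normed.fderiv ℝ)
    (hc.continuous_fderiv (by simp))]
  simp [convolution_def]

theorem tsupport_mollify_subset (φ : ContDiffBump (0 : X)) (f : X → F) :
    tsupport (mollify μ φ f) ⊆ Metric.cthickening φ.rOut (tsupport f) := by
  refine (closure_mono ?_).trans (Metric.closure_thickening_subset_cthickening _ _)
  refine (support_convolution_subset _).trans ?_
  rw [φ.support_normed_eq]
  rintro _ ⟨y, hy, z, hz, rfl⟩
  rw [Metric.mem_thickening_iff]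
  exact ⟨z, subset_tsupport _ hz, by simpa using hy⟩

theorem norm_mollify_le (φ : ContDiffBump (0 : X)) {f : X → F} {L : ℝ} (hf : ∀ x, ‖f x‖ ≤ L)
    (x : X) : ‖mollify μ φ f x‖ ≤ L := by
  simp only [mollify, convolution_def, ContinuousLinearMap.lsmul_apply]
  calc ‖∫ t, φ.normed μ t • f (x - t) ∂μ‖ ≤ ∫ t, φ.normed μ t * L ∂μ := by
        refine norm_integral_le_of_norm_le (φ.integrable_normed.mul_const L)
          (ae_of_all _ fun t => ?_)
        rw [norm_smul, Real.norm_of_nonneg (φ.nonneg_normed t)]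
        exact mul_le_mul_of_nonneg_left (hf _) (φ.nonneg_normed t)
    _ = L := by rw [integral_mul_const, φ.integral_normed, one_mul]

/-- The bump function at the origin with radii `r / 2` and `r`. -/
def smallBump (X : Type*) [NormedAddCommGroup X] [NormedSpace ℝ X] (r : ℝ) (hr : 0 < r) :
    ContDiffBump (0 : X) :=
  ⟨r / 2, r, by positivity, by linarith⟩

theorem ae_tendsto_mollify [CompleteSpace F] {δ : ℝ} (hδ : 0 < δ) {f : X → F}
    (hf : LocallyIntegrable f μ) :
    ∀ᵐ x ∂μ, Tendsto (fun n : ℕ => mollify μ (smallBump X (δ / (n + 1)) (by positivity)) f x)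
      atTop (𝓝 (f x)) := by
  refine ContDiffBump.ae_convolution_tendsto_right_of_locallyIntegrable (K := 2) ?_ ?_ hf
  · exact tendsto_const_div_atTop_nhds_zero_nat δ |>.comp (tendsto_add_atTop_nat 1) |>.congr
      fun n => by simp [smallBump]
  · exact Eventually.of_forall fun n => by simp only [smallBump]; linarith

end Mollify

section WeakDeriv

variable {X : Type*} [NormedAddCommGroup X] [NormedSpace ℝ X] [FiniteDimensional ℝ X]
  [MeasurableSpace X] [BorelSpace X] {μ : Measure X} [μ.IsAddHaarMeasure] {U : Set X} {v : X}

theorem isSmoothTest_mollify (φ : ContDiffBump (0 : X)) {f : X → ℝ}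
    (hf : LocallyIntegrable f μ) (hc : HasCompactSupport f)
    (hU : Metric.cthickening φ.rOut (tsupport f) ⊆ U) : IsSmoothTest U (mollify μ φ f) := by
  have : ProperSpace X := FiniteDimensional.proper ℝ X
  refine ⟨contDiff_mollify φ hf, ?_, (tsupport_mollify_subset φ f).trans hU⟩
  exact (hc.isCompact.cthickening).of_isClosed_subset (isClosed_tsupport _)
    (tsupport_mollify_subset φ f)

/-- `g` is the weak derivative of `w` on `U` in the direction `v`. -/
def HasWeakDeriv (μ : Measure X) (U : Set X) (v : X) (w g : X → ℝ) : Prop :=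
  ∀ φ, IsSmoothTest U φ → ∫ x in U, w x * fderiv ℝ φ x v ∂μ = -∫ x in U, g x * φ x ∂μ

omit [BorelSpace X] [μ.IsAddHaarMeasure] in
theorem fderiv_normed_neg (φ : ContDiffBump (0 : X)) (x v : X) :
    fderiv ℝ (φ.normed μ) (-x) v = -fderiv ℝ (φ.normed μ) x v := by
  have h : (fun y => φ.normed μ (-y)) = φ.normed μ := by
    ext y; exact φ.normed_neg y
  have hd : HasFDerivAt (φ.normed μ) (fderiv ℝ (φ.normed μ) (-x)) (-x) :=
    ((φ.contDiff_normed (μ := μ) (n := 1)).differentiable (by simp) (-x)).hasFDerivAt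
  have := (hd.comp x (hasFDerivAt_id x).neg).fderiv
  rw [show φ.normed μ ∘ Neg.neg = fun y => φ.normed μ (-y) from rfl, h] at this
  rw [this]; simp

/-- The kernel is even, so its derivative is odd: exchanging the two variables by Fubini transposes
the operator at the cost of a sign. This is how the derivative of a mollified factor is moved onto
the other factor in the product rule. -/
theorem integral_mul_fderiv_mollify (φ : ContDiffBump (0 : X)) {f b : X → ℝ} (hf : Integrable f μ)
    (hb : Integrable b μ) (v : X) :
    ∫ x, f x * fderiv ℝ (mollify μ φ b) x v ∂μ
      = -∫ y, b y * fderiv ℝ (mollify μ φ f) y v ∂μ := by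
  simp_rw [fderiv_mollify φ hb.locallyIntegrable, fderiv_mollify φ hf.locallyIntegrable,
    ← integral_const_mul]
  have hc : Continuous fun x => fderiv ℝ (φ.normed μ) x v :=
    ((φ.contDiff_normed (μ := μ) (n := 1)).continuous_fderiv (by simp)).clm_apply continuous_const
  obtain ⟨B, hB⟩ := ((φ.hasCompactSupport_normed (μ := μ)).fderiv ℝ).exists_bound_of_continuous
    ((φ.contDiff_normed (μ := μ) (n := 1)).continuous_fderiv (by simp))
  have hInt : Integrable (Function.uncurry fun x y =>
      f x * (fderiv ℝ (φ.normed μ) (x - y) v * b y)) (μ.prod μ) := by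
    have h1 := hf.mul_prod hb
    have h2 := h1.bdd_mul (c := B * ‖v‖)
      (f := fun z : X × X => fderiv ℝ (φ.normed μ) (z.1 - z.2) v)
      (hc.comp (continuous_fst.sub continuous_snd)).aestronglyMeasurable
      (ae_of_all _ fun z => (ContinuousLinearMap.le_opNorm _ _).trans (by gcongr; exact hB _))
    refine h2.congr (ae_of_all _ fun z => ?_)
    simp only [Function.uncurry]; ring
  rw [integral_integral_swap hInt, ← integral_neg]
  congr 1; ext y
  rw [← integral_neg]
  congr 1; ext x
  rw [← neg_sub y x, fderiv_normed_neg]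
  ring

/-- The product rule for bounded functions with weak derivatives. -/
theorem HasWeakDeriv.mul (hU : IsOpen U) (hUμ : μ U ≠ ⊤) {w b g c : X → ℝ} {L : ℝ}
    (hwm : AEStronglyMeasurable w (μ.restrict U)) (hbm : AEStronglyMeasurable b (μ.restrict U))
    (hwL : ∀ x, |w x| ≤ L) (hbL : ∀ x, |b x| ≤ L)
    (hg : LocallyIntegrableOn g U μ) (hc : LocallyIntegrableOn c U μ)
    (hw : HasWeakDeriv μ U v w g) (hb : HasWeakDeriv μ U v b c) :
    HasWeakDeriv μ U v (fun x => w x * b x) (fun x => b x * g x + w x * c x) := by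
  intro ζ hζ
  have : ProperSpace X := FiniteDimensional.proper ℝ X
  have : IsFiniteMeasure (μ.restrict U) := ⟨by simpa using hUμ.lt_top⟩
  have hUm := hU.measurableSet
  have hL0 : 0 ≤ L := (abs_nonneg _).trans (hwL 0)
  -- Mollifiers of radius at most δ keep everything derived from ζ inside the compact set `K` in
  -- `U`, on which the merely locally integrable `g` and `c` are integrable.
  obtain ⟨δ, hδ, hδU⟩ := hζ.compact.isCompact.exists_cthickening_subset_open hU hζ.support
  obtain ⟨B, hB⟩ := hζ.exists_bound
  have hB0 : 0 ≤ B := (abs_nonneg _).trans (hB 0)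
  set K := Metric.cthickening δ (tsupport ζ) with hK
  have hKc : IsCompact K := hζ.compact.isCompact.cthickening
  have hζK : tsupport ζ ⊆ K := Metric.self_subset_cthickening _
  have hζK0 : ∀ x, x ∉ K → ζ x = 0 := fun x hx =>
    image_eq_zero_of_notMem_tsupport (fun h => hx (hζK h))
  have hgK := hg.integrableOn_compact_subset hδU hKc
  have hcK := hc.integrableOn_compact_subset hδU hKc
  let b' := U.indicator b
  let wz : X → ℝ := U.indicator fun x => w x * ζ x
  have hb'i : Integrable b' μ := by
    rw [integrable_indicator_iff hUm]
    exact (MemLp.of_bound hbm L (ae_of_all _ hbL) : MemLp b ⊤ _).integrable le_top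
  have hwzi : Integrable wz μ := by
    rw [integrable_indicator_iff hUm]
    refine (MemLp.of_bound (hwm.mul hζ.continuous.aestronglyMeasurable) (L * B)
      (ae_of_all _ fun x => ?_) : MemLp (fun x => w x * ζ x) ⊤ _).integrable le_top
    rw [norm_mul]; exact mul_le_mul (hwL x) (hB x) (norm_nonneg _) hL0
  have hb'L : ∀ x, ‖b' x‖ ≤ L := fun x => by
    by_cases hx : x ∈ U
    · simpa [b', hx] using hbL x
    · simpa [b', hx] using hL0
  have hwzL : ∀ x, ‖wz x‖ ≤ L * B := fun x => by
    by_cases hx : x ∈ U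
    · simp only [wz, hx, indicator_of_mem, norm_mul]
      exact mul_le_mul (hwL x) (hB x) (norm_nonneg _) hL0
    · simpa [wz, hx] using mul_nonneg hL0 hB0
  have hwzs : tsupport wz ⊆ tsupport ζ := closure_mono fun x hx h0 => hx (by simp [wz, h0])
  have hwzc : HasCompactSupport wz :=
    hζ.compact.isCompact.of_isClosed_subset (isClosed_tsupport _) hwzs
  let ρ : ℕ → ContDiffBump (0 : X) := fun n => smallBump X (δ / (n + 1)) (by positivity)
  have hρr : ∀ n, (ρ n).rOut ≤ δ := fun n => by
    simp only [ρ, smallBump]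
    exact div_le_self hδ.le (by linarith [n.cast_nonneg (α := ℝ)])
  let bn : ℕ → X → ℝ := fun n => mollify μ (ρ n) b'
  let wn : ℕ → X → ℝ := fun n => mollify μ (ρ n) wz
  have hbns : ∀ n, ContDiff ℝ ∞ (bn n) := fun n => contDiff_mollify _ hb'i.locallyIntegrable
  have hwn : ∀ n, IsSmoothTest U (wn n) := fun n =>
    isSmoothTest_mollify _ hwzi.locallyIntegrable hwzc
      (((Metric.cthickening_mono (hρr n) _).trans (Metric.cthickening_subset_of_subset _ hwzs)).trans
        hδU)
  have hwnK : ∀ n x, x ∉ K → wn n x = 0 := fun n x hx => by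
    refine image_eq_zero_of_notMem_tsupport fun h => hx ?_
    exact (Metric.cthickening_mono (hρr n) _) (Metric.cthickening_subset_of_subset _ hwzs
      (tsupport_mollify_subset _ _ h))
  -- Two admissible tests are combined: `bn n * ζ` in the identity for `w`, and the mollification of
  -- `w * ζ` in the identity for `b`. The transposition of the mollifier shows that the terms
  -- containing the derivative of `bn n` cancel.
  have key : ∀ n, ∫ x in U, w x * bn n x * fderiv ℝ ζ x v ∂μ + ∫ x in U, c x * wn n x ∂μ
      = -∫ x in U, g x * (bn n x * ζ x) ∂μ := by
    intro n
    have h1 := hw _ (hζ.mul_left (hbns n))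
    have h2 := hb _ (hwn n)
    have h3 := integral_mul_fderiv_mollify (ρ n) hwzi hb'i v
    have e1 : ∫ x, wz x * fderiv ℝ (bn n) x v ∂μ
        = ∫ x in U, w x * (ζ x * fderiv ℝ (bn n) x v) ∂μ := by
      rw [← integral_indicator hUm]
      congr 1; ext x
      by_cases hx : x ∈ U <;> simp [wz, hx, mul_assoc]
    have e2 : ∫ y, b' y * fderiv ℝ (wn n) y v ∂μ = ∫ y in U, b y * fderiv ℝ (wn n) y v ∂μ := by
      rw [← integral_indicator hUm]
      congr 1; ext x
      by_cases hx : x ∈ U <;> simp [b', hx]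
    have e3 : ∫ x in U, w x * fderiv ℝ (fun x => bn n x * ζ x) x v ∂μ
        = ∫ x in U, w x * bn n x * fderiv ℝ ζ x v ∂μ
          + ∫ x in U, w x * (ζ x * fderiv ℝ (bn n) x v) ∂μ := by
      rw [← integral_add]
      · congr 1; ext x
        have := (((hbns n).differentiable (by simp) x).hasFDerivAt.mul
          (hζ.differentiable x).hasFDerivAt).fderiv
        rw [show (fun x => bn n x * ζ x) = bn n * ζ from rfl, this]
        simp; ring
      · refine Integrable.bdd_mul (c := L * L) ((hζ.memLp_fderiv 1 v).integrable le_rfl) ?_ ?_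
        · exact hwm.mul (hbns n).continuous.aestronglyMeasurable
        · refine ae_of_all _ fun x => ?_
          rw [norm_mul]
          exact mul_le_mul (hwL x) (norm_mollify_le _ hb'L x) (norm_nonneg _) hL0
      · refine Integrable.bdd_mul (c := L) ?_ hwm (ae_of_all _ hwL)
        refine Continuous.integrable_of_hasCompactSupport ?_ hζ.compact.mul_right
        exact hζ.continuous.mul (((hbns n).continuous_fderiv (by simp)).clm_apply continuous_const)
    change ∫ x, wz x * fderiv ℝ (bn n) x v ∂μ = -∫ y, b' y * fderiv ℝ (wn n) y v ∂μ at h3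
    rw [e1, e2, h2, neg_neg] at h3
    rw [e3, h3] at h1
    exact h1
  -- Mollification does not increase sup norms, so almost everywhere convergence suffices to pass to
  -- the limit, without any integrability of `g` and `c` beyond `L¹` on `K`.
  have aeb : ∀ᵐ x ∂μ.restrict U, Tendsto (fun n => bn n x) atTop (𝓝 (b x)) := by
    have := ae_restrict_of_ae (s := U) (ae_tendsto_mollify hδ hb'i.locallyIntegrable)
    filter_upwards [this, ae_restrict_mem hUm] with x hx hxU
    simpa [b', hxU] using hx
  have aew : ∀ᵐ x ∂μ.restrict U, Tendsto (fun n => wn n x) atTop (𝓝 (w x * ζ x)) := by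
    have := ae_restrict_of_ae (s := U) (ae_tendsto_mollify hδ hwzi.locallyIntegrable)
    filter_upwards [this, ae_restrict_mem hUm] with x hx hxU
    simpa [wz, hxU] using hx
  have hindK : ∀ f : X → ℝ, IntegrableOn f K μ → Integrable (K.indicator f) (μ.restrict U) :=
    fun f hf => ((integrable_indicator_iff hKc.measurableSet).2 hf).restrict
  have hgm := (hg.aestronglyMeasurable)
  have hcm := (hc.aestronglyMeasurable)
  have t1 : Tendsto (fun n => ∫ x in U, w x * bn n x * fderiv ℝ ζ x v ∂μ) atTop
      (𝓝 (∫ x in U, w x * b x * fderiv ℝ ζ x v ∂μ)) := by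
    refine tendsto_integral_of_dominated_convergence (fun x => L * L * ‖fderiv ℝ ζ x v‖)
      (fun n => ?_) ?_ (fun n => ae_of_all _ fun x => ?_) ?_
    · exact (hwm.mul (hbns n).continuous.aestronglyMeasurable).mul
        (hζ.continuous_fderiv.clm_apply continuous_const).aestronglyMeasurable
    · exact ((hζ.memLp_fderiv 1 v).integrable le_rfl).norm.const_mul _
    · rw [norm_mul, norm_mul]
      gcongr
      exacts [hwL x, norm_mollify_le _ hb'L x]
    · filter_upwards [aeb] with x hx
      exact (hx.const_mul _).mul_const _
  have t2 : Tendsto (fun n => ∫ x in U, c x * wn n x ∂μ) atTop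
      (𝓝 (∫ x in U, c x * (w x * ζ x) ∂μ)) := by
    refine tendsto_integral_of_dominated_convergence (fun x => K.indicator (fun x => ‖c x‖) x * (L * B))
      (fun n => ?_) ?_ (fun n => ae_of_all _ fun x => ?_) ?_
    · exact hcm.mul (hwn n).continuous.aestronglyMeasurable
    · exact (hindK _ hcK.norm).mul_const _
    · by_cases hx : x ∈ K
      · rw [norm_mul, indicator_of_mem hx]
        gcongr
        exact norm_mollify_le _ hwzL x
      · simp [hwnK n x hx, hx]
    · filter_upwards [aew] with x hx
      exact hx.const_mul _
  have t3 : Tendsto (fun n => ∫ x in U, g x * (bn n x * ζ x) ∂μ) atTop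
      (𝓝 (∫ x in U, g x * (b x * ζ x) ∂μ)) := by
    refine tendsto_integral_of_dominated_convergence (fun x => K.indicator (fun x => ‖g x‖) x * (L * B))
      (fun n => ?_) ?_ (fun n => ae_of_all _ fun x => ?_) ?_
    · exact hgm.mul ((hbns n).continuous.mul hζ.continuous).aestronglyMeasurable
    · exact (hindK _ hgK.norm).mul_const _
    · by_cases hx : x ∈ K
      · rw [norm_mul, norm_mul, indicator_of_mem hx]
        gcongr
        exacts [norm_mollify_le _ hb'L x, hB x]
      · simp [hζK0 x hx, hx]
    · filter_upwards [aeb] with x hx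
      exact (hx.mul_const _).const_mul _
  have tl := tendsto_nhds_unique (t1.add t2) (t3.neg.congr fun n => (key n).symm)
  have i1 : Integrable (fun x => c x * (w x * ζ x)) (μ.restrict U) := by
    refine ((hindK _ hcK.norm).mul_const (L * B)).mono'
      (hcm.mul (hwm.mul hζ.continuous.aestronglyMeasurable)) (ae_of_all _ fun x => ?_)
    by_cases hx : x ∈ K
    · rw [norm_mul, norm_mul, indicator_of_mem hx]
      gcongr
      exacts [hwL x, hB x]
    · simp [hζK0 x hx, hx]
  have i2 : Integrable (fun x => g x * (b x * ζ x)) (μ.restrict U) := by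
    refine ((hindK _ hgK.norm).mul_const (L * B)).mono'
      (hgm.mul (hbm.mul hζ.continuous.aestronglyMeasurable)) (ae_of_all _ fun x => ?_)
    by_cases hx : x ∈ K
    · rw [norm_mul, norm_mul, indicator_of_mem hx]
      gcongr
      exacts [hbL x, hB x]
    · simp [hζK0 x hx, hx]
  have e4 : ∫ x in U, (b x * g x + w x * c x) * ζ x ∂μ
      = ∫ x in U, g x * (b x * ζ x) ∂μ + ∫ x in U, c x * (w x * ζ x) ∂μ := by
    rw [← integral_add i2 i1]; congr 1; ext x; ring
  rw [e4]; linarith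

end WeakDeriv

/-- Weak derivatives are unique. -/
theorem HasWeakDeriv.ae_eq {X : Type*} [NormedAddCommGroup X] [NormedSpace ℝ X]
    [FiniteDimensional ℝ X] [MeasurableSpace X] [BorelSpace X] {μ : Measure X} {U : Set X} {v : X}
    (hU : IsOpen U) {w g g' : X → ℝ} (hg : LocallyIntegrableOn g U μ)
    (hg' : LocallyIntegrableOn g' U μ) (h : HasWeakDeriv μ U v w g) (h' : HasWeakDeriv μ U v w g') :
    g =ᵐ[μ.restrict U] g' := by
  have hlic : LocallyIntegrableOn (fun x => g x - g' x) U μ := hg.sub hg'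
  have := hU.ae_eq_zero_of_integral_contDiff_smul_eq_zero hlic fun φ h1 h2 h3 => by
    have hφ : IsSmoothTest U φ := ⟨h1, h2, h3⟩
    have e := neg_injective ((h φ hφ).symm.trans (h' φ hφ))
    have hi : ∀ f : X → ℝ, LocallyIntegrableOn f U μ → Integrable (fun x => f x * φ x) (μ.restrict U) := by
      intro f hf
      have := hf.integrableOn_compact_subset h3 h2.isCompact
      obtain ⟨B, hB⟩ := hφ.exists_bound
      have hi : Integrable ((tsupport φ).indicator f) (μ.restrict U) :=
        ((integrable_indicator_iff (isClosed_tsupport _).measurableSet).2 this).restrict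
      refine (hi.mul_bdd (c := B) hφ.continuous.aestronglyMeasurable
        (ae_of_all _ hB)).congr (ae_of_all _ fun x => ?_)
      by_cases hx : x ∈ tsupport φ
      · simp [hx]
      · simp [hx, image_eq_zero_of_notMem_tsupport hx]
    have e2 : ∫ x in U, φ x • (g x - g' x) ∂μ = 0 := by
      have : (fun x => φ x • (g x - g' x)) = fun x => g x * φ x - g' x * φ x := by
        ext x; simp; ring
      rw [this, integral_sub (hi g hg) (hi g' hg'), e, sub_self]
    rw [← e2, setIntegral_eq_integral_of_forall_compl_eq_zero]
    intro x hx
    rw [image_eq_zero_of_notMem_tsupport (fun h => hx (h3 h)), zero_smul]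
  rw [EventuallyEq, ae_restrict_iff' hU.measurableSet]
  filter_upwards [this] with x hx hxU
  exact sub_eq_zero.1 (hx hxU)

end

/-! ### Membership in `H¹₀` by cutoff, and a countable dense family of tests -/

section

variable {N : ℕ} {Ω : Set (Space N)}

/-- The standard basis vectors of `ℝ^N`. -/
abbrev basisVec (i : Fin N) : Space N := EuclideanSpace.single i 1

theorem inner_basisVec (x : Space N) (i : Fin N) : ⟪x, basisVec i⟫_ℝ = x i := by
  simp [basisVec, EuclideanSpace.inner_single_right]

theorem gradient_apply (φ : Space N → ℝ) (x : Space N) (i : Fin N) :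
    gradient φ x i = fderiv ℝ φ x (basisVec i) := by
  rw [← inner_basisVec, inner_gradient_left]

theorem norm_coord_le (x : Space N) (i : Fin N) : ‖x i‖ ≤ ‖x‖ := PiLp.norm_apply_le x i

theorem aestronglyMeasurable_coord {α : Type*} [MeasurableSpace α] {μ : Measure α}
    {B : α → Space N} (hB : AEStronglyMeasurable B μ) (i : Fin N) :
    AEStronglyMeasurable (fun x => B x i) μ :=
  (PiLp.continuous_apply 2 (fun _ : Fin N => ℝ) i).comp_aestronglyMeasurable hB

theorem memLp_coord {α : Type*} [MeasurableSpace α] {μ : Measure α} {p : ℝ≥0∞}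
    {B : α → Space N} (hB : MemLp B p μ) (i : Fin N) : MemLp (fun x => B x i) p μ :=
  hB.mono (aestronglyMeasurable_coord hB.1 i) (ae_of_all _ fun _ => norm_coord_le _ _)

/-- Cutting off a bounded function with square integrable weak gradient gives an element of
`H¹₀`. -/
theorem isH10WithGradient_mul_test (hΩ : IsOpen Ω) (hΩμ : volume Ω ≠ ⊤)
    {f : Space N → ℝ} {B : Space N → Space N} {R : ℝ}
    (hfm : AEStronglyMeasurable f (volume.restrict Ω)) (hfR : ∀ x, |f x| ≤ R)
    (hB : MemLp B 2 (volume.restrict Ω))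
    (hw : ∀ i, HasWeakDeriv volume Ω (basisVec i) f (fun x => B x i))
    {χ : Space N → ℝ} (hχ : IsSmoothTest Ω χ) :
    IsH10WithGradient Ω (fun x => f x * χ x) (fun x => χ x • B x + f x • gradient χ x) := by
  have hΩm := hΩ.measurableSet
  have hfin : IsFiniteMeasure (volume.restrict Ω) := ⟨by simpa using hΩμ.lt_top⟩
  have hR0 : 0 ≤ R := (abs_nonneg _).trans (hfR 0)
  obtain ⟨C, hC⟩ := hχ.exists_bound
  have hC0 : 0 ≤ C := (abs_nonneg _).trans (hC 0)
  set F : Space N → ℝ := fun x => f x * χ x with hF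
  set D : Space N → Space N := fun x => χ x • B x + f x • gradient χ x with hD
  have hχm : AEStronglyMeasurable χ (volume.restrict Ω) := hχ.continuous.aestronglyMeasurable
  have mF : MemLp F 2 (volume.restrict Ω) := by
    refine ((hχ.memLp 2).const_mul R).mono (hfm.mul hχm) (ae_of_all _ fun x => ?_)
    rw [norm_mul, norm_mul, Real.norm_of_nonneg hR0]
    gcongr
    exact hfR x
  have mD1 : MemLp (fun x => χ x • B x) 2 (volume.restrict Ω) := by
    refine (hB.const_smul C).mono (hχm.smul hB.1) (ae_of_all _ fun x => ?_)
    rw [norm_smul, Pi.smul_apply, norm_smul, Real.norm_of_nonneg hC0]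
    gcongr
    exact hC x
  have mD2 : MemLp (fun x => f x • gradient χ x) 2 (volume.restrict Ω) := by
    refine ((hχ.memLp_gradient 2).const_smul R).mono
      (hfm.smul hχ.continuous_gradient.aestronglyMeasurable) (ae_of_all _ fun x => ?_)
    rw [norm_smul, Pi.smul_apply, norm_smul, Real.norm_of_nonneg hR0]
    gcongr
    exact hfR x
  have mD : MemLp D 2 (volume.restrict Ω) := mD1.add mD2
  have mF' : MemLp (Ω.indicator F) 2 volume := (memLp_indicator_iff_restrict hΩm).2 mF
  have mD' : MemLp (Ω.indicator D) 2 volume := (memLp_indicator_iff_restrict hΩm).2 mD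
  have lF : LocallyIntegrable (Ω.indicator F) volume := mF'.locallyIntegrable (by simp)
  have lD : LocallyIntegrable (Ω.indicator D) volume := mD'.locallyIntegrable (by simp)
  have hsupp : tsupport (Ω.indicator F) ⊆ tsupport χ :=
    closure_mono fun x hx h0 => hx (by simp [hF, h0])
  have hcs : HasCompactSupport (Ω.indicator F) :=
    hχ.compact.isCompact.of_isClosed_subset (isClosed_tsupport _) hsupp
  obtain ⟨δ, hδ, hδΩ⟩ := hχ.compact.isCompact.exists_cthickening_subset_open hΩ hχ.support
  -- For fixed x the function y ↦ k(x − y)χ(y) is a test function in Ω. Inserting it in the weak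
  -- derivative of `f` shows that mollification commutes with the gradient, including across the
  -- boundary of Ω, where the extension by zero is harmless because χ vanishes there.
  have hgrad : ∀ (ρ : ContDiffBump (0 : Space N)) (x : Space N),
      gradient (mollify volume ρ (Ω.indicator F)) x = mollify volume ρ (Ω.indicator D) x := by
    intro ρ x
    set k : Space N → ℝ := ρ.normed volume with hk
    have hks : ContDiff ℝ ∞ k := ρ.contDiff_normed (n := ⊤)
    have hkb : ∃ c, ∀ y, ‖k y‖ ≤ c :=
      ρ.hasCompactSupport_normed.exists_bound_of_continuous hks.continuous
    obtain ⟨c, hc⟩ := hkb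
    have hkx : ContDiff ℝ ∞ fun y => k (x - y) := hks.comp (contDiff_const.sub contDiff_id)
    have hkd : ∀ y e, fderiv ℝ (fun y => k (x - y)) y e = -fderiv ℝ k (x - y) e := fun y e => by
      have h1 := (hks.differentiable (by simp) (x - y)).hasFDerivAt
      have h2 := h1.comp y ((hasFDerivAt_id y).const_sub x)
      have h3 : fderiv ℝ (fun y => k (x - y)) y = _ := h2.fderiv
      rw [h3]; simp
    ext i
    rw [gradient_apply, fderiv_mollify ρ lF, mollify_apply]
    have hDi : Integrable (fun y => k (x - y) • Ω.indicator D y) volume := by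
      have := (ρ.hasCompactSupport_normed (μ := volume)).convolutionExists_left
        (ContinuousLinearMap.lsmul ℝ ℝ) ρ.continuous_normed lD x
      simpa using this.integrable_swap
    have ei : (∫ y, k (x - y) • Ω.indicator D y) i = ∫ y in Ω, k (x - y) * D y i := by
      have := (EuclideanSpace.proj (𝕜 := ℝ) i).integral_comp_comm hDi
      rw [← integral_indicator hΩm]
      simp only [PiLp.proj_apply] at this
      rw [← this]
      congr 1; ext y
      by_cases hy : y ∈ Ω <;> simp [hy]
    rw [ei]
    have hψ := hw i _ (hχ.mul_left hkx)
    have e1 : ∀ y, fderiv ℝ (fun y => k (x - y) * χ y) y (basisVec i)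
        = k (x - y) * fderiv ℝ χ y (basisVec i) - fderiv ℝ k (x - y) (basisVec i) * χ y := by
      intro y
      have := ((hkx.differentiable (by simp) y).hasFDerivAt.mul
        (hχ.differentiable y).hasFDerivAt).fderiv
      rw [show (fun y => k (x - y) * χ y) = (fun y => k (x - y)) * χ from rfl, this]
      simp [hkd]; ring
    simp_rw [e1] at hψ
    have e2 : ∫ y, fderiv ℝ k (x - y) (basisVec i) * Ω.indicator F y
        = ∫ y in Ω, f y * (fderiv ℝ k (x - y) (basisVec i) * χ y) := by
      rw [← integral_indicator hΩm]
      congr 1; ext y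
      by_cases hy : y ∈ Ω <;> simp [hy, hF]; ring
    rw [e2]
    have i1 : Integrable (fun y => f y * (k (x - y) * fderiv ℝ χ y (basisVec i)))
        (volume.restrict Ω) := by
      refine Integrable.bdd_mul (c := R) ?_ hfm (ae_of_all _ hfR)
      exact Integrable.bdd_mul (c := c) ((hχ.memLp_fderiv 1 _).integrable le_rfl)
        hkx.continuous.aestronglyMeasurable (ae_of_all _ fun y => hc _)
    have i2 : Integrable (fun y => f y * (fderiv ℝ k (x - y) (basisVec i) * χ y))
        (volume.restrict Ω) := by
      refine Integrable.bdd_mul (c := R) ?_ hfm (ae_of_all _ hfR)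
      refine Continuous.integrable_of_hasCompactSupport ?_ hχ.compact.mul_left
      refine Continuous.mul ?_ hχ.continuous
      exact ((hks.continuous_fderiv (by simp)).comp (continuous_const.sub continuous_id)).clm_apply
        continuous_const
    have i3 : Integrable (fun y => B y i * (k (x - y) * χ y)) (volume.restrict Ω) := by
      refine Integrable.mul_bdd (c := c * C) ((memLp_coord hB i).integrable (by simp))
        (hkx.continuous.mul hχ.continuous).aestronglyMeasurable (ae_of_all _ fun y => ?_)
      rw [norm_mul]
      exact mul_le_mul (hc _) (hC _) (norm_nonneg _) ((norm_nonneg _).trans (hc 0))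
    simp_rw [mul_sub] at hψ
    rw [integral_sub i1 i2] at hψ
    have e3 : ∫ y in Ω, k (x - y) * D y i
        = (∫ y in Ω, B y i * (k (x - y) * χ y))
          + ∫ y in Ω, f y * (k (x - y) * fderiv ℝ χ y (basisVec i)) := by
      rw [← integral_add i3 i1]
      congr 1; ext y
      simp only [hD, PiLp.add_apply, PiLp.smul_apply, smul_eq_mul, gradient_apply]
      ring
    rw [e3]; linarith
  refine ⟨mF, mD, fun ε hε => ?_⟩
  obtain ⟨δ₁, hδ₁, h1⟩ := exists_eLpNorm_normed_convolution_sub_le (by simp) mF' hε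
  obtain ⟨δ₂, hδ₂, h2⟩ := exists_eLpNorm_normed_convolution_sub_le (by simp) mD' hε
  -- One radius serves three purposes: the support stays in Ω, and both the function and its
  -- gradient are approximated within ε.
  set r := min δ (min δ₁ δ₂) with hr
  have hr0 : 0 < r := by positivity
  let ρ := smallBump (Space N) r hr0
  have ht : IsSmoothTest Ω (mollify volume ρ (Ω.indicator F)) :=
    isSmoothTest_mollify ρ lF hcs (((Metric.cthickening_mono (min_le_left _ _) _).trans
      (Metric.cthickening_subset_of_subset _ hsupp)).trans hδΩ)
  refine ⟨_, ht.smooth, ht.compact, ht.support, ?_, ?_⟩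
  · refine le_trans (le_of_eq (eLpNorm_congr_ae ?_))
      ((eLpNorm_mono_measure _ Measure.restrict_le_self).trans
        (h1 ρ ((min_le_right _ _).trans (min_le_left _ _))))
    filter_upwards [ae_restrict_mem hΩm] with x hx
    simp [mollify, hx]
  · refine le_trans (le_of_eq (eLpNorm_congr_ae ?_))
      ((eLpNorm_mono_measure _ Measure.restrict_le_self).trans
        (h2 ρ ((min_le_right _ _).trans (min_le_right _ _))))
    filter_upwards [ae_restrict_mem hΩm] with x hx
    rw [hgrad]
    simp [mollify, hx]

/-- A bounded function with square integrable weak gradient that vanishes where a nonnegative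
element `a` of `H¹₀` is small belongs to `H¹₀`. -/
theorem isH10WithGradient_of_cutoff (hΩ : IsOpen Ω) (hΩμ : volume Ω ≠ ⊤)
    {f : Space N → ℝ} {B : Space N → Space N} {R : ℝ}
    (hfm : AEStronglyMeasurable f (volume.restrict Ω)) (hfR : ∀ x, |f x| ≤ R)
    (hB : MemLp B 2 (volume.restrict Ω))
    (hw : ∀ i, HasWeakDeriv volume Ω (basisVec i) f (fun x => B x i))
    {a : Space N → ℝ} {A : Space N → Space N} (ha : IsH10WithGradient Ω a A)
    {q : ℝ → ℝ} (hq : ContDiff ℝ ∞ q) (hq0 : q 0 = 0) {C : ℝ} (hqC : ∀ s, |q s| ≤ C)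
    (hqC' : ∀ s, |deriv q s| ≤ C) (h1 : ∀ x, f x * q (a x) = f x)
    (h2 : ∀ x, f x * deriv q (a x) = 0)
    (h3 : ∀ x, q (a x) • B x = B x) : IsH10WithGradient Ω f B := by
  have hfin : IsFiniteMeasure (volume.restrict Ω) := ⟨by simpa using hΩμ.lt_top⟩
  have hR0 : 0 ≤ R := (abs_nonneg _).trans (hfR 0)
  have hC0 : 0 ≤ C := (abs_nonneg _).trans (hqC 0)
  obtain ⟨φ, hφ, l1, l2, l3⟩ := ha.exists_seq
  have hqd : Differentiable ℝ q := hq.differentiable (by simp)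
  have hq'c : Continuous (deriv q) := hq.continuous_deriv (by simp)
  have mf : MemLp f 2 (volume.restrict Ω) := MemLp.of_bound hfm R (ae_of_all _ hfR)
  have hqa : AEStronglyMeasurable (fun x => q (a x)) (volume.restrict Ω) :=
    hq.continuous.comp_aestronglyMeasurable ha.1.1
  have hqa' : AEStronglyMeasurable (fun x => deriv q (a x)) (volume.restrict Ω) :=
    hq'c.comp_aestronglyMeasurable ha.1.1
  have hqφ : ∀ n, AEStronglyMeasurable (fun x => q (φ n x)) (volume.restrict Ω) := fun n =>
    (hq.continuous.comp (hφ n).continuous).aestronglyMeasurable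
  have hqφ' : ∀ n, AEStronglyMeasurable (fun x => deriv q (φ n x)) (volume.restrict Ω) := fun n =>
    (hq'c.comp (hφ n).continuous).aestronglyMeasurable
  have hb2 : ∀ n x, ‖q (φ n x) - q (a x)‖ ≤ 2 * C := fun n x => by
    refine (norm_sub_le _ _).trans ?_
    rw [two_mul]; exact add_le_add (hqC _) (hqC _)
  have hb2' : ∀ n x, ‖deriv q (φ n x) - deriv q (a x)‖ ≤ 2 * C := fun n x => by
    refine (norm_sub_le _ _).trans ?_
    rw [two_mul]; exact add_le_add (hqC' _) (hqC' _)
  have lq : ∀ᵐ x ∂volume.restrict Ω, Tendsto (fun n => q (φ n x) - q (a x)) atTop (𝓝 0) := by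
    filter_upwards [l3] with x hx
    simpa using ((hq.continuous.tendsto _).comp hx).sub_const (q (a x))
  have lq' : ∀ᵐ x ∂volume.restrict Ω,
      Tendsto (fun n => deriv q (φ n x) - deriv q (a x)) atTop (𝓝 0) := by
    filter_upwards [l3] with x hx
    simpa using ((hq'c.tendsto _).comp hx).sub_const (deriv q (a x))
  -- The approximants are `f * q (φ n)`, where the test functions `φ n` tend to `a`. They are
  -- cutoffs of `f` by genuine test functions, so they are already known to lie in `H¹₀`.
  refine IsH10WithGradient.of_approx mf hB
    (fun n => isH10WithGradient_mul_test hΩ hΩμ hfm hfR hB hw ((hφ n).comp hq hq0)) ?_ ?_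
  · refine tendsto_eLpNorm_zero_of_dominated (by simp) (by simp) (g := fun x => R * (2 * C))
      (fun n => (hfm.mul (hqφ n)).sub hfm) (memLp_const _) (fun n => ae_of_all _ fun x => ?_) ?_
    · have : f x * q (φ n x) - f x = f x * (q (φ n x) - q (a x)) := by rw [mul_sub, h1]
      rw [this, norm_mul]
      exact mul_le_mul (hfR x) (hb2 n x) (norm_nonneg _) hR0
    · filter_upwards [lq] with x hx
      have := hx.const_mul (f x)
      simp only [mul_sub, h1, mul_zero] at this
      exact this
  · have d1 : Tendsto (fun n => eLpNorm (fun x => (q (φ n x) - q (a x)) • B x) 2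
        (volume.restrict Ω)) atTop (𝓝 0) := by
      refine tendsto_eLpNorm_zero_of_dominated (by simp) (by simp) (g := fun x => 2 * C * ‖B x‖)
        (fun n => ((hqφ n).sub hqa).smul hB.1) (hB.norm.const_mul _)
        (fun n => ae_of_all _ fun x => ?_) ?_
      · rw [norm_smul]; gcongr; exact hb2 n x
      · filter_upwards [lq] with x hx
        simpa using hx.smul_const (B x)
    have d2 : Tendsto (fun n => eLpNorm (fun x => (f x * (deriv q (φ n x) - deriv q (a x))) • A x) 2
        (volume.restrict Ω)) atTop (𝓝 0) := by
      refine tendsto_eLpNorm_zero_of_dominated (by simp) (by simp)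
        (g := fun x => R * (2 * C) * ‖A x‖)
        (fun n => (hfm.mul ((hqφ' n).sub hqa')).smul ha.2.1.1) (ha.2.1.norm.const_mul _)
        (fun n => ae_of_all _ fun x => ?_) ?_
      · rw [norm_smul, norm_mul]; gcongr
        exacts [hfR x, hb2' n x]
      · filter_upwards [lq'] with x hx
        simpa using (hx.const_mul (f x)).smul_const (A x)
    have d3 : Tendsto (fun n => ENNReal.ofReal (R * C) *
        eLpNorm (fun x => gradient (φ n) x - A x) 2 (volume.restrict Ω)) atTop (𝓝 0) := by
      simpa using ENNReal.Tendsto.const_mul l2 (Or.inr ENNReal.ofReal_ne_top)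
    have hsum := (d1.add d2).add d3
    simp only [add_zero] at hsum
    refine tendsto_of_tendsto_of_tendsto_of_le_of_le tendsto_const_nhds hsum (fun _ => zero_le)
      fun n => ?_
    -- Since q(a) = 1 in effect where `B` lives and f q'(a) = 0, these products may be subtracted
    -- for free. Each of the three remaining terms then contains a difference that tends to zero.
    have e : (fun x => q (φ n x) • B x + f x • gradient (fun y => q (φ n y)) x - B x)
        = ((fun x => (q (φ n x) - q (a x)) • B x)
          + fun x => (f x * (deriv q (φ n x) - deriv q (a x))) • A x)
          + fun x => (f x * deriv q (φ n x)) • (gradient (φ n) x - A x) := by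
      ext1 x
      rw [gradient_comp ((hφ n).differentiable x) (hqd _), Pi.add_apply, Pi.add_apply, sub_smul, h3,
        mul_sub, h2, sub_zero, smul_sub, smul_smul]
      abel
    simp only []
    rw [e]
    have mm : AEStronglyMeasurable (fun x => (f x * deriv q (φ n x)) • (gradient (φ n) x - A x))
        (volume.restrict Ω) :=
      (hfm.mul (hqφ' n)).smul ((hφ n).continuous_gradient.aestronglyMeasurable.sub ha.2.1.1)
    have m1 : AEStronglyMeasurable (fun x => (q (φ n x) - q (a x)) • B x) (volume.restrict Ω) :=
      ((hqφ n).sub hqa).smul hB.1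
    have m2 : AEStronglyMeasurable (fun x => (f x * (deriv q (φ n x) - deriv q (a x))) • A x)
        (volume.restrict Ω) := (hfm.mul ((hqφ' n).sub hqa')).smul ha.2.1.1
    refine (eLpNorm_add_le (m1.add m2) mm (by simp)).trans (add_le_add ?_ ?_)
    · exact eLpNorm_add_le m1 m2 (by simp)
    · refine eLpNorm_le_mul_eLpNorm_of_ae_le_mul (ae_of_all _ fun x => ?_) _
      rw [norm_smul, norm_mul]
      gcongr
      exacts [hfR x, hqC' _]

/-- A countable set of test functions is dense in `C_c^∞(Ω)` for the norm of `H¹`. -/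
theorem exists_dense_seq_isSmoothTest (Ω : Set (Space N)) :
    ∃ ζ : ℕ → Space N → ℝ, (∀ n, IsSmoothTest Ω (ζ n)) ∧ ∀ ψ, IsSmoothTest Ω ψ →
      ∃ k : ℕ → ℕ,
        Tendsto (fun n => eLpNorm (fun x => ζ (k n) x - ψ x) 2 (volume.restrict Ω)) atTop (𝓝 0) ∧
        Tendsto (fun n => eLpNorm (fun x => gradient (ζ (k n)) x - gradient ψ x) 2
          (volume.restrict Ω)) atTop (𝓝 0) := by
  have : Fact ((2 : ℝ≥0∞) ≠ ⊤) := ⟨by simp⟩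
  let S := {ζ : Space N → ℝ // IsSmoothTest Ω ζ}
  -- The map ζ ↦ (ζ, ∇ζ) into L² × L² has range in a separable metric space, so the range is itself
  -- separable and a dense sequence can be chosen among images of test functions. Only the
  -- comparison of distances is retained.
  obtain ⟨Φ, hΦ1, hΦ2⟩ : ∃ Φ : S → Lp ℝ 2 (volume.restrict Ω) × Lp (Space N) 2 (volume.restrict Ω),
      (∀ ζ ψ : S, eLpNorm (fun x => ζ.1 x - ψ.1 x) 2 (volume.restrict Ω) ≤ edist (Φ ζ) (Φ ψ)) ∧
      ∀ ζ ψ : S, eLpNorm (fun x => gradient ζ.1 x - gradient ψ.1 x) 2 (volume.restrict Ω)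
        ≤ edist (Φ ζ) (Φ ψ) := by
    refine ⟨fun ζ => ((ζ.2.memLp 2).toLp _, (ζ.2.memLp_gradient 2).toLp _), fun ζ ψ => ?_,
      fun ζ ψ => ?_⟩
    · rw [Prod.edist_eq, Lp.edist_toLp_toLp]
      exact le_max_left _ _
    · rw [Prod.edist_eq, Lp.edist_toLp_toLp, Lp.edist_toLp_toLp]
      exact le_max_right _ _
  have h0 : IsSmoothTest Ω (fun _ => (0 : ℝ)) :=
    ⟨contDiff_const, HasCompactSupport.zero, by simp [tsupport]⟩
  have : Nonempty (range Φ) := ⟨⟨Φ ⟨_, h0⟩, mem_range_self _⟩⟩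
  have : SecondCountableTopology (Lp ℝ 2 (volume.restrict Ω)) := Lp.SecondCountableTopology
  have : SecondCountableTopology (Lp (Space N) 2 (volume.restrict Ω)) :=
    Lp.SecondCountableTopology
  have : TopologicalSpace.SeparableSpace (range Φ) := inferInstance
  choose ζ hζ using fun n => (TopologicalSpace.denseSeq (range Φ) n).2
  refine ⟨fun n => (ζ n).1, fun n => (ζ n).2, fun ψ hψ => ?_⟩
  have hd := TopologicalSpace.denseRange_denseSeq (range Φ)
  have hpos : ∀ n : ℕ, (0 : ℝ≥0∞) < ((n : ℝ≥0∞) + 1)⁻¹ := fun n => by simp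
  have hex : ∀ n : ℕ, ∃ k, edist (Φ (ζ k)) (Φ ⟨ψ, hψ⟩) < ((n : ℝ≥0∞) + 1)⁻¹ := fun n => by
    obtain ⟨k, hk⟩ := hd.exists_mem_open (Metric.isOpen_eball (x := (⟨Φ ⟨ψ, hψ⟩, mem_range_self _⟩ : range Φ))
      (ε := ((n : ℝ≥0∞) + 1)⁻¹)) ⟨_, Metric.mem_eball_self (hpos n)⟩
    refine ⟨k, ?_⟩
    rw [hζ]
    exact hk
  choose k hk using hex
  have hlim : Tendsto (fun n : ℕ => ((n : ℝ≥0∞) + 1)⁻¹) atTop (𝓝 0) := by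
    have := ENNReal.tendsto_inv_nat_nhds_zero.comp (tendsto_add_atTop_nat 1)
    refine this.congr fun n => ?_
    simp
  refine ⟨k, ?_, ?_⟩
  · refine tendsto_of_tendsto_of_tendsto_of_le_of_le tendsto_const_nhds hlim (fun _ => zero_le)
      fun n => ?_
    exact (hΦ1 _ ⟨ψ, hψ⟩).trans (hk n).le
  · refine tendsto_of_tendsto_of_tendsto_of_le_of_le tendsto_const_nhds hlim (fun _ => zero_le)
      fun n => ?_
    exact (hΦ2 _ ⟨ψ, hψ⟩).trans (hk n).le

end

/-! ### Passing between the cylinder and its time slices -/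

section

variable {N : ℕ} {Ω : Set (Space N)} {T : ℝ}

theorem isOpen_cyl (hΩ : IsOpen Ω) : IsOpen (cyl Ω T) := hΩ.prod isOpen_Ioo

theorem volume_restrict_cyl : (volume.restrict (cyl Ω T) : Measure (Space N × ℝ))
    = (volume.restrict Ω).prod (volume.restrict (Ioo 0 T)) := by
  rw [cyl, Measure.volume_eq_prod, Measure.prod_restrict]

theorem volume_cyl_ne_top (hΩ : volume Ω ≠ ⊤) : volume (cyl Ω T) ≠ ⊤ := by
  rw [cyl, Measure.volume_eq_prod, Measure.prod_prod]
  exact ENNReal.mul_ne_top hΩ (by simp)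

theorem ae_slice {P : Space N × ℝ → Prop} (h : ∀ᵐ z ∂volume.restrict (cyl Ω T), P z) :
    ∀ᵐ t ∂volume.restrict (Ioo 0 T), ∀ᵐ x ∂volume.restrict Ω, P (x, t) := by
  rw [volume_restrict_cyl] at h
  exact Measure.ae_ae_of_ae_prod (Measure.measurePreserving_swap.quasiMeasurePreserving.ae h)

theorem aestronglyMeasurable_slice {F : Type*} [TopologicalSpace F] {f : Space N × ℝ → F}
    (hf : AEStronglyMeasurable f (volume.restrict (cyl Ω T))) :
    ∀ᵐ t ∂volume.restrict (Ioo 0 T),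
      AEStronglyMeasurable (fun x => f (x, t)) (volume.restrict Ω) := by
  rw [volume_restrict_cyl] at hf
  exact hf.prod_swap.prodMk_left

theorem memLp_slice {F : Type*} [NormedAddCommGroup F] {f : Space N × ℝ → F}
    (hf : MemLp f 2 (volume.restrict (cyl Ω T))) :
    ∀ᵐ t ∂volume.restrict (Ioo 0 T), MemLp (fun x => f (x, t)) 2 (volume.restrict Ω) := by
  have h2 := (memLp_two_iff_integrable_sq_norm hf.1).1 hf
  rw [volume_restrict_cyl] at h2
  filter_upwards [aestronglyMeasurable_slice hf.1, h2.prod_left_ae] with t h3 h4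
  exact (memLp_two_iff_integrable_sq_norm h3).2 h4

theorem integral_cyl {F : Type*} [NormedAddCommGroup F] [NormedSpace ℝ F] {f : Space N × ℝ → F}
    (hf : Integrable f (volume.restrict (cyl Ω T))) :
    ∫ z in cyl Ω T, f z = ∫ t in Ioo 0 T, ∫ x in Ω, f (x, t) := by
  rw [volume_restrict_cyl] at hf ⊢
  exact integral_prod_symm _ hf

theorem integrable_integral_slice {F : Type*} [NormedAddCommGroup F] [NormedSpace ℝ F]
    {f : Space N × ℝ → F} (hf : Integrable f (volume.restrict (cyl Ω T))) :
    Integrable (fun t => ∫ x in Ω, f (x, t)) (volume.restrict (Ioo 0 T)) := by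
  rw [volume_restrict_cyl] at hf
  exact hf.integral_prod_right

theorem fderiv_slice {ζ : Space N × ℝ → ℝ} {x : Space N} {t : ℝ}
    (h : DifferentiableAt ℝ ζ (x, t)) (e : Space N) :
    fderiv ℝ (fun y => ζ (y, t)) x e = fderiv ℝ ζ (x, t) (e, 0) := by
  have := (HasFDerivAt.comp x h.hasFDerivAt (hasFDerivAt_prodMk_left (𝕜 := ℝ) x t)).fderiv
  rw [show (ζ ∘ fun y => (y, t)) = fun y => ζ (y, t) from rfl] at this
  rw [this]; simp

theorem IsSmoothTest.slice {ζ : Space N × ℝ → ℝ} (h : IsSmoothTest (cyl Ω T) ζ) (t : ℝ) :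
    IsSmoothTest Ω (fun x => ζ (x, t)) := by
  have hs : tsupport (fun x => ζ (x, t)) ⊆ (fun x => (x, t)) ⁻¹' tsupport ζ := by
    refine closure_minimal (fun x hx => subset_tsupport _ hx) ?_
    exact (isClosed_tsupport _).preimage (by fun_prop)
  refine ⟨h.smooth.comp (contDiff_prodMk_left t), ?_, fun x hx => (h.support (hs hx)).1⟩
  exact (h.compact.isCompact.image continuous_fst).of_isClosed_subset (isClosed_tsupport _)
    fun x hx => ⟨(x, t), hs hx, rfl⟩

theorem isSmoothTest_tensor {ζ : Space N → ℝ} {η : ℝ → ℝ} {V : Set ℝ} (hζ : IsSmoothTest Ω ζ)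
    (hη : IsSmoothTest V η) : IsSmoothTest (Ω ×ˢ V) (fun z : Space N × ℝ => ζ z.1 * η z.2) := by
  have hs : tsupport (fun z : Space N × ℝ => ζ z.1 * η z.2) ⊆ tsupport ζ ×ˢ tsupport η := by
    refine closure_minimal (fun z hz => ?_) ((isClosed_tsupport _).prod (isClosed_tsupport _))
    exact ⟨subset_tsupport _ (left_ne_zero_of_mul hz), subset_tsupport _ (right_ne_zero_of_mul hz)⟩
  refine ⟨(hζ.smooth.comp contDiff_fst).mul (hη.smooth.comp contDiff_snd), ?_,
    hs.trans (prod_mono hζ.support hη.support)⟩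
  exact (hζ.compact.isCompact.prod hη.compact.isCompact).of_isClosed_subset
    (isClosed_tsupport _) hs

/-- If almost every time slice of `f` is in `H¹₀(Ω)` with gradient `B`, then `B` is the weak spatial
gradient of `f` on the cylinder. -/
theorem hasWeakDeriv_of_slices {f : Space N × ℝ → ℝ} {B : Space N × ℝ → Space N}
    (hf : MemLp f 2 (volume.restrict (cyl Ω T))) (hB : MemLp B 2 (volume.restrict (cyl Ω T)))
    (h : ∀ᵐ t ∂volume.restrict (Ioo 0 T),
      IsH10WithGradient Ω (fun x => f (x, t)) (fun x => B (x, t))) (e : Space N) :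
    HasWeakDeriv volume (cyl Ω T) (e, 0) f (fun z => ⟪B z, e⟫_ℝ) := by
  intro ζ hζ
  have i1 : Integrable (fun z => f z * fderiv ℝ ζ z (e, 0)) (volume.restrict (cyl Ω T)) :=
    hf.integrable_mul (hζ.memLp_fderiv 2 _)
  have i2 : Integrable (fun z => ⟪B z, e⟫_ℝ * ζ z) (volume.restrict (cyl Ω T)) :=
    (hB.inner_const e).integrable_mul (hζ.memLp 2)
  rw [integral_cyl i1, integral_cyl i2, ← integral_neg]
  refine integral_congr_ae ?_
  filter_upwards [h] with t ht
  rw [← ht.integral_mul_fderiv (hζ.slice t) e]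
  simp_rw [fderiv_slice (hζ.differentiable _)]

/-- A square integrable weak spatial gradient on the cylinder restricts to weak gradients of almost
every time slice. -/
theorem ae_slice_hasWeakDeriv {f : Space N × ℝ → ℝ} {B : Space N × ℝ → Space N}
    (hf : MemLp f 2 (volume.restrict (cyl Ω T))) (hB : MemLp B 2 (volume.restrict (cyl Ω T)))
    (h : ∀ i, HasWeakDeriv volume (cyl Ω T) (basisVec i, 0) f (fun z => B z i)) :
    ∀ᵐ t ∂volume.restrict (Ioo 0 T), ∀ i,
      HasWeakDeriv volume Ω (basisVec i) (fun x => f (x, t)) (fun x => B (x, t) i) := by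
  -- The exceptional null set of times must not depend on the test function. It is found for
  -- countably many tests, and density in the `H¹` norm extends the identity to all of them.
  obtain ⟨ζ, hζ, hd⟩ := exists_dense_seq_isSmoothTest Ω
  have hBi := fun i => memLp_coord hB i
  have key : ∀ i n, ∀ᵐ t ∂volume.restrict (Ioo 0 T),
      (∫ x in Ω, f (x, t) * fderiv ℝ (ζ n) x (basisVec i))
        + ∫ x in Ω, B (x, t) i * ζ n x = 0 := by
    intro i n
    have c1 : Continuous fun z : Space N × ℝ => fderiv ℝ (ζ n) z.1 (basisVec i) :=
      ((hζ n).continuous_fderiv.comp continuous_fst).clm_apply continuous_const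
    have c2 : Continuous fun z : Space N × ℝ => ζ n z.1 := (hζ n).continuous.comp continuous_fst
    have i0 : ∀ (g : Space N × ℝ → ℝ) (k : Space N → ℝ), MemLp g 2 (volume.restrict (cyl Ω T)) →
        MemLp k 2 (volume.restrict Ω) →
        Integrable (fun z => g z * k z.1) (volume.restrict (cyl Ω T)) := by
      intro g k hg hk
      have hk' : MemLp (fun z : Space N × ℝ => k z.1) 2 (volume.restrict (cyl Ω T)) := by
        rw [volume_restrict_cyl]
        exact hk.comp_fst _
      exact hg.integrable_mul hk'
    have i1 := i0 f _ hf ((hζ n).memLp_fderiv 2 (basisVec i))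
    have i2 := i0 _ _ (hBi i) ((hζ n).memLp 2)
    have j := (integrable_integral_slice i1).add (integrable_integral_slice i2)
    -- Tests of the form ζ(x)η(t) and the fundamental lemma of the calculus of variations in t
    -- localize the identity to almost every time.
    have := isOpen_Ioo.ae_eq_zero_of_integral_contDiff_smul_eq_zero (μ := volume) (U := Ioo 0 T)
      (IntegrableOn.locallyIntegrableOn j) fun η h1 h2 h3 => by
        have hη : IsSmoothTest (Ioo 0 T) η := ⟨h1, h2, h3⟩
        obtain ⟨c, hc⟩ := hη.exists_bound
        have ht := h i _ (isSmoothTest_tensor (hζ n) hη)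
        have e1 : ∀ z : Space N × ℝ,
            fderiv ℝ (fun z : Space N × ℝ => ζ n z.1 * η z.2) z (basisVec i, 0)
              = fderiv ℝ (ζ n) z.1 (basisVec i) * η z.2 := by
          intro z
          have hh := isSmoothTest_tensor (hζ n) hη
          have := fderiv_slice (x := z.1) (t := z.2) (hh.differentiable z) (basisVec i)
          rw [← this]
          simp only [mul_comm (ζ n _) (η z.2)]
          rw [fderiv_const_mul ((hζ n).differentiable _)]
          simp [mul_comm]
        simp_rw [e1] at ht
        have k1 : Integrable (fun z : Space N × ℝ => f z * (fderiv ℝ (ζ n) z.1 (basisVec i) * η z.2))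
            (volume.restrict (cyl Ω T)) := by
          refine (i1.mul_bdd (c := c) (g := fun z : Space N × ℝ => η z.2)
            (hη.continuous.comp continuous_snd).aestronglyMeasurable (ae_of_all _ fun z => hc _)).congr
            (ae_of_all _ fun z => by simp only []; ring)
        have k2 : Integrable (fun z : Space N × ℝ => B z i * (ζ n z.1 * η z.2))
            (volume.restrict (cyl Ω T)) := by
          refine (i2.mul_bdd (c := c) (g := fun z : Space N × ℝ => η z.2)
            (hη.continuous.comp continuous_snd).aestronglyMeasurable (ae_of_all _ fun z => hc _)).congr
            (ae_of_all _ fun z => by simp only []; ring)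
        change ∫ z in cyl Ω T, _ = -∫ z in cyl Ω T, _ at ht
        rw [integral_cyl k1, integral_cyl k2] at ht
        have e2 : ∀ t, η t • (((fun t => ∫ x in Ω, f (x, t) * fderiv ℝ (ζ n) x (basisVec i))
            + fun t => ∫ x in Ω, B (x, t) i * ζ n x) t)
            = (∫ x in Ω, f (x, t) * (fderiv ℝ (ζ n) x (basisVec i) * η t))
              + ∫ x in Ω, B (x, t) i * (ζ n x * η t) := by
          intro t
          simp only [Pi.add_apply, smul_eq_mul, mul_add, ← integral_const_mul]
          congr 1
          · congr 1; ext x; ring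
          · congr 1; ext x; ring
        have z0 : ∫ t in Ioo 0 T, η t • (((fun t => ∫ x in Ω, f (x, t) * fderiv ℝ (ζ n) x (basisVec i))
            + fun t => ∫ x in Ω, B (x, t) i * ζ n x) t) = 0 := by
          simp_rw [e2]
          rw [integral_add (integrable_integral_slice k1) (integrable_integral_slice k2), ht]
          exact neg_add_cancel _
        rw [← z0, setIntegral_eq_integral_of_forall_compl_eq_zero]
        intro t ht
        rw [image_eq_zero_of_notMem_tsupport (fun h => ht (h3 h)), zero_smul]
    rw [ae_restrict_iff' measurableSet_Ioo]
    exact this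
  have key' : ∀ᵐ t ∂volume.restrict (Ioo 0 T), ∀ i n,
      (∫ x in Ω, f (x, t) * fderiv ℝ (ζ n) x (basisVec i))
        + ∫ x in Ω, B (x, t) i * ζ n x = 0 := by
    rw [ae_all_iff]; intro i; rw [ae_all_iff]; exact key i
  filter_upwards [key', memLp_slice hf, memLp_slice hB] with t ht hft hBt i ψ hψ
  obtain ⟨k, l1, l2⟩ := hd ψ hψ
  have hfv : MemLp (fun x => f (x, t) • basisVec i) 2 (volume.restrict Ω) :=
    hft.mono (hft.1.smul_const _) (ae_of_all _ fun x => by simp [norm_smul])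
  have t1 := tendsto_integral_inner (fun n => (hζ (k n)).memLp_gradient 2) (hψ.memLp_gradient 2)
    hfv l2
  have t2 := tendsto_integral_inner (fun n => (hζ (k n)).memLp 2) (hψ.memLp 2)
    (memLp_coord hBt i) l1
  have e : ∀ φ : Space N → ℝ, ∀ x, ⟪gradient φ x, f (x, t) • basisVec i⟫_ℝ
      = f (x, t) * fderiv ℝ φ x (basisVec i) := fun φ x => by
    rw [inner_smul_right, inner_gradient_left]
  simp_rw [e] at t1
  have e' : ∀ φ : Space N → ℝ, ∀ x, ⟪φ x, B (x, t) i⟫_ℝ = B (x, t) i * φ x := fun φ x => by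
    simp
  simp_rw [e'] at t2
  have := tendsto_nhds_unique (t1.add t2) (tendsto_const_nhds.congr fun n => (ht i (k n)).symm)
  linarith

end

/-! ### Profiles, their primitives and the quotient that appears in the test function -/

section

/-- `ρ` is a nonnegative smooth function supported in `[ε, b] ⊂ (0, ∞)`. -/
structure IsProfile (ρ : ℝ → ℝ) (ε b : ℝ) : Prop where
  smooth : ContDiff ℝ ∞ ρ
  nonneg : ∀ s, 0 ≤ ρ s
  pos : 0 < ε
  lt : ε < b
  left : ∀ s, s ≤ ε → ρ s = 0
  right : ∀ s, b ≤ s → ρ s = 0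

/-- The primitive of `ρ` vanishing at `0`. -/
def prim (ρ : ℝ → ℝ) (s : ℝ) : ℝ := ∫ t in (0 : ℝ)..s, ρ t

/-- The function `s ↦ (∫₀ˢ ρ) / s`. -/
def quot (ρ : ℝ → ℝ) (s : ℝ) : ℝ := prim ρ s / s

namespace IsProfile

variable {ρ : ℝ → ℝ} {ε b : ℝ} (h : IsProfile ρ ε b)
include h

theorem hasDerivAt_prim (s : ℝ) : HasDerivAt (prim ρ) (ρ s) s :=
  intervalIntegral.integral_hasDerivAt_right (h.smooth.continuous.intervalIntegrable _ _)
    (h.smooth.continuous.stronglyMeasurableAtFilter _ _) h.smooth.continuous.continuousAt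

theorem deriv_prim : deriv (prim ρ) = ρ := funext fun s => (h.hasDerivAt_prim s).deriv

theorem contDiff_prim : ContDiff ℝ ∞ (prim ρ) := by
  rw [contDiff_infty_iff_deriv, h.deriv_prim]
  exact ⟨fun s => (h.hasDerivAt_prim s).differentiableAt, h.smooth⟩

theorem monotone_prim : Monotone (prim ρ) :=
  monotone_of_hasDerivAt_nonneg h.hasDerivAt_prim h.nonneg

theorem prim_eq_zero {s : ℝ} (hs : s ≤ ε) : prim ρ s = 0 := by
  refine intervalIntegral.integral_zero_ae (ae_of_all _ fun t ht => h.left t ?_)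
  exact ht.2.trans (max_le h.pos.le hs)

theorem prim_eq_of_le {s : ℝ} (hs : b ≤ s) : prim ρ s = prim ρ b := by
  have := intervalIntegral.integral_add_adjacent_intervals (a := 0) (b := b) (c := s)
    (h.smooth.continuous.intervalIntegrable (μ := volume) _ _)
    (h.smooth.continuous.intervalIntegrable _ _)
  unfold prim
  rw [← this, intervalIntegral.integral_zero_ae (a := b), add_zero]
  refine ae_of_all _ fun t ht => h.right t ?_
  rw [uIoc_of_le hs] at ht
  exact ht.1.le

theorem prim_nonneg (s : ℝ) : 0 ≤ prim ρ s := by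
  rcases le_total s ε with hs | hs
  · rw [h.prim_eq_zero hs]
  · rw [← h.prim_eq_zero le_rfl]; exact h.monotone_prim hs

theorem prim_le (s : ℝ) : prim ρ s ≤ prim ρ b := by
  rcases le_total s b with hs | hs
  · exact h.monotone_prim hs
  · exact (h.prim_eq_of_le hs).le

theorem hasCompactSupport : HasCompactSupport ρ := by
  refine HasCompactSupport.intro (isCompact_Icc (a := ε) (b := b)) fun s hs => ?_
  rw [mem_Icc, not_and_or, not_le, not_le] at hs
  rcases hs with hs | hs
  · exact h.left s hs.le
  · exact h.right s hs.le

theorem exists_bound : ∃ C, 0 ≤ C ∧ ∀ s, |ρ s| ≤ C := by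
  obtain ⟨C, hC⟩ := h.hasCompactSupport.exists_bound_of_continuous h.smooth.continuous
  exact ⟨C, (norm_nonneg _).trans (hC 0), hC⟩

theorem quot_eq_zero {s : ℝ} (hs : s ≤ ε) : quot ρ s = 0 := by
  rw [quot, h.prim_eq_zero hs, zero_div]

theorem mul_quot (s : ℝ) : s * quot ρ s = prim ρ s := by
  rcases eq_or_ne s 0 with rfl | hs
  · rw [h.prim_eq_zero h.pos.le, zero_mul]
  · rw [quot, mul_div_cancel₀ _ hs]

theorem quot_eventuallyEq {s : ℝ} (hs : s < ε) : quot ρ =ᶠ[𝓝 s] fun _ => 0 := by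
  filter_upwards [Iio_mem_nhds hs] with t ht using h.quot_eq_zero (le_of_lt ht)

theorem contDiff_quot : ContDiff ℝ ∞ (quot ρ) := by
  rw [contDiff_iff_contDiffAt]
  intro s
  rcases lt_or_ge s ε with hs | hs
  · exact contDiffAt_const.congr_of_eventuallyEq (h.quot_eventuallyEq hs)
  · exact h.contDiff_prim.contDiffAt.div contDiffAt_id (h.pos.trans_le hs).ne'

theorem deriv_quot_of_lt {s : ℝ} (hs : s < ε) : deriv (quot ρ) s = 0 := by
  rw [(h.quot_eventuallyEq hs).deriv_eq]; simp

theorem deriv_quot_of_le {s : ℝ} (hs : ε ≤ s) :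
    deriv (quot ρ) s = (ρ s * s - prim ρ s) / s ^ 2 := by
  have := (h.hasDerivAt_prim s).div (hasDerivAt_id s) (h.pos.trans_le hs).ne'
  have e : (prim ρ / id) = quot ρ := rfl
  rw [e] at this
  rw [this.deriv]; simp

/-- This is the derivative of s · `quot ρ s` = `prim ρ s`. It makes the gradient of w · quot(|w|)
collapse to ρ(|w|)∇w. -/
theorem quot_add_mul_deriv (s : ℝ) : quot ρ s + s * deriv (quot ρ) s = ρ s := by
  rcases lt_or_ge s ε with hs | hs
  · rw [h.quot_eq_zero hs.le, h.deriv_quot_of_lt hs, h.left s hs.le]; simp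
  · have hs0 : s ≠ 0 := (h.pos.trans_le hs).ne'
    rw [h.deriv_quot_of_le hs, quot]
    field_simp
    ring

/-- The quotient vanishes up to ε, so the division by s costs at most powers of 1/ε. -/
theorem exists_bound_deriv_quot : ∃ C, ∀ s, |deriv (quot ρ) s| ≤ C := by
  obtain ⟨C, hC0, hC⟩ := h.exists_bound
  have hε := h.pos
  have hR : 0 ≤ prim ρ b := h.prim_nonneg b
  refine ⟨C / ε + prim ρ b / ε ^ 2, fun s => ?_⟩
  rcases lt_or_ge s ε with hs | hs
  · rw [h.deriv_quot_of_lt hs, abs_zero]; positivity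
  · have hs0 : 0 < s := hε.trans_le hs
    rw [h.deriv_quot_of_le hs, sub_div, sq, mul_div_mul_right _ _ hs0.ne']
    refine (abs_sub _ _).trans (add_le_add ?_ ?_)
    · rw [abs_div, abs_of_pos hs0]
      gcongr
      exact hC s
    · rw [abs_div, abs_of_nonneg (h.prim_nonneg s), abs_of_pos (by positivity), ← sq]
      gcongr
      exact h.prim_le s

end IsProfile

/-- The primitive is a smooth step from 0 to 1 within (δ/3, δ). It serves as a cutoff away from zero
and, as δ tends to 0, as an approximation of the sign function. -/
theorem exists_isProfile_step {δ : ℝ} (hδ : 0 < δ) :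
    ∃ ρ, IsProfile ρ (δ / 3) δ ∧ prim ρ δ = 1 := by
  let φ : ContDiffBump (2 * δ / 3 : ℝ) := ⟨δ / 6, δ / 3, by positivity, by linarith⟩
  have hz : ∀ s, s ∉ Ioo (δ / 3) δ → φ.normed volume s = 0 := fun s hs => by
    rw [← Function.notMem_support, φ.support_normed_eq, Real.ball_eq_Ioo]
    simp only [φ]
    convert hs using 3 <;> ring
  refine ⟨φ.normed volume, ⟨φ.contDiff_normed (n := ⊤), φ.nonneg_normed, by positivity, by linarith,
    fun s hs => hz s fun h => absurd h.1 (not_lt.2 hs),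
    fun s hs => hz s fun h => absurd h.2 (not_lt.2 hs)⟩, ?_⟩
  unfold prim
  rw [intervalIntegral.integral_of_le hδ.le, ← φ.integral_normed (μ := volume)]
  refine setIntegral_eq_integral_of_forall_compl_eq_zero fun s hs => hz s fun h => hs ?_
  exact ⟨(by positivity : 0 < δ / 3).trans h.1, h.2.le⟩

/-- The primitive is a smoothed truncation at height of order l. The bump ends at l + ε/2, so the
endpoint 2l leaves some room, and the primitive is at most 2l because ρ ≤ 1. -/
theorem exists_isProfile_plateau {ε l : ℝ} (hε : 0 < ε) (hl : ε < l) :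
    ∃ ρ, IsProfile ρ (ε / 2) (2 * l) ∧ (∀ s, ρ s ≤ 1) ∧ (∀ s ∈ Icc ε l, ρ s = 1) ∧
      prim ρ (2 * l) ≤ 2 * l := by
  let φ : ContDiffBump ((ε + l) / 2 : ℝ) := ⟨(l - ε) / 2, l / 2, by linarith, by linarith⟩
  have hz : ∀ s, s ∉ Ioo (ε / 2) (l + ε / 2) → φ s = 0 := fun s hs => by
    rw [← Function.notMem_support, φ.support_eq, Real.ball_eq_Ioo]
    simp only [φ]
    convert hs using 3 <;> ring
  have hp : IsProfile φ (ε / 2) (2 * l) := ⟨φ.contDiff, φ.nonneg', by positivity, by linarith,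
    fun s hs => hz s fun h => absurd h.1 (not_lt.2 hs),
    fun s hs => hz s fun h => absurd h.2 (not_lt.2 (by linarith))⟩
  refine ⟨φ, hp, fun s => φ.le_one, fun s hs => φ.one_of_mem_closedBall ?_, ?_⟩
  · rw [Real.closedBall_eq_Icc]
    simp only [φ]
    constructor <;> linarith [hs.1, hs.2]
  · have : ‖∫ t in (0 : ℝ)..(2 * l), φ t‖ ≤ 1 * |2 * l - 0| :=
      intervalIntegral.norm_integral_le_of_norm_le_const fun t _ => by
        rw [Real.norm_of_nonneg φ.nonneg]; exact φ.le_one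
    rw [one_mul, sub_zero, abs_of_pos (by linarith)] at this
    exact (Real.le_norm_self _).trans this

end

/-! ### The gradient of |u|^{m-1}u and the test function in `H¹₀` -/

section

theorem abs_sgnPow {m : ℝ} (hm : 0 < m) (s : ℝ) : |sgnPow m s| = |s| ^ m := by
  rw [sgnPow, abs_mul, abs_of_nonneg (by positivity)]
  rcases eq_or_ne s 0 with rfl | hs
  · simp [Real.zero_rpow hm.ne']
  · rw [← Real.rpow_add_one (abs_ne_zero.2 hs), sub_add_cancel]

theorem measurable_sgnPow (m : ℝ) : Measurable (sgnPow m) := by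
  unfold sgnPow; fun_prop

theorem ae_space_of_coord {α : Type*} [MeasurableSpace α] {μ : Measure α} {N : ℕ}
    {P : α → Space N} {Q : α → Space N} (h : ∀ i, (fun x => P x i) =ᵐ[μ] fun x => Q x i) :
    P =ᵐ[μ] Q := by
  filter_upwards [ae_all_iff.2 h] with x hx
  ext i; exact hx i

variable {N : ℕ} {Ω : Set (Space N)} {T : ℝ}

/-- The regularity of a weak solution that has been modified on a null set to be measurable and
bounded: `|u|^m ∈ L²((0,T); H¹₀(Ω))` with gradient `A`, and `G` is the weak gradient of
`|u|^{m-1}u`. -/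
structure IsRegular (m L : ℝ) (Ω : Set (Space N)) (T : ℝ) (u : Space N × ℝ → ℝ)
    (A G : Space N × ℝ → Space N) : Prop where
  exp_pos : 0 < m
  isOpen : IsOpen Ω
  isBounded : Bornology.IsBounded Ω
  measurable : Measurable u
  bound : ∀ z, |u z| ≤ L
  memLp : MemLp A 2 (volume.restrict (cyl Ω T))
  slices : ∀ᵐ t ∂volume.restrict (Ioo 0 T),
    IsH10WithGradient Ω (fun x => |u (x, t)| ^ m) (fun x => A (x, t))
  weak : HasWeakGradient Ω T (fun z => sgnPow m (u z)) G

instance : (volume : Measure (Space N × ℝ)).IsAddHaarMeasure := by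
  rw [Measure.volume_eq_prod]; infer_instance

theorem isFiniteMeasure_cyl (hΩ : Bornology.IsBounded Ω) :
    IsFiniteMeasure (volume.restrict (cyl Ω T)) :=
  ⟨by simpa using (volume_cyl_ne_top hΩ.measure_lt_top.ne).lt_top⟩

theorem locallyIntegrableOn_coord {U : Set (Space N × ℝ)} {G : Space N × ℝ → Space N}
    (hG : LocallyIntegrableOn G U) (i : Fin N) : LocallyIntegrableOn (fun z => G z i) U := by
  intro x hx
  obtain ⟨t, ht, hi⟩ := hG x hx
  exact ⟨t, ht, Integrable.mono hi (aestronglyMeasurable_coord hi.1 i)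
    (ae_of_all _ fun _ => norm_coord_le _ _)⟩

theorem bdd_mul_locallyIntegrableOn {k g : Space N × ℝ → ℝ} (hk : Measurable k) {C : ℝ}
    (hC : ∀ z, |k z| ≤ C) (hg : LocallyIntegrableOn g (cyl Ω T)) :
    LocallyIntegrableOn (fun z => k z * g z) (cyl Ω T) := by
  intro x hx
  obtain ⟨t, ht, hi⟩ := hg x hx
  exact ⟨t, ht, Integrable.bdd_mul (c := C) hi hk.aestronglyMeasurable (ae_of_all _ hC)⟩

theorem HasWeakGradient.hasWeakDeriv {w : Space N × ℝ → ℝ} {G : Space N × ℝ → Space N}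
    (h : HasWeakGradient Ω T w G) (i : Fin N) :
    HasWeakDeriv volume (cyl Ω T) (basisVec i, 0) w (fun z => G z i) := by
  intro φ hφ
  have := h.2.2 φ hφ.smooth hφ.compact hφ.support (basisVec i)
  simpa only [inner_basisVec] using this

namespace IsRegular

variable {m L : ℝ} {u : Space N × ℝ → ℝ} {A G : Space N × ℝ → Space N}
  (h : IsRegular m L Ω T u A G)
include h

theorem measurable_pow : Measurable fun z => |u z| ^ m :=
  (measurable_norm.comp h.measurable).pow_const m

theorem measurable_w : Measurable fun z => sgnPow m (u z) := (measurable_sgnPow m).comp h.measurable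

theorem pow_le (z : Space N × ℝ) : |u z| ^ m ≤ L ^ m :=
  Real.rpow_le_rpow (abs_nonneg _) (h.bound z) h.exp_pos.le

theorem abs_pow_le (z : Space N × ℝ) : |(|u z| ^ m)| ≤ L ^ m := by
  rw [abs_of_nonneg (by positivity)]; exact h.pow_le z

theorem abs_w (z : Space N × ℝ) : |sgnPow m (u z)| = |u z| ^ m := abs_sgnPow h.exp_pos _

theorem volume_ne_top : volume Ω ≠ ⊤ := h.isBounded.measure_lt_top.ne

theorem memLp_pow : MemLp (fun z => |u z| ^ m) 2 (volume.restrict (cyl Ω T)) := by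
  have := isFiniteMeasure_cyl (T := T) h.isBounded
  exact MemLp.of_bound h.measurable_pow.aestronglyMeasurable (L ^ m)
    (ae_of_all _ h.abs_pow_le)

theorem hasWeakDeriv_comp {g : ℝ → ℝ} (hg : ContDiff ℝ ∞ g) (h0 : g 0 = 0) {C : ℝ}
    (hC : ∀ s, |deriv g s| ≤ C) (i : Fin N) :
    HasWeakDeriv volume (cyl Ω T) (basisVec i, 0) (fun z => g (|u z| ^ m))
      (fun z => deriv g (|u z| ^ m) * A z i) := by
  have hfin := isFiniteMeasure_cyl (T := T) h.isBounded
  have hgm : Measurable fun z => g (|u z| ^ m) := hg.continuous.measurable.comp h.measurable_pow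
  have hg'm : Measurable fun z => deriv g (|u z| ^ m) :=
    (hg.continuous_deriv (by simp)).measurable.comp h.measurable_pow
  have hC0 : 0 ≤ C := (abs_nonneg _).trans (hC 0)
  obtain ⟨M, hM⟩ := (isCompact_Icc (a := -(L ^ m)) (b := L ^ m)).exists_bound_of_continuousOn
    hg.continuous.continuousOn
  have m1 : MemLp (fun z => g (|u z| ^ m)) 2 (volume.restrict (cyl Ω T)) :=
    MemLp.of_bound hgm.aestronglyMeasurable M
      (ae_of_all _ fun z => hM _ (abs_le.1 (h.abs_pow_le z)))
  have m2 : MemLp (fun z => deriv g (|u z| ^ m) • A z) 2 (volume.restrict (cyl Ω T)) := by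
    refine (h.memLp.const_smul C).mono (hg'm.aestronglyMeasurable.smul h.memLp.1)
      (ae_of_all _ fun z => ?_)
    rw [norm_smul, Pi.smul_apply, norm_smul, Real.norm_of_nonneg hC0]
    gcongr
    exact hC _
  have := hasWeakDeriv_of_slices m1 m2 (by
    filter_upwards [h.slices] with t ht using ht.comp hg h0 hC) (basisVec i)
  simpa only [inner_basisVec, PiLp.smul_apply, smul_eq_mul] using this

theorem locallyIntegrableOn_A (i : Fin N) : LocallyIntegrableOn (fun z => A z i) (cyl Ω T) := by
  have hfin := isFiniteMeasure_cyl (T := T) h.isBounded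
  exact IntegrableOn.locallyIntegrableOn ((memLp_coord h.memLp i).integrable (by simp))

theorem locallyIntegrableOn_G (i : Fin N) : LocallyIntegrableOn (fun z => G z i) (cyl Ω T) :=
  locallyIntegrableOn_coord h.weak.2.1 i

/-- `w ∇w = |w| ∇|w|`. -/
theorem smul_weak_ae_eq :
    (fun z => sgnPow m (u z) • G z) =ᵐ[volume.restrict (cyl Ω T)] fun z => |u z| ^ m • A z := by
  refine ae_space_of_coord fun i => ?_
  have hU : IsOpen (cyl Ω T) := isOpen_cyl h.isOpen
  have hUμ := volume_cyl_ne_top (T := T) h.volume_ne_top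
  have hwL : ∀ z, |sgnPow m (u z)| ≤ L ^ m := fun z => (h.abs_w z).trans_le (h.pow_le z)
  have h1 := HasWeakDeriv.mul hU hUμ h.measurable_w.aestronglyMeasurable
    h.measurable_w.aestronglyMeasurable hwL hwL (h.locallyIntegrableOn_G i)
    (h.locallyIntegrableOn_G i) (h.weak.hasWeakDeriv i) (h.weak.hasWeakDeriv i)
  have ha : HasWeakDeriv volume (cyl Ω T) (basisVec i, 0) (fun z => |u z| ^ m)
      (fun z => A z i) := by
    have := hasWeakDeriv_of_slices h.memLp_pow h.memLp h.slices (basisVec i)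
    simpa only [inner_basisVec] using this
  have h2 := HasWeakDeriv.mul hU hUμ h.measurable_pow.aestronglyMeasurable
    h.measurable_pow.aestronglyMeasurable h.abs_pow_le h.abs_pow_le (h.locallyIntegrableOn_A i)
    (h.locallyIntegrableOn_A i) ha ha
  -- The two squares are the same function, so uniqueness of weak derivatives identifies 2wG with
  -- twice |u|^m A.
  have e : (fun z => sgnPow m (u z) * sgnPow m (u z)) = fun z => |u z| ^ m * |u z| ^ m := by
    ext z; rw [← h.abs_w z, abs_mul_abs_self]
  rw [e] at h1
  have l1 := bdd_mul_locallyIntegrableOn h.measurable_w hwL (h.locallyIntegrableOn_G i)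
  have l2 := bdd_mul_locallyIntegrableOn h.measurable_pow h.abs_pow_le (h.locallyIntegrableOn_A i)
  filter_upwards [HasWeakDeriv.ae_eq hU (l1.add l1) (l2.add l2) h1 h2] with z hz
  simp only [PiLp.smul_apply, smul_eq_mul]
  simp only [Pi.add_apply] at hz
  linarith

/-- `∇w = 0` almost everywhere on `{w = 0}`. -/
theorem weak_eq_zero :
    ∀ᵐ z ∂volume.restrict (cyl Ω T), |u z| ^ m = 0 → G z = 0 := by
  have hfin := isFiniteMeasure_cyl (T := T) h.isBounded
  have hU : IsOpen (cyl Ω T) := isOpen_cyl h.isOpen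
  have hUμ := volume_cyl_ne_top (T := T) h.volume_ne_top
  have hwL : ∀ z, |sgnPow m (u z)| ≤ L ^ m := fun z => (h.abs_w z).trans_le (h.pow_le z)
  obtain ⟨κ, hκ, hκ1⟩ := exists_isProfile_step one_pos
  -- q_n increases to 1 on ever larger parts of (0,∞) and vanishes at 0, so w q_n(|w|) converges to
  -- w. Comparing the limits of the weak derivatives gives G = 1_{u ≠ 0} G.
  let q : ℕ → ℝ → ℝ := fun n s => prim κ ((n + 1) * s)
  have hqs : ∀ n, ContDiff ℝ ∞ (q n) := fun n => hκ.contDiff_prim.comp (by fun_prop)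
  have hqd : ∀ n s, deriv (q n) s = (n + 1) * κ ((n + 1) * s) := fun n s => by
    have h1 := (hκ.hasDerivAt_prim ((n + 1) * s)).comp s ((hasDerivAt_id s).const_mul ((n : ℝ) + 1))
    have h2 : deriv (q n) s = _ := h1.deriv
    rw [h2]; ring
  have hq0 : ∀ n, q n 0 = 0 := fun n => by
    simp only [q, mul_zero]; exact hκ.prim_eq_zero hκ.pos.le
  obtain ⟨C, hC0, hC⟩ := hκ.exists_bound
  have hq1 : ∀ n s, |q n s| ≤ 1 := fun n s => by
    rw [abs_of_nonneg (hκ.prim_nonneg _), ← hκ1]; exact hκ.prim_le _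
  have hqb : ∀ n s, |deriv (q n) s| ≤ (n + 1) * C := fun n s => by
    rw [hqd, abs_mul, abs_of_nonneg (by positivity : (0 : ℝ) ≤ n + 1)]
    gcongr; exact hC _
  -- The derivative of q_n is as large as n + 1, but only where s ≤ 1/(n + 1). Hence w q_n'(|w|) A
  -- is dominated by a multiple of |A| uniformly in n, and it tends to zero pointwise.
  have hsq : ∀ n s, 0 ≤ s → s * |deriv (q n) s| ≤ C := fun n s hs => by
    rw [hqd, abs_mul, abs_of_nonneg (by positivity : (0 : ℝ) ≤ n + 1), ← mul_assoc, mul_comm s]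
    rcases le_total 1 ((n + 1) * s) with h1 | h1
    · rw [hκ.right _ h1, abs_zero, mul_zero]; exact hC0
    · calc (n + 1) * s * |κ ((n + 1) * s)| ≤ 1 * C :=
          mul_le_mul h1 (hC _) (abs_nonneg _) zero_le_one
        _ = C := one_mul C
  have hlarge : ∀ s : ℝ, 0 < s → ∀ᶠ n : ℕ in atTop, 1 ≤ ((n : ℝ) + 1) * s := fun s hs => by
    obtain ⟨n₀, hn₀⟩ := exists_nat_ge s⁻¹
    filter_upwards [eventually_ge_atTop n₀] with n hn
    have : s⁻¹ ≤ (n : ℝ) + 1 := hn₀.trans (by have : (n₀ : ℝ) ≤ n := (by exact_mod_cast hn); linarith)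
    calc (1 : ℝ) = s⁻¹ * s := (inv_mul_cancel₀ hs.ne').symm
      _ ≤ _ := by gcongr
  have hqm : ∀ n, Measurable fun z => q n (|u z| ^ m) := fun n =>
    (hqs n).continuous.measurable.comp h.measurable_pow
  have hqm' : ∀ n, Measurable fun z => deriv (q n) (|u z| ^ m) := fun n =>
    ((hqs n).continuous_deriv (by simp)).measurable.comp h.measurable_pow
  have hset : MeasurableSet {z : Space N × ℝ | 0 < |u z| ^ m} :=
    measurableSet_lt measurable_const h.measurable_pow
  let ind : Space N × ℝ → ℝ := {z : Space N × ℝ | 0 < |u z| ^ m}.indicator fun _ => 1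
  have hind : Measurable ind := measurable_const.indicator hset
  have hind1 : ∀ z, |ind z| ≤ 1 := fun z => by
    by_cases hz : 0 < |u z| ^ m <;> simp [ind, hz]
  have hlim_q : ∀ z, Tendsto (fun n => q n (|u z| ^ m)) atTop (𝓝 (ind z)) := fun z => by
    by_cases hz : 0 < |u z| ^ m
    · refine tendsto_const_nhds.congr' ?_
      filter_upwards [hlarge _ hz] with n hn
      simp only [ind, indicator_of_mem (show z ∈ {z : Space N × ℝ | 0 < |u z| ^ m} from hz), q]
      rw [hκ.prim_eq_of_le hn, hκ1]
    · have hz0 : |u z| ^ m = 0 := le_antisymm (not_lt.1 hz) (by positivity)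
      simp only [hz0, hq0]
      simp [ind, hz0]
  have key : ∀ i, (fun z => G z i) =ᵐ[volume.restrict (cyl Ω T)] fun z => ind z * G z i := by
    intro i
    have lG := h.locallyIntegrableOn_G i
    have lA := h.locallyIntegrableOn_A i
    refine HasWeakDeriv.ae_eq hU lG (bdd_mul_locallyIntegrableOn hind hind1 lG)
      (h.weak.hasWeakDeriv i) fun ζ hζ => ?_
    have hn : ∀ n, ∫ z in cyl Ω T, sgnPow m (u z) * q n (|u z| ^ m) * fderiv ℝ ζ z (basisVec i, 0)
        = -∫ z in cyl Ω T, (q n (|u z| ^ m) * G z i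
          + sgnPow m (u z) * (deriv (q n) (|u z| ^ m) * A z i)) * ζ z := fun n => by
      refine HasWeakDeriv.mul (L := max (L ^ m) 1) hU hUμ h.measurable_w.aestronglyMeasurable
        (hqm n).aestronglyMeasurable (fun z => (hwL z).trans (le_max_left _ _))
        (fun z => (hq1 n _).trans (le_max_right _ _)) lG ?_ (h.weak.hasWeakDeriv i)
        (h.hasWeakDeriv_comp (hqs n) (hq0 n) (hqb n) i) ζ hζ
      exact bdd_mul_locallyIntegrableOn (hqm' n) (fun z => hqb n _) lA
    obtain ⟨B, hB⟩ := hζ.exists_bound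
    have hB0 : 0 ≤ B := (abs_nonneg _).trans (hB 0)
    have hGK : Integrable ((tsupport ζ).indicator fun z => ‖G z i‖) (volume.restrict (cyl Ω T)) :=
      ((integrable_indicator_iff (isClosed_tsupport _).measurableSet).2
        (lG.integrableOn_compact_subset hζ.support hζ.compact.isCompact).norm).restrict
    have hAi : Integrable (fun z => ‖A z i‖) (volume.restrict (cyl Ω T)) :=
      ((memLp_coord h.memLp i).integrable (by simp)).norm
    have t1 : Tendsto (fun n => ∫ z in cyl Ω T,
        sgnPow m (u z) * q n (|u z| ^ m) * fderiv ℝ ζ z (basisVec i, 0)) atTop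
        (𝓝 (∫ z in cyl Ω T, sgnPow m (u z) * fderiv ℝ ζ z (basisVec i, 0))) := by
      refine tendsto_integral_of_dominated_convergence
        (fun z => L ^ m * ‖fderiv ℝ ζ z (basisVec i, 0)‖) (fun n => ?_) ?_
        (fun n => ae_of_all _ fun z => ?_) (ae_of_all _ fun z => ?_)
      · exact ((h.measurable_w.mul (hqm n)).aestronglyMeasurable).mul
          (hζ.continuous_fderiv.clm_apply continuous_const).aestronglyMeasurable
      · exact ((hζ.memLp_fderiv 1 _).integrable le_rfl).norm.const_mul _
      · rw [norm_mul, norm_mul]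
        gcongr
        calc ‖sgnPow m (u z)‖ * ‖q n (|u z| ^ m)‖ ≤ L ^ m * 1 :=
              mul_le_mul (hwL z) (hq1 n _) (norm_nonneg _) ((abs_nonneg _).trans (hwL z))
          _ = L ^ m := mul_one _
      · have : sgnPow m (u z) * ind z = sgnPow m (u z) := by
          by_cases hz : 0 < |u z| ^ m
          · simp [ind, hz]
          · have hz0 : |u z| ^ m = 0 := le_antisymm (not_lt.1 hz) (by positivity)
            have hw0 : sgnPow m (u z) = 0 := by rw [← abs_eq_zero, h.abs_w, hz0]
            simp [hw0]
        have h2 := ((hlim_q z).const_mul (sgnPow m (u z))).mul_const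
          (fderiv ℝ ζ z (basisVec i, 0))
        rwa [this] at h2
    have hGm : AEStronglyMeasurable (fun z => G z i) (volume.restrict (cyl Ω T)) :=
      lG.aestronglyMeasurable
    have hAm : AEStronglyMeasurable (fun z => A z i) (volume.restrict (cyl Ω T)) :=
      aestronglyMeasurable_coord h.memLp.1 i
    have t2 : Tendsto (fun n => ∫ z in cyl Ω T, (q n (|u z| ^ m) * G z i
          + sgnPow m (u z) * (deriv (q n) (|u z| ^ m) * A z i)) * ζ z) atTop
        (𝓝 (∫ z in cyl Ω T, ind z * G z i * ζ z)) := by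
      refine tendsto_integral_of_dominated_convergence
        (fun z => (tsupport ζ).indicator (fun z => ‖G z i‖) z * B + C * B * ‖A z i‖) (fun n => ?_) ?_
        (fun n => ae_of_all _ fun z => ?_) (ae_of_all _ fun z => ?_)
      · exact (((hqm n).aestronglyMeasurable.mul hGm).add
          (h.measurable_w.aestronglyMeasurable.mul
            ((hqm' n).aestronglyMeasurable.mul hAm))).mul hζ.continuous.aestronglyMeasurable
      · exact (hGK.mul_const _).add (hAi.const_mul _)
      · rw [add_mul]
        refine (norm_add_le _ _).trans (add_le_add ?_ ?_)
        · by_cases hz : z ∈ tsupport ζ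
          · rw [indicator_of_mem hz, norm_mul, norm_mul]
            gcongr
            · calc ‖q n (|u z| ^ m)‖ * ‖G z i‖ ≤ 1 * ‖G z i‖ := by gcongr; exact hq1 n _
                _ = _ := one_mul _
            · exact hB z
          · simp [image_eq_zero_of_notMem_tsupport hz, hz]
        · rw [norm_mul, norm_mul, norm_mul, ← mul_assoc, Real.norm_eq_abs (sgnPow _ _), h.abs_w]
          calc |u z| ^ m * ‖deriv (q n) (|u z| ^ m)‖ * ‖A z i‖ * ‖ζ z‖ ≤ C * ‖A z i‖ * B := by
                gcongr
                · exact hsq n _ (by positivity)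
                · exact hB z
            _ = _ := by ring
      · have h1 : Tendsto (fun n => sgnPow m (u z) * (deriv (q n) (|u z| ^ m) * A z i)) atTop
            (𝓝 0) := by
          by_cases hz : 0 < |u z| ^ m
          · refine tendsto_const_nhds.congr' ?_
            filter_upwards [hlarge _ hz] with n hn
            rw [hqd, hκ.right _ hn]; simp
          · have hz0 : |u z| ^ m = 0 := le_antisymm (not_lt.1 hz) (by positivity)
            have hw0 : sgnPow m (u z) = 0 := by rw [← abs_eq_zero, h.abs_w, hz0]
            simp [hw0]
        have h2 := ((((hlim_q z).mul_const (G z i)).add h1).mul_const (ζ z))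
        simpa using h2
    exact tendsto_nhds_unique t1 (t2.neg.congr fun n => (hn n).symm)
  filter_upwards [ae_all_iff.2 key] with z hz h0
  ext i
  rw [hz i]
  simp [ind, h0]

/-- Off the zero set |w| cancels in wG = |w|A, and on it G vanishes. In particular G, assumed only
locally integrable, is square integrable. -/
theorem norm_weak_le : ∀ᵐ z ∂volume.restrict (cyl Ω T), ‖G z‖ ≤ ‖A z‖ := by
  filter_upwards [h.smul_weak_ae_eq, h.weak_eq_zero] with z h1 h2
  rcases eq_or_ne (|u z| ^ m) 0 with h0 | h0
  · rw [h2 h0, norm_zero]; exact norm_nonneg _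
  · have := congrArg norm h1
    rw [norm_smul, norm_smul, Real.norm_eq_abs, Real.norm_eq_abs, h.abs_w,
      abs_of_nonneg (by positivity : 0 ≤ |u z| ^ m)] at this
    exact (mul_left_cancel₀ h0 this).le

theorem norm_weak_eq : ∀ᵐ z ∂volume.restrict (cyl Ω T), |u z| ^ m ≠ 0 → ‖G z‖ = ‖A z‖ := by
  filter_upwards [h.smul_weak_ae_eq] with z h1 h0
  have := congrArg norm h1
  rw [norm_smul, norm_smul, Real.norm_eq_abs, Real.norm_eq_abs, h.abs_w,
    abs_of_nonneg (by positivity : 0 ≤ |u z| ^ m)] at this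
  exact mul_left_cancel₀ h0 this

theorem memLp_weak : MemLp G 2 (volume.restrict (cyl Ω T)) :=
  h.memLp.mono h.weak.2.1.aestronglyMeasurable h.norm_weak_le

/-- The test function `sgn(w) ∫₀^{|w|} ρ` is in `H¹₀(Ω)` at almost every time. -/
theorem slices_test {ρ : ℝ → ℝ} {ε b : ℝ} (hρ : IsProfile ρ ε b) :
    ∀ᵐ t ∂volume.restrict (Ioo 0 T),
      IsH10WithGradient Ω (fun x => sgnPow m (u (x, t)) * quot ρ (|u (x, t)| ^ m))
        (fun x => ρ (|u (x, t)| ^ m) • G (x, t)) := by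
  have hfin := isFiniteMeasure_cyl (T := T) h.isBounded
  have hU : IsOpen (cyl Ω T) := isOpen_cyl h.isOpen
  have hUμ := volume_cyl_ne_top (T := T) h.volume_ne_top
  have hwL : ∀ z, |sgnPow m (u z)| ≤ L ^ m := fun z => (h.abs_w z).trans_le (h.pow_le z)
  obtain ⟨C, hC⟩ := hρ.exists_bound_deriv_quot
  obtain ⟨K, hK0, hK⟩ := hρ.exists_bound
  obtain ⟨Q, hQ⟩ := (isCompact_Icc (a := -(L ^ m)) (b := L ^ m)).exists_bound_of_continuousOn
    hρ.contDiff_quot.continuous.continuousOn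
  have hQ' : ∀ z, |quot ρ (|u z| ^ m)| ≤ Q := fun z => hQ _ (abs_le.1 (h.abs_pow_le z))
  have hqm : Measurable fun z => quot ρ (|u z| ^ m) :=
    hρ.contDiff_quot.continuous.measurable.comp h.measurable_pow
  have hfm : Measurable fun z => sgnPow m (u z) * quot ρ (|u z| ^ m) := h.measurable_w.mul hqm
  have hfR : ∀ z, |sgnPow m (u z) * quot ρ (|u z| ^ m)| ≤ prim ρ b := fun z => by
    have h0 : 0 ≤ |u z| ^ m := by positivity
    have : 0 ≤ quot ρ (|u z| ^ m) := div_nonneg (hρ.prim_nonneg _) h0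
    rw [abs_mul, h.abs_w, abs_of_nonneg this, hρ.mul_quot]
    exact hρ.prim_le _
  have mf : MemLp (fun z => sgnPow m (u z) * quot ρ (|u z| ^ m)) 2 (volume.restrict (cyl Ω T)) :=
    MemLp.of_bound hfm.aestronglyMeasurable _ (ae_of_all _ hfR)
  have hρm : Measurable fun z => ρ (|u z| ^ m) :=
    hρ.smooth.continuous.measurable.comp h.measurable_pow
  have mB : MemLp (fun z => ρ (|u z| ^ m) • G z) 2 (volume.restrict (cyl Ω T)) := by
    refine (h.memLp_weak.const_smul K).mono (hρm.aestronglyMeasurable.smul h.memLp_weak.1)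
      (ae_of_all _ fun z => ?_)
    rw [norm_smul, Pi.smul_apply, norm_smul, Real.norm_of_nonneg hK0]
    gcongr
    exact hK _
  have hwd : ∀ i, HasWeakDeriv volume (cyl Ω T) (basisVec i, 0)
      (fun z => sgnPow m (u z) * quot ρ (|u z| ^ m)) (fun z => (ρ (|u z| ^ m) • G z) i) := by
    intro i
    -- The product rule gives quot(|w|) G + w quot'(|w|) A. The relation wA = |w|G, valid where w ≠
    -- 0, turns this into ρ(|w|)G.
    have h1 := HasWeakDeriv.mul (L := max (L ^ m) Q) hU hUμ h.measurable_w.aestronglyMeasurable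
        hqm.aestronglyMeasurable (fun z => (hwL z).trans (le_max_left _ _))
        (fun z => (hQ' z).trans (le_max_right _ _)) (h.locallyIntegrableOn_G i)
        (bdd_mul_locallyIntegrableOn (((hρ.contDiff_quot.continuous_deriv (by simp)).measurable).comp
          h.measurable_pow) (fun z => hC _) (h.locallyIntegrableOn_A i))
        (h.weak.hasWeakDeriv i)
        (h.hasWeakDeriv_comp hρ.contDiff_quot (hρ.quot_eq_zero hρ.pos.le) hC i)
    intro ζ hζ
    rw [h1 ζ hζ]
    congr 1
    refine integral_congr_ae ?_
    filter_upwards [h.smul_weak_ae_eq] with z hz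
    rcases eq_or_ne (|u z| ^ m) 0 with h0 | h0
    · have hw0 : sgnPow m (u z) = 0 := by rw [← abs_eq_zero, h.abs_w, h0]
      simp [h0, hw0, hρ.quot_eq_zero hρ.pos.le, hρ.left 0 hρ.pos.le]
    · have hzi : sgnPow m (u z) * G z i = |u z| ^ m * A z i := by
        have := congrArg (fun v : Space N => v i) hz
        simpa using this
      have hww : sgnPow m (u z) * sgnPow m (u z) = |u z| ^ m * |u z| ^ m := by
        rw [← h.abs_w z, abs_mul_abs_self]
      have hwA : sgnPow m (u z) * A z i = |u z| ^ m * G z i := by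
        refine mul_left_cancel₀ h0 ?_
        calc |u z| ^ m * (sgnPow m (u z) * A z i) = sgnPow m (u z) * (|u z| ^ m * A z i) := by ring
          _ = sgnPow m (u z) * sgnPow m (u z) * G z i := by rw [← hzi]; ring
          _ = _ := by rw [hww]; ring
      have hd := hρ.quot_add_mul_deriv (|u z| ^ m)
      simp only [PiLp.smul_apply, smul_eq_mul, Function.comp]
      rw [← hd]
      have : sgnPow m (u z) * (deriv (quot ρ) (|u z| ^ m) * A z i)
          = deriv (quot ρ) (|u z| ^ m) * (sgnPow m (u z) * A z i) := by ring
      rw [this, hwA]; ring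
  -- With δ = ε the step equals 1 from ε on, so it does not change the test function or its
  -- gradient, both of which vanish where |u|^m ≤ ε. Its own derivative is supported where they
  -- vanish.
  obtain ⟨κ, hκ, hκ1⟩ := exists_isProfile_step hρ.pos
  obtain ⟨D, hD0, hD⟩ := hκ.exists_bound
  filter_upwards [ae_slice_hasWeakDeriv mf mB hwd, h.slices, memLp_slice mB] with t h1 h2 h3
  refine isH10WithGradient_of_cutoff (q := prim κ) (C := max 1 D) h.isOpen h.volume_ne_top
    (hfm.comp measurable_prodMk_right).aestronglyMeasurable (fun x => hfR (x, t)) h3 h1 h2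
    hκ.contDiff_prim (hκ.prim_eq_zero hκ.pos.le) (fun s => ?_) (fun s => ?_) (fun x => ?_)
    (fun x => ?_) (fun x => ?_)
  · rw [abs_of_nonneg (hκ.prim_nonneg s), ← hκ1]
    exact (hκ.prim_le s).trans (le_max_left _ _)
  · rw [hκ.deriv_prim]; exact (hD s).trans (le_max_right _ _)
  · rcases le_total (|u (x, t)| ^ m) ε with hs | hs
    · rw [hρ.quot_eq_zero hs]; simp
    · rw [hκ.prim_eq_of_le hs, hκ1, mul_one]
  · rw [hκ.deriv_prim]
    rcases le_total (|u (x, t)| ^ m) ε with hs | hs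
    · rw [hρ.quot_eq_zero hs]; simp
    · rw [hκ.right _ hs, mul_zero]
  · rcases le_total (|u (x, t)| ^ m) ε with hs | hs
    · rw [hρ.left _ hs]; simp
    · rw [hκ.prim_eq_of_le hs, hκ1, one_smul]

end IsRegular

end

/-! ### Distributional time derivatives, time translations, and the convex energy density -/

section

/-- A continuous function whose distributional derivative on `[0,T)` is `F`, with initial value `S`,
is `S + ∫₀ᵗ F`. -/
theorem eq_add_integral_of_weak_deriv {U F : ℝ → ℝ} {S T : ℝ} (hT : 0 < T)
    (hU : ContinuousOn U (Icc 0 T)) (hF : IntervalIntegrable F volume 0 T)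
    (h : ∀ η, IsSmoothTest (Iio T) η →
      -(∫ t in (0 : ℝ)..T, U t * deriv η t) = (∫ t in (0 : ℝ)..T, F t * η t) + η 0 * S) :
    ∀ t ∈ Icc 0 T, U t = S + ∫ s in (0 : ℝ)..t, F s := by
  set V : ℝ → ℝ := fun t => S + ∫ s in (0 : ℝ)..t, F s with hV
  have hVac : AbsolutelyContinuousOnInterval V 0 T := by
    have h1 : AbsolutelyContinuousOnInterval (fun _ : ℝ => S) 0 T :=
      ContDiffOn.absolutelyContinuousOnInterval contDiffOn_const
    exact h1.add (hF.absolutelyContinuousOnInterval_intervalIntegral left_mem_uIcc)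
  have hVc : ContinuousOn V (Icc 0 T) := by
    have := hVac.continuousOn
    rwa [uIcc_of_le hT.le] at this
  have hV' : ∀ᵐ t, t ∈ uIoc 0 T → deriv V t = F t := by
    filter_upwards [hF.ae_hasDerivAt_integral] with t ht htm
    exact ((ht (uIoc_subset_uIcc htm) 0 left_mem_uIcc).const_add S).deriv
  -- The primitive `V` is absolutely continuous and satisfies the same identity by integration by
  -- parts, so the difference U − V has zero derivative and zero initial value in the weak sense.
  have hd : ∀ η, IsSmoothTest (Iio T) η → ∫ t in (0 : ℝ)..T, (U t - V t) * deriv η t = 0 := by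
    intro η hη
    have hηT : η T = 0 := image_eq_zero_of_notMem_tsupport fun hm => lt_irrefl T (hη.support hm)
    have hηac : AbsolutelyContinuousOnInterval η 0 T :=
      ContDiffOn.absolutelyContinuousOnInterval
        ((hη.smooth.of_le (by simp)).contDiffOn)
    have hp := hVac.integral_mul_deriv_eq_deriv_mul hηac
    have e1 : ∫ t in (0 : ℝ)..T, deriv V t * η t = ∫ t in (0 : ℝ)..T, F t * η t := by
      refine intervalIntegral.integral_congr_ae ?_
      filter_upwards [hV'] with t ht htm
      rw [ht htm]
    have hV0 : V 0 = S := by simp [hV]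
    have hη' : Continuous (deriv η) := hη.smooth.continuous_deriv (by simp)
    rw [hηT, hV0, e1] at hp
    have i1 : IntervalIntegrable (fun t => U t * deriv η t) volume 0 T := by
      refine ContinuousOn.intervalIntegrable ?_
      rw [uIcc_of_le hT.le]
      exact hU.mul hη'.continuousOn
    have i2 : IntervalIntegrable (fun t => V t * deriv η t) volume 0 T := by
      refine ContinuousOn.intervalIntegrable ?_
      rw [uIcc_of_le hT.le]
      exact hVc.mul hη'.continuousOn
    simp_rw [sub_mul]
    rw [intervalIntegral.integral_sub i1 i2, hp]
    have := h η hη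
    linarith
  have hk : ∀ κ : ℝ → ℝ, ContDiff ℝ ∞ κ → HasCompactSupport κ → tsupport κ ⊆ Ioo 0 T →
      ∫ t, κ t • (U t - V t) = 0 := by
    intro κ k1 k2 k3
    have hκc := k1.continuous
    -- a point of `(0,T)` to the right of the support of `κ`
    obtain ⟨b, hb0, hbT, hb⟩ : ∃ b, 0 < b ∧ b < T ∧ ∀ t, b ≤ t → κ t = 0 := by
      rcases (tsupport κ).eq_empty_or_nonempty with he | hne
      · exact ⟨T / 2, by linarith, by linarith, fun t _ =>
          image_eq_zero_of_notMem_tsupport (by simp [he])⟩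
      · obtain ⟨b, hbm, hbu⟩ := k2.isCompact.exists_isGreatest hne
        have hbm' := k3 hbm
        refine ⟨(b + T) / 2, by linarith [hbm'.1, hbm'.2], by linarith [hbm'.1, hbm'.2],
          fun t ht => image_eq_zero_of_notMem_tsupport fun hm => ?_⟩
        have := hbu hm
        linarith [hbm'.1, hbm'.2]
    -- Any κ supported in (0,T) is the derivative of a function that vanishes near T. No mean-zero
    -- condition is needed, because test functions need not vanish at 0. Hence U − V is zero and not
    -- merely constant.
    let K : ℝ → ℝ := fun t => -∫ s in t..T, κ s
    have hKd : ∀ t, HasDerivAt K (κ t) t := fun t => by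
      have := (intervalIntegral.integral_hasDerivAt_left (hκc.intervalIntegrable t T)
        (hκc.stronglyMeasurableAtFilter _ _) hκc.continuousAt).neg
      rwa [neg_neg] at this
    have hKs : ContDiff ℝ ∞ K := by
      rw [contDiff_infty_iff_deriv, show deriv K = κ from funext fun t => (hKd t).deriv]
      exact ⟨fun t => (hKd t).differentiableAt, k1⟩
    have hK0 : ∀ t, b ≤ t → K t = 0 := fun t ht => by
      simp only [K]
      rw [intervalIntegral.integral_zero_ae, neg_zero]
      refine ae_of_all _ fun s hs => hb s ?_
      exact (le_min ht hbT.le).trans hs.1.le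
    -- χ equals 1 on a neighbourhood of [0,T]; its only role is to make the support compact at
    -- negative times.
    let χ : ContDiffBump (0 : ℝ) := ⟨T + 1, T + 2, by linarith, by linarith⟩
    have hη : IsSmoothTest (Iio T) (fun t => χ t * K t) := by
      refine ⟨χ.contDiff.mul hKs, χ.hasCompactSupport.mul_right, ?_⟩
      refine (closure_minimal (t := Iic b) (fun t ht => ?_) isClosed_Iic).trans
        (fun t (ht : t ≤ b) => lt_of_le_of_lt ht hbT)
      by_contra hbt
      exact ht (by simp only [hK0 t (not_le.1 hbt).le, mul_zero])
    have hη' : ∀ t ∈ Icc 0 T, deriv (fun t => χ t * K t) t = κ t := fun t ht => by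
      have hball : t ∈ Metric.ball (0 : ℝ) χ.rIn := by
        rw [Real.ball_eq_Ioo]
        simp only [χ]
        constructor <;> linarith [ht.1, ht.2]
      have he : (fun t => χ t * K t) =ᶠ[𝓝 t] K := by
        filter_upwards [χ.eventuallyEq_one_of_mem_ball hball] with s hs
        rw [hs]; simp
      rw [he.deriv_eq, (hKd t).deriv]
    have h0 := hd _ hη
    have e1 : ∫ t in (0 : ℝ)..T, (U t - V t) * deriv (fun t => χ t * K t) t
        = ∫ t in (0 : ℝ)..T, κ t • (U t - V t) := by
      refine intervalIntegral.integral_congr fun t ht => ?_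
      rw [uIcc_of_le hT.le] at ht
      simp only [smul_eq_mul]
      rw [hη' t ht, mul_comm]
    rw [e1, intervalIntegral.integral_of_le hT.le] at h0
    rw [← h0, setIntegral_eq_integral_of_forall_compl_eq_zero]
    intro t ht
    rw [image_eq_zero_of_notMem_tsupport (fun hm => ht (Ioo_subset_Ioc_self (k3 hm))), zero_smul]
  have hae := isOpen_Ioo.ae_eq_zero_of_integral_contDiff_smul_eq_zero (U := Ioo 0 T)
    ((hU.sub hVc).mono Ioo_subset_Icc_self |>.locallyIntegrableOn measurableSet_Ioo) hk
  have hae' : U =ᵐ[volume.restrict (Icc 0 T)] V := by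
    rw [← restrict_Ioo_eq_restrict_Icc]
    rw [EventuallyEq, ae_restrict_iff' measurableSet_Ioo]
    filter_upwards [hae] with t ht htm using sub_eq_zero.1 (ht htm)
  exact Measure.eqOn_Icc_of_ae_eq volume hT.ne hae' hU hVc

section Pairing

variable {N : ℕ} {F : Type*} [NormedAddCommGroup F] [InnerProductSpace ℝ F]
  {P Q : Space N × ℝ → F}

omit [InnerProductSpace ℝ F] in
theorem memLp_time_translate (hP : MemLp P 2 volume) (r : ℝ) :
    MemLp (fun z : Space N × ℝ => P (z.1, z.2 - r)) 2 volume := by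
  have := hP.comp_measurePreserving 
    (measurePreserving_sub_right (volume : Measure (Space N × ℝ)) (0, r))
  refine (memLp_congr_ae (ae_of_all _ fun z => ?_)).1 this
  simp [Function.comp, Prod.sub_def]

theorem tendsto_integral_inner_time_translate (hP : MemLp P 2 volume) (hQ : MemLp Q 2 volume) :
    Tendsto (fun r => ∫ z : Space N × ℝ, ⟪P (z.1, z.2 - r), Q z⟫_ℝ) (𝓝 0)
      (𝓝 (∫ z, ⟪P z, Q z⟫_ℝ)) := by
  refine tendsto_integral_inner (fun r => memLp_time_translate hP r) hP hQ ?_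
  have h1 := tendsto_eLpNorm_translate (p := 2) (by simp) hP
  have h2 : Tendsto (fun r : ℝ => ((0, r) : Space N × ℝ)) (𝓝 0) (𝓝 0) := by
    have : Continuous fun r : ℝ => ((0, r) : Space N × ℝ) := by fun_prop
    exact this.tendsto 0
  refine (h1.comp h2).congr fun r => ?_
  simp [Function.comp, Prod.sub_def]

/-- The pairing is at most ‖P‖² + ‖Q‖² with `P` shifted, and the integral of the shifted square does
not depend on the shift. The integrals in z are thus uniformly bounded over the bounded range of
shifts. -/
theorem integrable_inner_time_translate (hPm : StronglyMeasurable P) (hQm : StronglyMeasurable Q)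
    (hP : MemLp P 2 volume) (hQ : MemLp Q 2 volume) (h : ℝ) :
    Integrable (fun y : (Space N × ℝ) × ℝ => ⟪P (y.1.1, y.1.2 - y.2), Q y.1⟫_ℝ)
      ((volume : Measure (Space N × ℝ)).prod (volume.restrict (Ioc 0 h))) := by
  have hm : StronglyMeasurable fun y : (Space N × ℝ) × ℝ => ⟪P (y.1.1, y.1.2 - y.2), Q y.1⟫_ℝ :=
    (hPm.comp_measurable (by fun_prop)).inner (hQm.comp_measurable measurable_fst)
  rw [integrable_prod_iff' hm.aestronglyMeasurable]
  refine ⟨ae_of_all _ fun r => integrable_inner_of_memLp (memLp_time_translate hP r) hQ, ?_⟩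
  have hb : ∀ r, ∫ z : Space N × ℝ, ‖⟪P (z.1, z.2 - r), Q z⟫_ℝ‖
      ≤ ∫ z : Space N × ℝ, ‖P z‖ ^ 2 + ‖Q z‖ ^ 2 := by
    intro r
    have i1 := (memLp_two_iff_integrable_sq_norm hP.1).1 hP
    have i1' := (memLp_two_iff_integrable_sq_norm (memLp_time_translate hP r).1).1
      (memLp_time_translate hP r)
    have i2 := (memLp_two_iff_integrable_sq_norm hQ.1).1 hQ
    have e : ∫ z : Space N × ℝ, ‖P (z.1, z.2 - r)‖ ^ 2 = ∫ z, ‖P z‖ ^ 2 := by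
      rw [← integral_sub_right_eq_self (fun z => ‖P z‖ ^ 2) ((0, r) : Space N × ℝ)]
      simp [Prod.sub_def]
    calc _ ≤ ∫ z : Space N × ℝ, ‖P (z.1, z.2 - r)‖ ^ 2 + ‖Q z‖ ^ 2 := by
          refine integral_mono
            (integrable_inner_of_memLp (memLp_time_translate hP r) hQ).norm (i1'.add i2) fun z => ?_
          have := norm_inner_le_norm (𝕜 := ℝ) (P (z.1, z.2 - r)) (Q z)
          nlinarith [sq_nonneg (‖P (z.1, z.2 - r)‖ - ‖Q z‖), norm_nonneg (P (z.1, z.2 - r)),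
            norm_nonneg (Q z)]
      _ = _ := by rw [integral_add i1' i2, integral_add i1 i2, e]
  refine Integrable.mono' (integrable_const (∫ z : Space N × ℝ, ‖P z‖ ^ 2 + ‖Q z‖ ^ 2))
    (hm.norm.integral_prod_left').aestronglyMeasurable (ae_of_all _ fun r => ?_)
  rw [Real.norm_of_nonneg (by positivity)]
  exact hb r

end Pairing

section Convex

variable {m : ℝ} {ρ : ℝ → ℝ} {ε b : ℝ}

/-- The test nonlinearity `r ↦ sgn(r) ∫₀^{|r|^m} ρ`. -/
def testFn (m : ℝ) (ρ : ℝ → ℝ) (r : ℝ) : ℝ := sgnPow m r * quot ρ (|r| ^ m)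

/-- The primitive of the test nonlinearity. -/
def energyFn (m : ℝ) (ρ : ℝ → ℝ) (x : ℝ) : ℝ := ∫ r in (0 : ℝ)..x, testFn m ρ r

theorem testFn_neg (m : ℝ) (ρ : ℝ → ℝ) (r : ℝ) : testFn m ρ (-r) = -testFn m ρ r := by
  simp [testFn, sgnPow]

theorem testFn_of_nonneg (hm : 0 < m) (hρ : IsProfile ρ ε b) {r : ℝ} (hr : 0 ≤ r) :
    testFn m ρ r = prim ρ (r ^ m) := by
  have : sgnPow m r = r ^ m := by
    rw [← abs_of_nonneg hr, ← abs_sgnPow hm, abs_of_nonneg hr, abs_of_nonneg]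
    rw [sgnPow]; positivity
  rw [testFn, this, abs_of_nonneg hr, hρ.mul_quot]

theorem monotone_testFn (hm : 0 < m) (hρ : IsProfile ρ ε b) : Monotone (testFn m ρ) := by
  have h1 : MonotoneOn (testFn m ρ) (Ici 0) := fun x hx y hy hxy => by
    rw [testFn_of_nonneg hm hρ hx, testFn_of_nonneg hm hρ hy]
    exact hρ.monotone_prim (Real.rpow_le_rpow hx hxy hm.le)
  have h2 : MonotoneOn (testFn m ρ) (Iic 0) := fun x hx y hy hxy => by
    have := h1 (show -y ∈ Ici 0 by simpa using hy) (show -x ∈ Ici 0 by simpa using hx)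
      (neg_le_neg hxy)
    rw [testFn_neg, testFn_neg] at this
    linarith
  exact h2.Iic_union_Ici h1

theorem abs_testFn_le (hm : 0 < m) (hρ : IsProfile ρ ε b) (r : ℝ) :
    |testFn m ρ r| ≤ prim ρ b := by
  have key : ∀ r, 0 ≤ r → |testFn m ρ r| ≤ prim ρ b := fun r hr => by
    rw [testFn_of_nonneg hm hρ hr, abs_of_nonneg (hρ.prim_nonneg _)]
    exact hρ.prim_le _
  rcases le_total 0 r with hr | hr
  · exact key r hr
  · have := key (-r) (by linarith)
    rwa [testFn_neg, abs_neg] at this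

theorem energyFn_sub (hm : 0 < m) (hρ : IsProfile ρ ε b) (x y : ℝ) :
    energyFn m ρ x - energyFn m ρ y = ∫ r in y..x, testFn m ρ r :=
  intervalIntegral.integral_interval_sub_left (monotone_testFn hm hρ).intervalIntegrable
    (monotone_testFn hm hρ).intervalIntegrable

/-- Convexity of the energy density. -/
theorem energyFn_sub_le (hm : 0 < m) (hρ : IsProfile ρ ε b) (x y : ℝ) :
    energyFn m ρ x - energyFn m ρ y ≤ (x - y) * testFn m ρ x := by
  have hmono := monotone_testFn hm hρ
  rw [energyFn_sub hm hρ]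
  rcases le_total y x with h | h
  · calc ∫ r in y..x, testFn m ρ r ≤ ∫ _ in y..x, testFn m ρ x :=
        intervalIntegral.integral_mono_on h hmono.intervalIntegrable (by simp)
          fun r hr => hmono hr.2
      _ = _ := by simp
  · rw [intervalIntegral.integral_symm]
    have : ∫ _ in x..y, testFn m ρ x ≤ ∫ r in x..y, testFn m ρ r :=
        intervalIntegral.integral_mono_on h (by simp) hmono.intervalIntegrable
          fun r hr => hmono hr.1
    simp only [intervalIntegral.integral_const, smul_eq_mul] at this
    linarith

theorem abs_energyFn_sub_le (hm : 0 < m) (hρ : IsProfile ρ ε b) (x y : ℝ) :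
    |energyFn m ρ x - energyFn m ρ y| ≤ prim ρ b * |x - y| := by
  rw [energyFn_sub hm hρ]
  exact intervalIntegral.norm_integral_le_of_norm_le_const (f := testFn m ρ) (C := prim ρ b)
    fun r _ => abs_testFn_le hm hρ r

theorem continuous_energyFn (hm : 0 < m) (hρ : IsProfile ρ ε b) : Continuous (energyFn m ρ) :=
  (LipschitzWith.of_dist_le_mul (K := ⟨prim ρ b, hρ.prim_nonneg b⟩)
    fun x y => abs_energyFn_sub_le hm hρ x y).continuous

theorem energyFn_zero : energyFn m ρ 0 = 0 := by simp [energyFn]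

theorem energyFn_neg (x : ℝ) : energyFn m ρ (-x) = energyFn m ρ x := by
  unfold energyFn
  have := intervalIntegral.integral_comp_neg (a := 0) (b := x) (testFn m ρ)
  simp only [testFn_neg, neg_zero, intervalIntegral.integral_neg] at this
  rw [intervalIntegral.integral_symm, ← this, neg_neg]

theorem energyFn_abs (x : ℝ) : energyFn m ρ |x| = energyFn m ρ x := by
  rcases abs_choice x with h | h <;> rw [h]
  exact energyFn_neg x

theorem energyFn_nonneg (hm : 0 < m) (hρ : IsProfile ρ ε b) (x : ℝ) : 0 ≤ energyFn m ρ x := by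
  rw [← energyFn_abs]
  refine intervalIntegral.integral_nonneg (abs_nonneg x) fun r hr => ?_
  rw [testFn_of_nonneg hm hρ hr.1]
  exact hρ.prim_nonneg _

theorem energyFn_le (hm : 0 < m) (hρ : IsProfile ρ ε b) (x : ℝ) :
    energyFn m ρ x ≤ prim ρ b * |x| := by
  have := abs_energyFn_sub_le hm hρ x 0
  rw [energyFn_zero, sub_zero, sub_zero] at this
  exact (le_abs_self _).trans this

/-- The energy density grows linearly. -/
theorem le_energyFn (hm : 0 < m) (hρ : IsProfile ρ ε b) (x : ℝ) :
    prim ρ b * (|x| - b ^ (1 / m)) ≤ energyFn m ρ x := by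
  have hb : 0 < b := hρ.pos.trans hρ.lt
  have hc : 0 ≤ b ^ (1 / m) := by positivity
  rcases le_total |x| (b ^ (1 / m)) with h | h
  · refine le_trans ?_ (energyFn_nonneg hm hρ x)
    exact mul_nonpos_of_nonneg_of_nonpos (hρ.prim_nonneg b) (by linarith)
  · rw [← energyFn_abs]
    have h1 := energyFn_sub hm hρ |x| (b ^ (1 / m))
    have h2 := energyFn_nonneg hm hρ (b ^ (1 / m))
    -- Beyond r = b^{1/m} one has r^m ≥ b, so the whole mass of ρ has been collected and the test
    -- nonlinearity is constant.
    have h3 : ∫ r in (b ^ (1 / m))..|x|, testFn m ρ r = ∫ _ in (b ^ (1 / m))..|x|, prim ρ b := by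
      refine intervalIntegral.integral_congr fun r hr => ?_
      rw [uIcc_of_le h] at hr
      have hr0 : 0 ≤ r := hc.trans hr.1
      change testFn m ρ r = prim ρ b
      rw [testFn_of_nonneg hm hρ hr0, hρ.prim_eq_of_le]
      calc b = (b ^ (1 / m)) ^ m := by
            rw [← Real.rpow_mul hb.le, one_div_mul_cancel hm.ne', Real.rpow_one]
        _ ≤ r ^ m := Real.rpow_le_rpow hc hr.1 hm.le
    rw [h3, intervalIntegral.integral_const, smul_eq_mul] at h1
    linarith

end Convex

end

/-! ### The equation tested on time slices against a fixed function of `H¹₀` -/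

section

variable {N : ℕ} {Ω : Set (Space N)} {T : ℝ}

theorem dt_tensor (ζ : Space N → ℝ) {η : ℝ → ℝ} (hη : Differentiable ℝ η) (z : Space N × ℝ) :
    dt (fun z : Space N × ℝ => ζ z.1 * η z.2) z = ζ z.1 * deriv η z.2 := by
  simp only [dt]
  exact deriv_const_mul _ (hη _)

theorem gradx_tensor {ζ : Space N → ℝ} (hζ : Differentiable ℝ ζ) (η : ℝ → ℝ) (z : Space N × ℝ) :
    gradx (fun z : Space N × ℝ => ζ z.1 * η z.2) z = η z.2 • gradient ζ z.1 := by
  simp only [gradx, gradient]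
  rw [fderiv_mul_const (hζ _), map_smul]

/-- Products of a test function in space and a test function in time are test functions. -/
theorem isTest_tensor {ζ : Space N → ℝ} {η : ℝ → ℝ} (hζ : IsSmoothTest Ω ζ)
    (hη : IsSmoothTest (Iio T) η) : IsTest Ω T (fun z : Space N × ℝ => ζ z.1 * η z.2) := by
  have h := isSmoothTest_tensor hζ hη
  have hζ2 : ContDiff ℝ 2 ζ := hζ.smooth.of_le (by norm_cast)
  refine ⟨h.compact, h.support, h.continuous, fun x => ?_, ?_, fun t => ?_, ?_, ?_⟩
  · exact hη.differentiable.const_mul (ζ x)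
  · rw [show dt _ = _ from funext fun z => dt_tensor ζ hη.differentiable z]
    exact (hζ.continuous.comp continuous_fst).mul
      ((hη.smooth.continuous_deriv (by simp)).comp continuous_snd)
  · exact hζ2.mul (contDiff_const (c := η t))
  · simp_rw [fderiv_mul_const (hζ.differentiable _)]
    exact (hη.continuous.comp continuous_snd).smul (hζ.continuous_fderiv.comp continuous_fst)
  · have e : ∀ z : Space N × ℝ, iteratedFDeriv ℝ 2 (fun y => ζ y * η z.2) z.1
        = η z.2 • iteratedFDeriv ℝ 2 ζ z.1 := fun z => by
      rw [← iteratedFDeriv_const_smul_apply hζ2.contDiffAt]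
      congr 1; ext y; simp [mul_comm]
    simp only [e]
    exact (hη.continuous.comp continuous_snd).smul
      ((hζ2.continuous_iteratedFDeriv le_rfl).comp continuous_fst)

theorem memLp_fst {F : Type*} [NormedAddCommGroup F] {k : Space N → F} {p : ℝ≥0∞}
    (hk : MemLp k p (volume.restrict Ω)) (T : ℝ) :
    MemLp (fun z : Space N × ℝ => k z.1) p (volume.restrict (cyl Ω T)) := by
  rw [volume_restrict_cyl]
  exact hk.comp_fst _

theorem tendsto_eLpNorm_fst {F : Type*} [NormedAddCommGroup F] {k : ℕ → Space N → F}
    (hk : ∀ n, AEStronglyMeasurable (k n) (volume.restrict Ω))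
    (h : Tendsto (fun n => eLpNorm (k n) 2 (volume.restrict Ω)) atTop (𝓝 0)) (T : ℝ) :
    Tendsto (fun n => eLpNorm (fun z : Space N × ℝ => k n z.1) 2 (volume.restrict (cyl Ω T)))
      atTop (𝓝 0) := by
  have e : ∀ n, eLpNorm (fun z : Space N × ℝ => k n z.1) 2 (volume.restrict (cyl Ω T))
      = (volume.restrict (Ioo 0 T) univ) ^ (1 / 2 : ℝ) * eLpNorm (k n) 2 (volume.restrict Ω) := by
    intro n
    have hm : AEStronglyMeasurable (k n) (Measure.map Prod.fst (volume.restrict (cyl Ω T))) := by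
      rw [volume_restrict_cyl, Measure.map_fst_prod]
      exact (hk n).smul_measure _
    have := eLpNorm_map_measure (p := 2) hm measurable_fst.aemeasurable
    rw [show (fun z : Space N × ℝ => k n z.1) = k n ∘ Prod.fst from rfl, ← this,
      volume_restrict_cyl, Measure.map_fst_prod,
      eLpNorm_smul_measure_of_ne_top (by simp)]
    simp
  simp_rw [e]
  have := ENNReal.Tendsto.const_mul (a := (volume.restrict (Ioo 0 T) univ) ^ (1 / 2 : ℝ)) h
    (Or.inr (by simp [ENNReal.rpow_eq_top_iff]))
  simpa using this

theorem IsCb.memLp {X : Type*} [TopologicalSpace X] [MeasurableSpace X] [OpensMeasurableSpace X]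
    {ν : Measure X} [SecondCountableTopology X] {s : Set X} {f : X → ℝ} (h : IsCb s f)
    (hs : MeasurableSet s) (hν : ν s ≠ ⊤) (p : ℝ≥0∞) : MemLp f p (ν.restrict s) := by
  obtain ⟨hc, B, hB⟩ := h
  have : IsFiniteMeasure (ν.restrict s) := ⟨by simpa using hν.lt_top⟩
  refine MemLp.of_bound (hc.aestronglyMeasurable hs) B ?_
  filter_upwards [ae_restrict_mem hs] with x hx using hB x hx

/-- A weak solution that has been modified on a null set to be measurable and bounded, with the
continuous curve `v` in `L²(Ω)` representing it. -/
structure IsRegularSolution (m L : ℝ) (Ω : Set (Space N)) (T : ℝ) (μ : Space N × ℝ → ℝ)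
    (σ : Space N → ℝ) (u : Space N × ℝ → ℝ) (A G : Space N × ℝ → Space N)
    (v : ℝ → Lp ℝ 2 ((volume : Measure (Space N)).restrict Ω)) : Prop
    extends IsRegular m L Ω T u A G where
  time_pos : 0 < T
  continuousOn : ContinuousOn v (Icc 0 T)
  ae_eq : ∀ᵐ t ∂(volume.restrict (Ioo 0 T)), (fun x => u (x, t)) =ᵐ[volume.restrict Ω] v t
  isCb_source : IsCb (cyl Ω T) μ
  isCb_initial : IsCb Ω σ
  eqn : ∀ φ : Space N × ℝ → ℝ, IsTest Ω T φ →
      -(∫ z in cyl Ω T, u z * dt φ z) + ∫ z in cyl Ω T, ⟪G z, gradx φ z⟫_ℝ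
        = (∫ z in cyl Ω T, φ z * μ z) + ∫ x in Ω, φ (x, 0) * σ x

namespace IsRegularSolution

variable {m L : ℝ} {μ : Space N × ℝ → ℝ} {σ : Space N → ℝ} {u : Space N × ℝ → ℝ}
  {A G : Space N × ℝ → Space N} {v : ℝ → Lp ℝ 2 ((volume : Measure (Space N)).restrict Ω)}
  (h : IsRegularSolution m L Ω T μ σ u A G v)
include h

theorem memLp_source (p : ℝ≥0∞) : MemLp μ p (volume.restrict (cyl Ω T)) :=
  h.isCb_source.memLp (isOpen_cyl h.isOpen).measurableSet (volume_cyl_ne_top h.volume_ne_top) p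

theorem memLp_initial (p : ℝ≥0∞) : MemLp σ p (volume.restrict Ω) :=
  h.isCb_initial.memLp h.isOpen.measurableSet h.volume_ne_top p

theorem memLp_sol (p : ℝ≥0∞) : MemLp u p (volume.restrict (cyl Ω T)) := by
  have := isFiniteMeasure_cyl (T := T) h.isBounded
  exact MemLp.of_bound h.measurable.aestronglyMeasurable L (ae_of_all _ h.bound)

theorem integrable_flux {ψ : Space N → ℝ} {D : Space N → Space N}
    (hψ : MemLp ψ 2 (volume.restrict Ω)) (hD : MemLp D 2 (volume.restrict Ω)) :
    Integrable (fun z : Space N × ℝ => ⟪ψ z.1, μ z⟫_ℝ - ⟪D z.1, G z⟫_ℝ)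
      (volume.restrict (cyl Ω T)) :=
  (integrable_inner_of_memLp (memLp_fst hψ T) (h.memLp_source 2)).sub
    (integrable_inner_of_memLp (memLp_fst hD T) h.memLp_weak)

theorem continuousOn_pairing {ζ : Space N → ℝ} (hζ : MemLp ζ 2 (volume.restrict Ω)) :
    ContinuousOn (fun t => ∫ x in Ω, ⟪ζ x, v t x⟫_ℝ) (Icc 0 T) := by
  have : ∀ t, ∫ x in Ω, ⟪ζ x, v t x⟫_ℝ = ⟪hζ.toLp ζ, v t⟫_ℝ := fun t => by
    rw [L2.inner_def]
    refine integral_congr_ae ?_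
    filter_upwards [hζ.coeFn_toLp] with x hx
    rw [hx]
  simp_rw [this]
  exact continuousOn_const.inner h.continuousOn

/-- Separated tests ζ(x)η(t) turn the weak formulation into a distributional ordinary differential
equation for the pairing of ζ with the solution. Since the curve v is continuous in L², the
integrated equation holds at every time, with the initial value supplied by σ. -/
theorem pairing_of_isSmoothTest {ζ : Space N → ℝ} (hζ : IsSmoothTest Ω ζ) :
    ∀ t ∈ Icc 0 T, ∫ x in Ω, ⟪ζ x, v t x⟫_ℝ = (∫ x in Ω, ⟪ζ x, σ x⟫_ℝ)
      + ∫ s in (0 : ℝ)..t, ∫ x in Ω, (⟪ζ x, μ (x, s)⟫_ℝ - ⟪gradient ζ x, G (x, s)⟫_ℝ) := by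
  have hflux := h.integrable_flux (hζ.memLp 2) (hζ.memLp_gradient 2)
  refine eq_add_integral_of_weak_deriv h.time_pos (h.continuousOn_pairing (hζ.memLp 2)) ?_ ?_
  · rw [intervalIntegrable_iff_integrableOn_Ioo_of_le h.time_pos.le]
    exact integrable_integral_slice hflux
  · intro η hη
    have hη' : Continuous (deriv η) := hη.smooth.continuous_deriv (by simp)
    obtain ⟨c, hc⟩ := hη.exists_bound
    obtain ⟨c', hc'⟩ := hη.compact.deriv.exists_bound_of_continuous hη'
    have he := h.eqn _ (isTest_tensor hζ hη)
    have i1 : Integrable (fun z : Space N × ℝ => deriv η z.2 * ⟪ζ z.1, u z⟫_ℝ)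
        (volume.restrict (cyl Ω T)) :=
      (integrable_inner_of_memLp (memLp_fst (hζ.memLp 2) T) (h.memLp_sol 2)).bdd_mul (c := c')
        (hη'.comp continuous_snd).aestronglyMeasurable (ae_of_all _ fun z => hc' _)
    have i2 : Integrable (fun z : Space N × ℝ => η z.2 * ⟪gradient ζ z.1, G z⟫_ℝ)
        (volume.restrict (cyl Ω T)) :=
      (integrable_inner_of_memLp (memLp_fst (hζ.memLp_gradient 2) T) h.memLp_weak).bdd_mul (c := c)
        (hη.continuous.comp continuous_snd).aestronglyMeasurable (ae_of_all _ fun z => hc _)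
    have i3 : Integrable (fun z : Space N × ℝ => η z.2 * ⟪ζ z.1, μ z⟫_ℝ)
        (volume.restrict (cyl Ω T)) :=
      (integrable_inner_of_memLp (memLp_fst (hζ.memLp 2) T) (h.memLp_source 2)).bdd_mul (c := c)
        (hη.continuous.comp continuous_snd).aestronglyMeasurable (ae_of_all _ fun z => hc _)
    have e1 : ∫ z in cyl Ω T, u z * dt (fun z : Space N × ℝ => ζ z.1 * η z.2) z
        = ∫ t in (0 : ℝ)..T, (∫ x in Ω, ⟪ζ x, v t x⟫_ℝ) * deriv η t := by
      rw [intervalIntegral.integral_of_le h.time_pos.le, integral_Ioc_eq_integral_Ioo]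
      trans ∫ z in cyl Ω T, deriv η z.2 * ⟪ζ z.1, u z⟫_ℝ
      · congr 1; ext z
        rw [dt_tensor ζ hη.differentiable]
        simp; ring
      · rw [integral_cyl i1]
        refine integral_congr_ae ?_
        filter_upwards [h.ae_eq] with t ht
        simp only [integral_const_mul]
        rw [mul_comm]
        congr 1
        refine integral_congr_ae ?_
        filter_upwards [ht] with x hx
        rw [hx]
    have e2 : (∫ z in cyl Ω T, (fun z : Space N × ℝ => ζ z.1 * η z.2) z * μ z)
        - ∫ z in cyl Ω T, ⟪G z, gradx (fun z : Space N × ℝ => ζ z.1 * η z.2) z⟫_ℝ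
        = ∫ t in (0 : ℝ)..T,
          (∫ x in Ω, (⟪ζ x, μ (x, t)⟫_ℝ - ⟪gradient ζ x, G (x, t)⟫_ℝ)) * η t := by
      rw [intervalIntegral.integral_of_le h.time_pos.le, integral_Ioc_eq_integral_Ioo]
      trans ∫ z in cyl Ω T, (η z.2 * ⟪ζ z.1, μ z⟫_ℝ - η z.2 * ⟪gradient ζ z.1, G z⟫_ℝ)
      · rw [integral_sub i3 i2]
        congr 2
        · ext z; simp; ring
        · ext z
          rw [gradx_tensor hζ.differentiable, inner_smul_right, real_inner_comm]
      · have hs : Integrable (fun z : Space N × ℝ =>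
            η z.2 * ⟪ζ z.1, μ z⟫_ℝ - η z.2 * ⟪gradient ζ z.1, G z⟫_ℝ)
            (volume.restrict (cyl Ω T)) := i3.sub i2
        rw [integral_cyl hs]
        refine integral_congr_ae (ae_of_all _ fun t => ?_)
        simp only [← mul_sub]
        rw [integral_const_mul, mul_comm]
    have e3 : ∫ x in Ω, (fun z : Space N × ℝ => ζ z.1 * η z.2) (x, 0) * σ x
        = η 0 * ∫ x in Ω, ⟪ζ x, σ x⟫_ℝ := by
      rw [← integral_const_mul]
      congr 1; ext x; simp; ring
    rw [e3, e1] at he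
    rw [← e2]
    linarith

/-- The equation tested against a function in `H¹₀(Ω)`. -/
theorem pairing {ψ : Space N → ℝ} {D : Space N → Space N} (hψ : IsH10WithGradient Ω ψ D) :
    ∀ t ∈ Icc 0 T, ∫ x in Ω, ⟪ψ x, v t x⟫_ℝ = (∫ x in Ω, ⟪ψ x, σ x⟫_ℝ)
      + ∫ s in (0 : ℝ)..t, ∫ x in Ω, (⟪ψ x, μ (x, s)⟫_ℝ - ⟪D x, G (x, s)⟫_ℝ) := by
  intro t ht
  obtain ⟨φ, hφ, l1, l2, -⟩ := hψ.exists_seq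
  have hsub : cyl Ω t ⊆ cyl Ω T := prod_mono_right (Ioo_subset_Ioo_right ht.2)
  -- As integrals over the cylinder up to time t, both flux terms are L² pairings, hence continuous
  -- along the approximating sequence.
  have hcyl : ∀ (ψ : Space N → ℝ) (D : Space N → Space N), MemLp ψ 2 (volume.restrict Ω) →
      MemLp D 2 (volume.restrict Ω) →
      ∫ s in (0 : ℝ)..t, ∫ x in Ω, (⟪ψ x, μ (x, s)⟫_ℝ - ⟪D x, G (x, s)⟫_ℝ)
        = (∫ z in cyl Ω t, ⟪ψ z.1, μ z⟫_ℝ) - ∫ z in cyl Ω t, ⟪D z.1, G z⟫_ℝ := by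
    intro ψ D h1 h2
    rw [intervalIntegral.integral_of_le ht.1, integral_Ioc_eq_integral_Ioo]
    rw [← integral_sub]
    · rw [integral_cyl]
      exact (h.integrable_flux h1 h2).mono_measure (Measure.restrict_mono_set _ hsub)
    · exact integrable_inner_of_memLp (memLp_fst h1 t)
        ((h.memLp_source 2).mono_measure (Measure.restrict_mono_set _ hsub))
    · exact integrable_inner_of_memLp (memLp_fst h2 t)
        (h.memLp_weak.mono_measure (Measure.restrict_mono_set _ hsub))
  have t1 := tendsto_integral_inner (fun n => (hφ n).memLp 2) hψ.1 (Lp.memLp (v t)) l1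
  have t2 := tendsto_integral_inner (fun n => (hφ n).memLp 2) hψ.1 (h.memLp_initial 2) l1
  have t3 := tendsto_integral_inner (fun n => memLp_fst ((hφ n).memLp 2) t) (memLp_fst hψ.1 t)
    ((h.memLp_source 2).mono_measure (Measure.restrict_mono_set _ hsub))
    (tendsto_eLpNorm_fst (fun n => (((hφ n).memLp 2).sub hψ.1).1) l1 t)
  have t4 := tendsto_integral_inner (fun n => memLp_fst ((hφ n).memLp_gradient 2) t)
    (memLp_fst hψ.2.1 t)
    (h.memLp_weak.mono_measure (Measure.restrict_mono_set _ hsub))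
    (tendsto_eLpNorm_fst (fun n => (((hφ n).memLp_gradient 2).sub hψ.2.1).1) l2 t)
  rw [hcyl _ _ hψ.1 hψ.2.1]
  refine tendsto_nhds_unique t1 ((t2.add (t3.sub t4)).congr fun n => ?_)
  rw [h.pairing_of_isSmoothTest (hφ n) t ht,
    hcyl _ _ ((hφ n).memLp 2) ((hφ n).memLp_gradient 2)]

theorem initial_ae_eq : v 0 =ᵐ[volume.restrict Ω] σ := by
  have := h.isOpen.ae_eq_zero_of_integral_contDiff_smul_eq_zero (μ := volume) (U := Ω)
    (f := fun x => v 0 x - σ x) ?_ ?_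
  · rw [EventuallyEq, ae_restrict_iff' h.isOpen.measurableSet]
    filter_upwards [this] with x hx hxm using sub_eq_zero.1 (hx hxm)
  · have : IsFiniteMeasure (volume.restrict Ω) := ⟨by simpa using h.isBounded.measure_lt_top⟩
    exact IntegrableOn.locallyIntegrableOn
      (((Lp.memLp (v 0)).sub (h.memLp_initial 2)).integrable (by norm_num))
  · intro ζ h1 h2 h3
    have hζ : IsSmoothTest Ω ζ := ⟨h1, h2, h3⟩
    have hp := h.pairing_of_isSmoothTest hζ 0 ⟨le_rfl, h.time_pos.le⟩
    rw [intervalIntegral.integral_same, add_zero] at hp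
    have e : ∫ x in Ω, ζ x • (v 0 x - σ x) = 0 := by
      have hd := integral_sub (integrable_inner_of_memLp (hζ.memLp 2)
        (Lp.memLp (v 0))) (integrable_inner_of_memLp (hζ.memLp 2) (h.memLp_initial 2))
      rw [hp, sub_self] at hd
      refine (integral_congr_ae (ae_of_all _ fun x => ?_)).trans hd
      simp; ring
    refine Eq.trans (setIntegral_eq_integral_of_forall_compl_eq_zero fun x hx => ?_).symm e
    rw [image_eq_zero_of_notMem_tsupport (fun hm => hx (h3 hm)), zero_smul]

end IsRegularSolution

end

/-! ### Time averages and the convexity inequality between two times -/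

section

variable {N : ℕ} {Ω : Set (Space N)} {T : ℝ}

section Averages

variable {F : Type*} [NormedAddCommGroup F] [InnerProductSpace ℝ F] {P Q : Space N × ℝ → F}

/-- Fubini in (x, t, r). The left side arises from integrating in t the equation over the preceding
h units of time; the right side is an average of translated L² pairings, which can be differentiated
in h. -/
theorem integral_average (hPm : StronglyMeasurable P) (hQm : StronglyMeasurable Q)
    (hP : MemLp P 2 volume) (hQ : MemLp Q 2 volume) {h : ℝ} (hh : 0 ≤ h) :
    Integrable (fun t => ∫ r in (0 : ℝ)..h, ∫ x, ⟪P (x, t - r), Q (x, t)⟫_ℝ) ∧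
    ∫ t, ∫ r in (0 : ℝ)..h, ∫ x, ⟪P (x, t - r), Q (x, t)⟫_ℝ
      = ∫ r in (0 : ℝ)..h, ∫ z : Space N × ℝ, ⟪P (z.1, z.2 - r), Q z⟫_ℝ := by
  have hi := integrable_inner_time_translate hPm hQm hP hQ h
  simp_rw [intervalIntegral.integral_of_le hh]
  set ν : Measure ℝ := volume.restrict (Ioc 0 h)
  have hmp := measurePreserving_prodAssoc (volume : Measure (Space N)) (volume : Measure ℝ) ν
  have hi' : Integrable (fun y : Space N × ℝ × ℝ => ⟪P (y.1, y.2.1 - y.2.2), Q (y.1, y.2.1)⟫_ℝ)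
      ((volume : Measure (Space N)).prod ((volume : Measure ℝ).prod ν)) := by
    rw [← hmp.integrable_comp_emb MeasurableEquiv.prodAssoc.measurableEmbedding]
    exact hi
  refine ⟨hi'.integral_prod_right.integral_prod_left, ?_⟩
  have e1 := integral_prod _ hi'.integral_prod_right
  have e2 := integral_prod_symm _ hi'
  have e3 := integral_prod_symm _ hi
  have e4 := hmp.integral_comp MeasurableEquiv.prodAssoc.measurableEmbedding
    (fun y : Space N × ℝ × ℝ => ⟪P (y.1, y.2.1 - y.2.2), Q (y.1, y.2.1)⟫_ℝ)
  rw [← e3]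
  refine e1.symm.trans (e2.symm.trans (e4.symm.trans ?_))
  rfl

/-- By continuity of translations in L² the integrand is continuous at r = 0, so the fundamental
theorem of calculus applies. No regularity of `P` or `Q` in time is required. -/
theorem hasDerivAt_average (hPm : StronglyMeasurable P) (hQm : StronglyMeasurable Q)
    (hP : MemLp P 2 volume) (hQ : MemLp Q 2 volume) :
    HasDerivAt (fun h => ∫ r in (0 : ℝ)..h, ∫ z : Space N × ℝ, ⟪P (z.1, z.2 - r), Q z⟫_ℝ)
      (∫ z, ⟪P z, Q z⟫_ℝ) 0 := by
  have hm : StronglyMeasurable fun y : (Space N × ℝ) × ℝ => ⟪P (y.1.1, y.1.2 - y.2), Q y.1⟫_ℝ :=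
    (hPm.comp_measurable (by fun_prop)).inner (hQm.comp_measurable measurable_fst)
  have hΦ : StronglyMeasurable fun r : ℝ => ∫ z : Space N × ℝ, ⟪P (z.1, z.2 - r), Q z⟫_ℝ :=
    hm.integral_prod_left' (μ := (volume : Measure (Space N × ℝ)))
  have hc : ContinuousAt (fun r : ℝ => ∫ z : Space N × ℝ, ⟪P (z.1, z.2 - r), Q z⟫_ℝ) 0 := by
    have := tendsto_integral_inner_time_translate hP hQ
    simpa [ContinuousAt] using this
  have := intervalIntegral.integral_hasDerivAt_right (a := 0) (b := 0) (by simp)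
    hΦ.aestronglyMeasurable.stronglyMeasurableAtFilter hc
  simpa using this

/-- The time averages of the pairing with a fixed time slice, in terms of the original field. -/
theorem average_slice {P₀ : Space N × ℝ → F}
    (hP₀ : P₀ =ᵐ[volume.restrict (cyl Ω T)] P) (hP : ∀ z ∉ cyl Ω T, P z = 0)
    {k K : Space N → F} (hk : k =ᵐ[volume.restrict Ω] K) {t h : ℝ} (ht : t ∈ Ioo 0 T)
    (hh : 0 < h) :
    ∫ r in (0 : ℝ)..h, ∫ x, ⟪P (x, t - r), K x⟫_ℝ
      = ∫ s in max 0 (t - h)..t, ∫ x in Ω, ⟪k x, P₀ (x, s)⟫_ℝ := by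
  have hle : max 0 (t - h) ≤ t := max_le ht.1.le (by linarith)
  rw [intervalIntegral.integral_comp_sub_left (fun s => ∫ x, ⟪P (x, s), K x⟫_ℝ) t, sub_zero,
    intervalIntegral.integral_of_le (by linarith), intervalIntegral.integral_of_le hle]
  -- `P` is extended by zero, so times s ≤ 0 contribute nothing and the average may be truncated at
  -- time 0.
  have e1 : ∫ s in Ioc (t - h) t, ∫ x, ⟪P (x, s), K x⟫_ℝ
      = ∫ s in Ioc (max 0 (t - h)) t, ∫ x, ⟪P (x, s), K x⟫_ℝ := by
    refine setIntegral_eq_of_subset_of_forall_sdiff_eq_zero measurableSet_Ioc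
      (Ioc_subset_Ioc_left (le_max_right _ _)) fun s hs => ?_
    have hs0 : s ≤ 0 := by
      by_contra hs0
      exact hs.2 ⟨max_lt (not_le.1 hs0) hs.1.1, hs.1.2⟩
    have : ∀ x, P (x, s) = 0 := fun x => hP _ fun hm => (lt_irrefl _ (hm.2.1.trans_le hs0))
    simp [this]
  rw [e1]
  have hsl := ae_slice hP₀
  rw [ae_restrict_iff' measurableSet_Ioo] at hsl
  refine setIntegral_congr_ae measurableSet_Ioc ?_
  filter_upwards [hsl] with s hs hsm
  have hs' := hs ⟨(le_max_left _ _).trans_lt hsm.1, hsm.2.trans_lt ht.2⟩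
  rw [← setIntegral_eq_integral_of_forall_compl_eq_zero (s := Ω)]
  · refine integral_congr_ae ?_
    filter_upwards [hs', hk] with x hx hkx
    rw [← hx, ← hkx, real_inner_comm]
  · intro x hx
    rw [hP _ fun hm => hx hm.1, inner_zero_left]

end Averages

namespace IsRegularSolution

variable {m L : ℝ} {μ : Space N × ℝ → ℝ} {σ : Space N → ℝ} {u : Space N × ℝ → ℝ}
  {A G : Space N × ℝ → Space N} {v : ℝ → Lp ℝ 2 ((volume : Measure (Space N)).restrict Ω)}
  {ρ : ℝ → ℝ} {ε b : ℝ}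
  (h : IsRegularSolution m L Ω T μ σ u A G v)
include h

theorem isFiniteMeasure : IsFiniteMeasure ((volume : Measure (Space N)).restrict Ω) :=
  ⟨by simpa using h.isBounded.measure_lt_top⟩

theorem memLp_energyFn (hρ : IsProfile ρ ε b) {g : Space N → ℝ} {p : ℝ≥0∞}
    (hg : MemLp g p (volume.restrict Ω)) :
    MemLp (fun x => energyFn m ρ (g x)) p (volume.restrict Ω) := by
  refine hg.of_le_mul (c := prim ρ b)
    ((continuous_energyFn h.exp_pos hρ).comp_aestronglyMeasurable hg.1) (ae_of_all _ fun x => ?_)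
  rw [Real.norm_of_nonneg (energyFn_nonneg h.exp_pos hρ _)]
  exact energyFn_le h.exp_pos hρ _

/-- The energy density is Lipschitz and Ω has finite measure, so continuity of the curve in L² is
inherited by the energy. -/
theorem continuousOn_energy (hρ : IsProfile ρ ε b) :
    ContinuousOn (fun t => ∫ x in Ω, energyFn m ρ (v t x)) (Icc 0 T) := by
  have := h.isFiniteMeasure
  intro t ht
  have hmem : ∀ s, MemLp (fun x => energyFn m ρ (v s x)) 2 (volume.restrict Ω) := fun s =>
    h.memLp_energyFn hρ (Lp.memLp (v s))
  have key := tendsto_integral_inner (l := 𝓝[Icc 0 T] t) hmem (hmem t)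
    (memLp_const (1 : ℝ)) ?_
  · simpa [ContinuousWithinAt] using key
  · have h1 : Tendsto (fun s => edist (v s) (v t)) (𝓝[Icc 0 T] t) (𝓝 0) :=
      tendsto_iff_edist_tendsto_0.1 (h.continuousOn t ht)
    have h2 := ENNReal.Tendsto.const_mul (a := ENNReal.ofReal (prim ρ b)) h1
      (Or.inr ENNReal.ofReal_ne_top)
    rw [mul_zero] at h2
    refine tendsto_of_tendsto_of_tendsto_of_le_of_le tendsto_const_nhds h2
      (fun _ => zero_le) fun s => ?_
    simp only [Lp.edist_def]
    refine eLpNorm_le_mul_eLpNorm_of_ae_le_mul (ae_of_all _ fun x => ?_) _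
    exact abs_energyFn_sub_le h.exp_pos hρ _ _

/-- The integrated form of the convexity inequality, tested with the solution. -/
theorem energy_sub_le (hρ : IsProfile ρ ε b) : ∀ᵐ t ∂volume.restrict (Ioo 0 T), ∀ s ∈ Icc 0 t,
    (∫ x in Ω, energyFn m ρ (v t x)) - (∫ x in Ω, energyFn m ρ (v s x))
      ≤ (∫ r in s..t, ∫ x in Ω, ⟪testFn m ρ (u (x, t)), μ (x, r)⟫_ℝ)
        - ∫ r in s..t, ∫ x in Ω, ⟪ρ (|u (x, t)| ^ m) • G (x, t), G (x, r)⟫_ℝ := by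
  have := h.isFiniteMeasure
  filter_upwards [h.slices_test hρ, h.ae_eq, ae_restrict_mem measurableSet_Ioo]
    with t ht hut htm s hs
  change IsH10WithGradient Ω (fun x => testFn m ρ (u (x, t))) _ at ht
  have hst : s ∈ Icc 0 T := ⟨hs.1, hs.2.trans htm.2.le⟩
  -- The test function is frozen at the single time t, and the integrated equation is compared at t
  -- and s. The result therefore holds for almost every t and for every s ≤ t.
  have p1 := h.pairing ht t ⟨htm.1.le, htm.2.le⟩
  have p2 := h.pairing ht s hst
  have hm1 := integrable_integral_slice (integrable_inner_of_memLp (memLp_fst ht.1 T)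
    (h.memLp_source 2))
  have hm2 := integrable_integral_slice (integrable_inner_of_memLp (memLp_fst ht.2.1 T)
    h.memLp_weak)
  have hm3 := integrable_integral_slice (h.integrable_flux ht.1 ht.2.1)
  have hII : ∀ {f : ℝ → ℝ} {a c : ℝ}, Integrable f (volume.restrict (Ioo 0 T)) → a ∈ Icc 0 T →
      c ∈ Icc 0 T → IntervalIntegrable f volume a c := by
    intro f a c hf ha hc
    have h0 : IntervalIntegrable f volume 0 T := by
      rw [intervalIntegrable_iff_integrableOn_Ioo_of_le h.time_pos.le]
      exact hf
    refine h0.mono_set ?_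
    rw [uIcc_of_le h.time_pos.le]
    exact uIcc_subset_Icc ha hc
  have h0m : (0 : ℝ) ∈ Icc 0 T := ⟨le_rfl, h.time_pos.le⟩
  have htm' : t ∈ Icc 0 T := ⟨htm.1.le, htm.2.le⟩
  have hflux : ∀ᵐ r ∂volume.restrict (Ioo 0 T),
      ∫ x in Ω, (⟪testFn m ρ (u (x, t)), μ (x, r)⟫_ℝ - ⟪ρ (|u (x, t)| ^ m) • G (x, t), G (x, r)⟫_ℝ)
      = (∫ x in Ω, ⟪testFn m ρ (u (x, t)), μ (x, r)⟫_ℝ)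
        - ∫ x in Ω, ⟪ρ (|u (x, t)| ^ m) • G (x, t), G (x, r)⟫_ℝ := by
    filter_upwards [memLp_slice (h.memLp_source 2), memLp_slice h.memLp_weak] with r h1 h2
    exact integral_sub (integrable_inner_of_memLp ht.1 h1) (integrable_inner_of_memLp ht.2.1 h2)
  have hdiff : (∫ x in Ω, ⟪testFn m ρ (u (x, t)), v t x⟫_ℝ)
      - (∫ x in Ω, ⟪testFn m ρ (u (x, t)), v s x⟫_ℝ)
      = (∫ r in s..t, ∫ x in Ω, ⟪testFn m ρ (u (x, t)), μ (x, r)⟫_ℝ)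
        - ∫ r in s..t, ∫ x in Ω, ⟪ρ (|u (x, t)| ^ m) • G (x, t), G (x, r)⟫_ℝ := by
    rw [p1, p2, ← intervalIntegral.integral_sub (hII hm1 hst htm') (hII hm2 hst htm')]
    rw [add_sub_add_left_eq_sub, intervalIntegral.integral_interval_sub_left (hII hm3 h0m htm')
      (hII hm3 h0m hst)]
    rw [intervalIntegral.integral_of_le hs.2, intervalIntegral.integral_of_le hs.2,
      integral_Ioc_eq_integral_Ioo, integral_Ioc_eq_integral_Ioo]
    refine integral_congr_ae ?_
    exact ae_restrict_of_ae_restrict_of_subset (Ioo_subset_Ioo hs.1 htm.2.le) hflux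
  rw [← hdiff, ← integral_sub, ← integral_sub]
  · refine integral_mono_ae ?_ ?_ ?_
    · exact ((h.memLp_energyFn hρ (Lp.memLp (v t))).sub
        (h.memLp_energyFn hρ (Lp.memLp (v s)))).integrable (by norm_num)
    · exact (integrable_inner_of_memLp ht.1 (Lp.memLp (v t))).sub
        (integrable_inner_of_memLp ht.1 (Lp.memLp (v s)))
    · filter_upwards [hut] with x hx
      -- Convexity is used with the supporting slope at v(t) = u(t), which is exactly the frozen
      -- test function.
      have := energyFn_sub_le h.exp_pos hρ (v t x) (v s x)
      rw [hx]
      simp only [RCLike.inner_apply, conj_trivial]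
      linarith
  · exact integrable_inner_of_memLp ht.1 (Lp.memLp (v t))
  · exact integrable_inner_of_memLp ht.1 (Lp.memLp (v s))
  · exact (h.memLp_energyFn hρ (Lp.memLp (v t))).integrable (by norm_num)
  · exact (h.memLp_energyFn hρ (Lp.memLp (v s))).integrable (by norm_num)

end IsRegularSolution

end

/-! ### The energy inequality -/

section

variable {N : ℕ} {Ω : Set (Space N)} {T : ℝ}

theorem deriv_nonneg_of_right {D : ℝ → ℝ} {d : ℝ} (hD : HasDerivAt D d 0) (h0 : D 0 = 0)
    (h : ∀ t, 0 < t → 0 ≤ D t) : 0 ≤ d := by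
  refine ge_of_tendsto hD.tendsto_slope_zero_right ?_
  filter_upwards [self_mem_nhdsWithin] with t ht
  rw [zero_add, h0, sub_zero, smul_eq_mul]
  exact mul_nonneg (inv_nonneg.2 (le_of_lt ht)) (h t ht)

theorem measurable_testFn {m : ℝ} {ρ : ℝ → ℝ} {ε b : ℝ} (hm : 0 < m) (hρ : IsProfile ρ ε b) :
    Measurable (testFn m ρ) := (monotone_testFn hm hρ).measurable

namespace IsRegularSolution

variable {m L : ℝ} {μ : Space N × ℝ → ℝ} {σ : Space N → ℝ} {u : Space N × ℝ → ℝ}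
  {A G : Space N × ℝ → Space N} {v : ℝ → Lp ℝ 2 ((volume : Measure (Space N)).restrict Ω)}
  {ρ : ℝ → ℝ} {ε b : ℝ}
  (h : IsRegularSolution m L Ω T μ σ u A G v)
include h

/-- The energy inequality. -/
theorem energy (hρ : IsProfile ρ ε b) {τ : ℝ} (hτ : τ ∈ Ioc 0 T) :
    (∫ x in Ω, energyFn m ρ (v τ x)) + ∫ z in cyl Ω τ, ρ (|u z| ^ m) * ‖G z‖ ^ 2
      ≤ (∫ x in Ω, energyFn m ρ (σ x)) + ∫ z in cyl Ω τ, testFn m ρ (u z) * μ z := by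
  have hsub : cyl Ω τ ⊆ cyl Ω T := prod_mono_right (Ioo_subset_Ioo_right hτ.2)
  have hmT : MeasurableSet (cyl Ω T) := (isOpen_cyl h.isOpen).measurableSet
  have hmτ : MeasurableSet (cyl Ω τ) := (isOpen_cyl h.isOpen).measurableSet
  have hGm := h.memLp_weak.1
  have hμm := (h.memLp_source 2).1
  set G₁ : Space N × ℝ → Space N := hGm.mk G with hG₁
  set μ₁ : Space N × ℝ → ℝ := hμm.mk μ with hμ₁
  obtain ⟨c, -, hc⟩ := hρ.exists_bound
  -- The fields that will be shifted in time are extended by zero outside the full cylinder. The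
  -- test function and its gradient are cut off at time τ, which restricts the range of t in the
  -- pairings.
  let P : Space N × ℝ → Space N := (cyl Ω T).indicator G₁
  let p : Space N × ℝ → ℝ := (cyl Ω T).indicator μ₁
  let Q : Space N × ℝ → Space N := (cyl Ω τ).indicator fun z => ρ (|u z| ^ m) • G₁ z
  let q : Space N × ℝ → ℝ := (cyl Ω τ).indicator fun z => testFn m ρ (u z)
  have hGτ : G =ᵐ[volume.restrict (cyl Ω τ)] G₁ :=
    ae_restrict_of_ae_restrict_of_subset hsub hGm.ae_eq_mk
  have hμτ : μ =ᵐ[volume.restrict (cyl Ω τ)] μ₁ :=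
    ae_restrict_of_ae_restrict_of_subset hsub hμm.ae_eq_mk
  have hρu : Measurable fun z => ρ (|u z| ^ m) := hρ.smooth.continuous.measurable.comp h.measurable_pow
  have hPm : StronglyMeasurable P := hGm.stronglyMeasurable_mk.indicator hmT
  have hpm : StronglyMeasurable p := hμm.stronglyMeasurable_mk.indicator hmT
  have hQm : StronglyMeasurable Q :=
    (hρu.stronglyMeasurable.smul hGm.stronglyMeasurable_mk).indicator hmτ
  have hqm : StronglyMeasurable q :=
    ((measurable_testFn h.exp_pos hρ).comp h.measurable).stronglyMeasurable.indicator hmτ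
  have hG₁2 : MemLp G₁ 2 (volume.restrict (cyl Ω T)) := h.memLp_weak.ae_eq hGm.ae_eq_mk
  have hP : MemLp P 2 volume := (memLp_indicator_iff_restrict hmT).2 hG₁2
  have hp : MemLp p 2 volume :=
    (memLp_indicator_iff_restrict hmT).2 ((h.memLp_source 2).ae_eq hμm.ae_eq_mk)
  have hQ : MemLp Q 2 volume := by
    refine (memLp_indicator_iff_restrict hmτ).2 ?_
    refine (hG₁2.mono_measure (Measure.restrict_mono_set _ hsub)).of_le_mul (c := c)
      (hρu.stronglyMeasurable.smul hGm.stronglyMeasurable_mk).aestronglyMeasurable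
      (ae_of_all _ fun z => ?_)
    rw [norm_smul]
    exact mul_le_mul_of_nonneg_right (hc _) (norm_nonneg _)
  have hq : MemLp q 2 volume := by
    refine (memLp_indicator_iff_restrict hmτ).2 ?_
    have := isFiniteMeasure_cyl (T := τ) h.isBounded
    exact MemLp.of_bound ((measurable_testFn h.exp_pos hρ).comp h.measurable).aestronglyMeasurable
      (prim ρ b) (ae_of_all _ fun z => abs_testFn_le h.exp_pos hρ _)
  -- The energy is continued to all times by constants, so that for t < d the value at t − d is the
  -- initial energy. This matches the lower limit max 0 (t − d) in the averaged pairings.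
  set j : ℝ → ℝ := fun t => ∫ x in Ω, energyFn m ρ (v (max 0 (min t T)) x) with hj
  have hjc : Continuous j := (h.continuousOn_energy hρ).comp_continuous
    (f := fun t => max 0 (min t T)) (by fun_prop)
    fun t => ⟨le_max_left _ _, max_le h.time_pos.le (min_le_right _ _)⟩
  set K : ℝ → ℝ := fun a => ∫ t in (0 : ℝ)..a, j t with hK
  have hKd : ∀ a, HasDerivAt K (j a) a := fun a => hjc.integral_hasStrictDerivAt 0 a |>.hasDerivAt
  -- This is the two-time inequality with s = max 0 (t − d), integrated over t in (0,τ). The left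
  -- side is the integral of j(t) − j(t − d), written with the primitive `K`.
  have key : ∀ d : ℝ, 0 < d → K τ - (K (τ - d) - K (-d))
      ≤ (∫ r in (0 : ℝ)..d, ∫ z : Space N × ℝ, ⟪p (z.1, z.2 - r), q z⟫_ℝ)
        - ∫ r in (0 : ℝ)..d, ∫ z : Space N × ℝ, ⟪P (z.1, z.2 - r), Q z⟫_ℝ := by
    intro d hd
    obtain ⟨i1, e1⟩ := integral_average hpm hqm hp hq hd.le
    obtain ⟨i2, e2⟩ := integral_average hPm hQm hP hQ hd.le
    rw [← e1, ← e2, ← integral_sub i1 i2]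
    have hjd : Continuous fun t => j (t - d) := hjc.comp (continuous_sub_right d)
    have hK' : K τ - (K (τ - d) - K (-d)) = ∫ t in Ioo 0 τ, (j t - j (t - d)) := by
      rw [← integral_Ioc_eq_integral_Ioo, ← intervalIntegral.integral_of_le hτ.1.le,
        intervalIntegral.integral_sub (hjc.intervalIntegrable _ _)
          (hjd.intervalIntegrable _ _)]
      congr 1
      rw [hK]
      simp only
      rw [intervalIntegral.integral_interval_sub_left (hjc.intervalIntegrable _ _)
        (hjc.intervalIntegrable _ _)]
      simp
    rw [hK']
    refine le_trans ?_ (setIntegral_eq_integral_of_forall_compl_eq_zero (s := Ioo 0 τ)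
      fun t ht => ?_).le
    · refine integral_mono_ae ?_ (i1.sub i2).restrict ?_
      · exact ((hjc.sub hjd).integrableOn_Icc
          (a := 0) (b := τ)).mono_set Ioo_subset_Icc_self
      · filter_upwards [ae_restrict_of_ae_restrict_of_subset (Ioo_subset_Ioo_right hτ.2)
          (h.energy_sub_le hρ), ae_slice hGτ, ae_restrict_mem measurableSet_Ioo] with t ht hGt htm
        have htT : t ∈ Ioo 0 T := ⟨htm.1, htm.2.trans_le hτ.2⟩
        have hs : max 0 (t - d) ∈ Icc 0 t := ⟨le_max_left _ _, max_le htm.1.le (by linarith)⟩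
        have := ht _ hs
        have ej1 : j t = ∫ x in Ω, energyFn m ρ (v t x) := by
          simp only [hj]
          rw [min_eq_left htT.2.le, max_eq_right htT.1.le]
        have ej2 : j (t - d) = ∫ x in Ω, energyFn m ρ (v (max 0 (t - d)) x) := by
          simp only [hj]
          rw [min_eq_left (by linarith [htT.2])]
        rw [ej1, ej2]
        have a1 := average_slice (P₀ := μ) (P := p) (k := fun x => testFn m ρ (u (x, t)))
          (K := fun x => q (x, t)) (T := T)
          (by filter_upwards [hμm.ae_eq_mk, ae_restrict_mem hmT] with z hz hzm
              rw [hz]; exact (indicator_of_mem hzm μ₁).symm)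
          (fun z hz => indicator_of_notMem hz μ₁)
          (by filter_upwards [ae_restrict_mem h.isOpen.measurableSet] with x hx
              exact (indicator_of_mem (show (x, t) ∈ cyl Ω τ from ⟨hx, htm⟩)
                fun z => testFn m ρ (u z)).symm)
          htT hd
        have a2 := average_slice (P₀ := G) (P := P) (k := fun x => ρ (|u (x, t)| ^ m) • G (x, t))
          (K := fun x => Q (x, t)) (T := T)
          (by filter_upwards [hGm.ae_eq_mk, ae_restrict_mem hmT] with z hz hzm
              rw [hz]; exact (indicator_of_mem hzm G₁).symm)
          (fun z hz => indicator_of_notMem hz G₁)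
          (by filter_upwards [hGt, ae_restrict_mem h.isOpen.measurableSet] with x hGx hx
              rw [hGx]
              exact (indicator_of_mem (show (x, t) ∈ cyl Ω τ from ⟨hx, htm⟩)
                fun z => ρ (|u z| ^ m) • G₁ z).symm)
          htT hd
        rw [a1, a2]
        exact this
    · have hq0 : ∀ x, q (x, t) = 0 := fun x => indicator_of_notMem (fun hm => ht hm.2) _
      have hQ0 : ∀ x, Q (x, t) = 0 := fun x => indicator_of_notMem (fun hm => ht hm.2) _
      simp [hq0, hQ0]
  -- Both sides of the inequality vanish at d = 0, so their derivatives there are ordered too. The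
  -- derivative of the left side is j(τ) − j(0), and those of the right side are the untranslated
  -- pairings.
  have hd := ((hasDerivAt_average hpm hqm hp hq).sub (hasDerivAt_average hPm hQm hP hQ)).sub
    (((hasDerivAt_const (0 : ℝ) (K τ)).sub
      (((hKd (τ - 0)).comp_const_sub τ 0).sub ((hKd (-0)).comp (0 : ℝ) (hasDerivAt_neg 0)))))
  have hfin := deriv_nonneg_of_right hd (by simp [hK]) fun d hd => by
    have := key d hd
    simp only [Pi.sub_apply, Function.comp]
    linarith
  have ej0 : j 0 = ∫ x in Ω, energyFn m ρ (σ x) := by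
    simp only [hj]
    rw [min_eq_left h.time_pos.le, max_self]
    refine integral_congr_ae ?_
    filter_upwards [h.initial_ae_eq] with x hx
    rw [hx]
  have ejτ : j τ = ∫ x in Ω, energyFn m ρ (v τ x) := by
    simp only [hj]
    rw [min_eq_left hτ.2, max_eq_right hτ.1.le]
  have eP : ∫ z, ⟪P z, Q z⟫_ℝ = ∫ z in cyl Ω τ, ρ (|u z| ^ m) * ‖G z‖ ^ 2 := by
    rw [← setIntegral_eq_integral_of_forall_compl_eq_zero (s := cyl Ω τ)]
    · refine integral_congr_ae ?_
      filter_upwards [hGτ, ae_restrict_mem hmτ] with z hz hzm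
      simp only [P, Q]
      rw [indicator_of_mem hzm, indicator_of_mem (hsub hzm), hz, inner_smul_right,
        real_inner_self_eq_norm_sq]
    · intro z hz
      simp only [Q]
      rw [indicator_of_notMem hz, inner_zero_right]
  have ep : ∫ z, ⟪p z, q z⟫_ℝ = ∫ z in cyl Ω τ, testFn m ρ (u z) * μ z := by
    rw [← setIntegral_eq_integral_of_forall_compl_eq_zero (s := cyl Ω τ)]
    · refine integral_congr_ae ?_
      filter_upwards [hμτ, ae_restrict_mem hmτ] with z hz hzm
      simp only [p, q]
      rw [indicator_of_mem hzm, indicator_of_mem (hsub hzm), hz]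
      simp
    · intro z hz
      simp only [q]
      rw [indicator_of_notMem hz, inner_zero_right]
  rw [eP, ep, sub_zero, neg_zero, ej0, ejτ] at hfin
  linarith

/-- The energy is controlled by the mass of the data. -/
theorem energy_le (hρ : IsProfile ρ ε b) {τ : ℝ} (hτ : τ ∈ Ioc 0 T) :
    (∫ x in Ω, energyFn m ρ (v τ x)) + ∫ z in cyl Ω τ, ρ (|u z| ^ m) * ‖G z‖ ^ 2
      ≤ prim ρ b * mass Ω T μ σ := by
  refine (h.energy hρ hτ).trans ?_
  have := h.isFiniteMeasure
  have hsub : cyl Ω τ ⊆ cyl Ω T := prod_mono_right (Ioo_subset_Ioo_right hτ.2)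
  have hmT : MeasurableSet (cyl Ω T) := (isOpen_cyl h.isOpen).measurableSet
  have hμ1 := memLp_one_iff_integrable.1 (h.memLp_source 1)
  have hσ1 := memLp_one_iff_integrable.1 (h.memLp_initial 1)
  rw [mass, mul_add]
  refine add_le_add ?_ ?_
  · rw [← integral_const_mul]
    refine integral_mono (memLp_one_iff_integrable.1 (h.memLp_energyFn hρ (h.memLp_initial 1)))
      (hσ1.abs.const_mul _) fun x => energyFn_le h.exp_pos hρ _
  · rw [← integral_const_mul]
    have i0 : IntegrableOn (fun z => prim ρ b * |μ z|) (cyl Ω T) := hμ1.abs.const_mul _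
    refine le_trans (integral_mono ?_ (i0.mono_set hsub) fun z => ?_)
      (setIntegral_mono_set i0 (ae_of_all _ fun z => ?_) hsub.eventuallyLE)
    · exact Integrable.bdd_mul (c := prim ρ b) (IntegrableOn.mono_set hμ1 hsub)
        ((measurable_testFn h.exp_pos hρ).comp h.measurable).aestronglyMeasurable
        (ae_of_all _ fun z => abs_testFn_le h.exp_pos hρ _)
    · refine (le_abs_self _).trans ?_
      rw [abs_mul]
      exact mul_le_mul_of_nonneg_right (abs_testFn_le h.exp_pos hρ _) (abs_nonneg _)
    · exact mul_nonneg (hρ.prim_nonneg _) (abs_nonneg _)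

end IsRegularSolution

end

/-! ### The `L¹` bound, the energy on sublevel sets, and the estimate on a time slice -/

section

variable {N : ℕ} {Ω : Set (Space N)} {T : ℝ}

theorem mass_nonneg (μ : Space N × ℝ → ℝ) (σ : Space N → ℝ) : 0 ≤ mass Ω T μ σ := by
  unfold mass; positivity

namespace IsRegularSolution

variable {m L : ℝ} {μ : Space N × ℝ → ℝ} {σ : Space N → ℝ} {u : Space N × ℝ → ℝ}
  {A G : Space N × ℝ → Space N} {v : ℝ → Lp ℝ 2 ((volume : Measure (Space N)).restrict Ω)}
  {ρ : ℝ → ℝ} {ε b : ℝ}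
  (h : IsRegularSolution m L Ω T μ σ u A G v)
include h

/-- With a step profile of mass one at scale δ the energy density is at least |x| − δ^{1/m}, while
the energy is at most the mass of the data. Since Ω has finite measure, δ can tend to 0. -/
theorem integral_abs_le {τ : ℝ} (hτ : τ ∈ Ioc 0 T) : ∫ x in Ω, |v τ x| ≤ mass Ω T μ σ := by
  have hfin := h.isFiniteMeasure
  have hv : Integrable (fun x => |v τ x|) (volume.restrict Ω) :=
    ((Lp.memLp (v τ)).integrable (by norm_num)).abs
  have key : ∀ δ : ℝ, 0 < δ →
      ∫ x in Ω, |v τ x| ≤ mass Ω T μ σ + δ ^ (1 / m) * (volume.restrict Ω).real univ := by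
    intro δ hδ
    obtain ⟨ρ, hρ, h1⟩ := exists_isProfile_step hδ
    have he := h.energy_le hρ hτ
    rw [h1, one_mul] at he
    have h2 : 0 ≤ ∫ z in cyl Ω τ, ρ (|u z| ^ m) * ‖G z‖ ^ 2 :=
      integral_nonneg fun z => mul_nonneg (hρ.nonneg _) (by positivity)
    have h3 : ∫ x in Ω, (|v τ x| - δ ^ (1 / m)) ≤ ∫ x in Ω, energyFn m ρ (v τ x) := by
      refine integral_mono (hv.sub (integrable_const _))
        ((h.memLp_energyFn hρ (Lp.memLp (v τ))).integrable (by norm_num)) fun x => ?_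
      have := le_energyFn h.exp_pos hρ (v τ x)
      rwa [h1, one_mul] at this
    rw [integral_sub hv (integrable_const _), integral_const, smul_eq_mul] at h3
    linarith [mul_comm (δ ^ (1 / m)) ((volume.restrict Ω).real univ)]
  have hlim : Tendsto (fun δ : ℝ => mass Ω T μ σ + δ ^ (1 / m) * (volume.restrict Ω).real univ)
      (𝓝[>] 0) (𝓝 (mass Ω T μ σ + 0 ^ (1 / m) * (volume.restrict Ω).real univ)) := by
    refine Tendsto.mono_left ?_ nhdsWithin_le_nhds
    have : ContinuousAt (fun δ : ℝ => δ ^ (1 / m)) 0 :=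
      Real.continuousAt_rpow_const _ _ (Or.inr (one_div_pos.2 h.exp_pos).le)
    exact (this.mul_const _).const_add _
  rw [Real.zero_rpow (one_div_pos.2 h.exp_pos).ne', zero_mul, add_zero] at hlim
  exact ge_of_tendsto hlim (by filter_upwards [self_mem_nhdsWithin] with δ hδ using key δ hδ)

theorem lintegral_slice_le : ∀ᵐ t ∂volume.restrict (Ioo 0 T),
    ∫⁻ x in Ω, ‖u (x, t)‖ₑ ≤ ENNReal.ofReal (mass Ω T μ σ) := by
  have hfin := h.isFiniteMeasure
  filter_upwards [h.ae_eq, ae_restrict_mem measurableSet_Ioo] with t ht htm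
  refine le_trans (le_of_eq ?_) (ENNReal.ofReal_le_ofReal (h.integral_abs_le ⟨htm.1, htm.2.le⟩))
  rw [ofReal_integral_eq_lintegral_ofReal ((Lp.memLp (v t)).integrable (by norm_num)).abs
    (ae_of_all _ fun x => abs_nonneg _)]
  refine lintegral_congr_ae ?_
  filter_upwards [ht] with x hx
  rw [hx, Real.enorm_eq_ofReal_abs]

/-- The energy at the final time is nonnegative and can be dropped. -/
theorem lintegral_profile_le (hρ : IsProfile ρ ε b) :
    ∫⁻ z in cyl Ω T, ENNReal.ofReal (ρ (|u z| ^ m) * ‖G z‖ ^ 2)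
      ≤ ENNReal.ofReal (prim ρ b * mass Ω T μ σ) := by
  have he := h.energy_le hρ ⟨h.time_pos, le_rfl⟩
  have h0 : 0 ≤ ∫ x in Ω, energyFn m ρ (v T x) :=
    integral_nonneg fun x => energyFn_nonneg h.exp_pos hρ _
  obtain ⟨c, -, hc⟩ := hρ.exists_bound
  have hi : Integrable (fun z => ρ (|u z| ^ m) * ‖G z‖ ^ 2) (volume.restrict (cyl Ω T)) :=
    ((memLp_two_iff_integrable_sq_norm h.memLp_weak.1).1 h.memLp_weak).bdd_mul (c := c)
      (hρ.smooth.continuous.measurable.comp h.measurable_pow).aestronglyMeasurable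
      (ae_of_all _ fun z => hc _)
  rw [← ofReal_integral_eq_lintegral_ofReal hi
    (ae_of_all _ fun z => mul_nonneg (hρ.nonneg _) (by positivity))]
  exact ENNReal.ofReal_le_ofReal (by linarith)

/-- The energy on the sublevel sets of the solution. -/
theorem lintegral_sublevel_le {l : ℝ} (hl : 0 < l) :
    ∫⁻ z in {z | |u z| ^ m ≤ l}, ‖G z‖ₑ ^ 2 ∂volume.restrict (cyl Ω T)
      ≤ ENNReal.ofReal (2 * l * mass Ω T μ σ) := by
  set ν := (volume : Measure (Space N × ℝ)).restrict (cyl Ω T) with hν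
  -- Profiles must vanish near 0, so the sublevel set is exhausted from above zero; on what is left,
  -- u = 0 and the gradient vanishes. The shift by 2 makes l/(n + 2) < l already for n = 0.
  let s : ℕ → Set (Space N × ℝ) := fun n => {z | l / (n + 2) ≤ |u z| ^ m ∧ |u z| ^ m ≤ l}
  have hs : ∀ n, MeasurableSet (s n) := fun n =>
    (measurableSet_le measurable_const h.measurable_pow).inter
      (measurableSet_le h.measurable_pow measurable_const)
  have hmono : Monotone s := fun i j hij z hz => ⟨le_trans (by gcongr) hz.1, hz.2⟩
  have hsn : ∀ n, ∫⁻ z in s n, ‖G z‖ₑ ^ 2 ∂ν ≤ ENNReal.ofReal (2 * l * mass Ω T μ σ) := by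
    intro n
    have hn : (0 : ℝ) < l / (n + 2) := by positivity
    have hn' : l / (n + 2) < l := div_lt_self hl (by have : (0 : ℝ) ≤ n := n.cast_nonneg; linarith)
    obtain ⟨ρ, hρ, -, h2, h3⟩ := exists_isProfile_plateau hn hn'
    calc ∫⁻ z in s n, ‖G z‖ₑ ^ 2 ∂ν
        ≤ ∫⁻ z in s n, ENNReal.ofReal (ρ (|u z| ^ m) * ‖G z‖ ^ 2) ∂ν := by
          refine lintegral_mono_ae ?_
          filter_upwards [ae_restrict_mem (hs n)] with z hz
          rw [h2 _ ⟨hz.1, hz.2⟩, one_mul, ← ofReal_norm,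
            ENNReal.ofReal_pow (norm_nonneg _)]
      _ ≤ ∫⁻ z, ENNReal.ofReal (ρ (|u z| ^ m) * ‖G z‖ ^ 2) ∂ν := setLIntegral_le_lintegral _ _
      _ ≤ ENNReal.ofReal (prim ρ (2 * l) * mass Ω T μ σ) := h.lintegral_profile_le hρ
      _ ≤ _ := ENNReal.ofReal_le_ofReal (mul_le_mul_of_nonneg_right h3 (mass_nonneg _ _))
  have hU : {z | |u z| ^ m ≤ l} ⊆ {z | |u z| ^ m = 0} ∪ ⋃ n, s n := by
    intro z (hz : |u z| ^ m ≤ l)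
    have ha : 0 ≤ |u z| ^ m := by positivity
    rcases ha.eq_or_lt with h0 | h0
    · exact Or.inl h0.symm
    · obtain ⟨n, hn⟩ := exists_nat_gt (l / |u z| ^ m)
      refine Or.inr (mem_iUnion.2 ⟨n, ?_, hz⟩)
      rw [div_lt_iff₀ h0] at hn
      rw [div_le_iff₀ (by positivity)]
      nlinarith
  calc ∫⁻ z in {z | |u z| ^ m ≤ l}, ‖G z‖ₑ ^ 2 ∂ν
      ≤ ∫⁻ z in {z | |u z| ^ m = 0} ∪ ⋃ n, s n, ‖G z‖ₑ ^ 2 ∂ν := lintegral_mono_set hU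
    _ ≤ (∫⁻ z in {z | |u z| ^ m = 0}, ‖G z‖ₑ ^ 2 ∂ν) + ∫⁻ z in ⋃ n, s n, ‖G z‖ₑ ^ 2 ∂ν :=
        lintegral_union_le _ _ _
    _ = 0 + ⨆ n, ∫⁻ z in s n, ‖G z‖ₑ ^ 2 ∂ν := by
        congr 1
        · rw [lintegral_congr_ae (g := fun _ => 0), lintegral_zero]
          filter_upwards [ae_restrict_mem
            (h.measurable_pow (measurableSet_singleton 0) : MeasurableSet {z | |u z| ^ m = 0}),
            ae_restrict_of_ae h.weak_eq_zero] with z hz h0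
          rw [h0 hz]; simp
        · exact setLIntegral_iUnion_of_directed _ hmono.directed_le
    _ ≤ _ := by rw [zero_add]; exact iSup_le hsn

/-- Sobolev's inequality on a time slice. -/
theorem measure_slice_le (hN : 2 ≤ N) {k : ℝ} (hk : 0 < k)
    (hρ : IsProfile ρ (k ^ m / 2 / 2) b) (hle : k ^ m / 2 ≤ prim ρ (k ^ m)) :
    ∀ᵐ t ∂volume.restrict (Ioo 0 T),
      ENNReal.ofReal (k ^ m / 2) ^ (2 : ℝ) * volume.restrict Ω {x | k < |u (x, t)|}
        ≤ (sobolevConst N * ENNReal.ofReal (4 ^ (1 / m) * mass Ω T μ σ / k) ^ (1 / N : ℝ)) ^ (2 : ℝ)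
          * ∫⁻ x in Ω, ‖ρ (|u (x, t)| ^ m) • A (x, t)‖ₑ ^ 2 := by
  have hm := h.exp_pos
  obtain ⟨C, -, hC⟩ := hρ.exists_bound
  filter_upwards [h.slices, h.lintegral_slice_le] with t ht hLt
  have hut : Measurable fun x => u (x, t) := h.measurable.comp measurable_prodMk_right
  have hH := ht.comp hρ.contDiff_prim (hρ.prim_eq_zero hρ.pos.le) (C := C)
    (by rw [hρ.deriv_prim]; exact hC)
  rw [hρ.deriv_prim] at hH
  set ν := (volume : Measure (Space N)).restrict Ω with hν
  set B : Space N → Space N := fun x => ρ (|u (x, t)| ^ m) • A (x, t) with hB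
  have hsob := hH.sobolev hN h.isBounded
  -- the gradient is supported where the solution is not small
  set c : ℝ := k / 4 ^ (1 / m) with hc
  have hc0 : 0 < c := by positivity
  have hcm : c ^ m = k ^ m / 2 / 2 := by
    rw [hc, Real.div_rpow hk.le (by positivity), ← Real.rpow_mul (by norm_num),
      one_div_mul_cancel hm.ne', Real.rpow_one]
    ring
  have hsupp : Function.support B ⊆ {x | ENNReal.ofReal c ≤ ‖u (x, t)‖ₑ} := by
    intro x hx
    rw [mem_ofPred_eq, Real.enorm_eq_ofReal_abs]
    refine ENNReal.ofReal_le_ofReal ?_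
    by_contra hlt
    refine hx ?_
    simp only [hB]
    rw [hρ.left _ ?_, zero_smul]
    rw [← hcm]
    exact Real.rpow_le_rpow (abs_nonneg _) (not_le.1 hlt).le hm.le
  -- Chebyshev's inequality with the L¹ bound: the gradient is supported on a set of measure at most
  -- M/c.
  have hF : ν {x | ENNReal.ofReal c ≤ ‖u (x, t)‖ₑ}
      ≤ ENNReal.ofReal (4 ^ (1 / m) * mass Ω T μ σ / k) := by
    refine (meas_ge_le_lintegral_div hut.enorm.aemeasurable (by simpa using hc0) (by simp)).trans ?_
    refine (ENNReal.div_le_div_right hLt _).trans (le_of_eq ?_)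
    rw [← ENNReal.ofReal_div_of_pos hc0]
    congr 1
    rw [hc]; field_simp
  have hNpos : (0 : ℝ) < N := by exact_mod_cast (by omega : 0 < N)
  have hhol : eLpNorm B (sobolevExp N) ν
      ≤ eLpNorm B 2 ν * ENNReal.ofReal (4 ^ (1 / m) * mass Ω T μ σ / k) ^ (1 / N : ℝ) := by
    rw [← eLpNorm_restrict_eq_of_support_subset hsupp]
    refine (eLpNorm_le_eLpNorm_mul_rpow_measure_univ
      (q := 2) (by exact_mod_cast sobolevExp_le_two N) hH.2.1.1.restrict).trans ?_
    rw [eLpNorm_restrict_eq_of_support_subset hsupp, Measure.restrict_apply_univ]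
    -- Hölder between the exponents p and 2 on that small set yields its measure to the power 1/p −
    -- 1/2 = 1/N. This is the gain that produces 2/N in the final exponent.
    have e : 1 / (sobolevExp N : ℝ≥0∞).toReal - 1 / (2 : ℝ≥0∞).toReal = (1 / N : ℝ) := by
      simp only [ENNReal.coe_toReal, sobolevExp, ENNReal.toReal_ofNat]
      push_cast
      field_simp
      ring
    rw [e]
    gcongr
  have hcheb := mul_meas_ge_le_pow_eLpNorm' ν (p := 2) (by simp) (by simp) hH.1.1
    (ENNReal.ofReal (k ^ m / 2))
  have e2 : eLpNorm B 2 ν ^ (2 : ℝ) = ∫⁻ x, ‖B x‖ₑ ^ 2 ∂ν := by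
    have := eLpNorm_nnreal_pow_eq_lintegral (μ := ν) (f := B) (p := 2) (by simp)
    simpa using this
  rw [ENNReal.toReal_ofNat] at hcheb
  calc ENNReal.ofReal (k ^ m / 2) ^ (2 : ℝ) * ν {x | k < |u (x, t)|}
      ≤ ENNReal.ofReal (k ^ m / 2) ^ (2 : ℝ)
        * ν {x | ENNReal.ofReal (k ^ m / 2) ≤ ‖prim ρ (|u (x, t)| ^ m)‖ₑ} := by
        gcongr
        intro hx
        rw [Real.enorm_eq_ofReal_abs]
        refine ENNReal.ofReal_le_ofReal (le_trans ?_ (le_abs_self _))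
        exact hle.trans (hρ.monotone_prim (Real.rpow_le_rpow hk.le hx.le hm.le))
    _ ≤ eLpNorm (fun x => prim ρ (|u (x, t)| ^ m)) 2 ν ^ (2 : ℝ) := hcheb
    _ ≤ (sobolevConst N * (eLpNorm B 2 ν
          * ENNReal.ofReal (4 ^ (1 / m) * mass Ω T μ σ / k) ^ (1 / N : ℝ))) ^ (2 : ℝ) := by
        gcongr
        exact hsob.trans (by gcongr)
    _ = _ := by
        rw [← e2, ← ENNReal.mul_rpow_of_nonneg _ _ (by norm_num)]
        congr 1; ring

end IsRegularSolution

end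

/-! ### Distribution functions of the solution and of the gradient -/

section

variable {N : ℕ} {Ω : Set (Space N)} {T : ℝ}

/-- The constant in the estimate of the superlevel sets of a solution. -/
def levelConst (N : ℕ) (m : ℝ) : ℝ :=
  8 * (sobolevConst N).toReal ^ 2 * (4 ^ (1 / m)) ^ (2 / N : ℝ) + 1

theorem levelConst_pos (N : ℕ) (m : ℝ) : 0 < levelConst N m := by
  unfold levelConst; positivity

theorem IsProfile.half_le_prim {ρ : ℝ → ℝ} {ε b l : ℝ} (hρ : IsProfile ρ ε b) (hl : 0 < l)
    (h1 : ∀ s ∈ Icc (l / 2) l, ρ s = 1) : l / 2 ≤ prim ρ l := by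
  have e1 : prim ρ l - prim ρ (l / 2) = ∫ s in (l / 2)..l, ρ s :=
    intervalIntegral.integral_interval_sub_left
      (hρ.smooth.continuous.intervalIntegrable (μ := volume) _ _)
      (hρ.smooth.continuous.intervalIntegrable _ _)
  have e2 : ∫ s in (l / 2)..l, ρ s = ∫ _ in (l / 2)..l, (1 : ℝ) := by
    refine intervalIntegral.integral_congr fun s hs => ?_
    rw [uIcc_of_le (by linarith)] at hs
    exact h1 s hs
  have e3 := hρ.prim_nonneg (l / 2)
  rw [e2] at e1
  simp only [intervalIntegral.integral_const, smul_eq_mul, mul_one] at e1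
  linarith

namespace IsRegularSolution

variable {m L : ℝ} {μ : Space N × ℝ → ℝ} {σ : Space N → ℝ} {u : Space N × ℝ → ℝ}
  {A G : Space N × ℝ → Space N} {v : ℝ → Lp ℝ 2 ((volume : Measure (Space N)).restrict Ω)}
  {ρ : ℝ → ℝ} {ε b : ℝ}
  (h : IsRegularSolution m L Ω T μ σ u A G v)
include h

/-- The slice estimate is integrated in time. Its right side contains the energy of the truncated
function, which is at most 2k^m M, against k^{2m} on the left and the factor (M/k)^{2/N}. -/
theorem measure_superlevel_le (hN : 2 ≤ N) {k : ℝ} (hk : 0 < k) :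
    volume.restrict (cyl Ω T) {z | k < |u z|}
      ≤ ENNReal.ofReal (levelConst N m * mass Ω T μ σ ^ (1 + 2 / N : ℝ)
        * k ^ (-(m + 2 / N : ℝ))) := by
  set M := mass Ω T μ σ with hM
  have hM0 : 0 ≤ M := mass_nonneg μ σ
  have hm := h.exp_pos
  have hNpos : (0 : ℝ) < N := by exact_mod_cast (by omega : 0 < N)
  have hl : 0 < k ^ m := by positivity
  -- The plateau is [k^m/2, k^m]: the primitive has reached k^m/2 by the time |u| exceeds k, its
  -- total is at most 2k^m, and nothing is seen below k^m/4.
  obtain ⟨ρ, hρ, h1, h2, h3⟩ := exists_isProfile_plateau (half_pos hl) (half_lt_self hl)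
  have hs := h.measure_slice_le hN hk hρ (hρ.half_le_prim hl h2)
  have hE : MeasurableSet {z | k < |u z|} := measurableSet_lt measurable_const h.measurable.abs
  have hvol : volume.restrict (cyl Ω T) {z | k < |u z|}
      = ∫⁻ t in Ioo 0 T, volume.restrict Ω {x | k < |u (x, t)|} := by
    rw [volume_restrict_cyl, Measure.prod_apply_symm hE]
    rfl
  have hA : AEStronglyMeasurable (fun z => ρ (|u z| ^ m) • A z) (volume.restrict (cyl Ω T)) :=
    (hρ.smooth.continuous.measurable.comp h.measurable_pow).aestronglyMeasurable.smul h.memLp.1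
  have hInt : ∫⁻ t in Ioo 0 T, ∫⁻ x in Ω, ‖ρ (|u (x, t)| ^ m) • A (x, t)‖ₑ ^ 2
      ≤ ENNReal.ofReal (2 * k ^ m * M) := by
    have hme := hA.enorm.pow_const 2
    rw [volume_restrict_cyl] at hme
    rw [← lintegral_prod_symm (fun z : Space N × ℝ => ‖ρ (|u z| ^ m) • A z‖ₑ ^ 2) hme,
      ← volume_restrict_cyl]
    refine le_trans (lintegral_mono_ae ?_) ((h.lintegral_profile_le hρ).trans
      (ENNReal.ofReal_le_ofReal (mul_le_mul_of_nonneg_right h3 hM0)))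
    -- The gradient of |u|^m may be replaced by that of w where u ≠ 0, and ρ vanishes elsewhere.
    -- Since 0 ≤ ρ ≤ 1, also ρ² ≤ ρ.
    filter_upwards [h.norm_weak_eq] with z hz
    rw [← ofReal_norm, ← ENNReal.ofReal_pow (norm_nonneg _)]
    refine ENNReal.ofReal_le_ofReal ?_
    rw [norm_smul, Real.norm_of_nonneg (hρ.nonneg _), mul_pow]
    by_cases h0 : |u z| ^ m = 0
    · rw [h0, hρ.left 0 hρ.pos.le]; simp
    · rw [hz h0]
      refine mul_le_mul_of_nonneg_right ?_ (by positivity)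
      nlinarith [hρ.nonneg (|u z| ^ m), h1 (|u z| ^ m)]
  set S := (sobolevConst N).toReal with hS
  have hS' : sobolevConst N = ENNReal.ofReal S :=
    (ENNReal.ofReal_toReal (sobolevConst_ne_top N)).symm
  set κ := 4 ^ (1 / m) * M / k with hκ
  have hκ0 : 0 ≤ κ := by positivity
  have e1 : ENNReal.ofReal (k ^ m / 2) ^ (2 : ℝ) = ENNReal.ofReal ((k ^ m / 2) ^ 2) := by
    rw [ENNReal.ofReal_rpow_of_nonneg (by positivity) (by norm_num), Real.rpow_ofNat]
  have e2 : (sobolevConst N * ENNReal.ofReal κ ^ (1 / N : ℝ)) ^ (2 : ℝ)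
      = ENNReal.ofReal ((S * κ ^ (1 / N : ℝ)) ^ 2) := by
    rw [hS', ENNReal.ofReal_rpow_of_nonneg hκ0 (by positivity),
      ← ENNReal.ofReal_mul (by positivity),
      ENNReal.ofReal_rpow_of_nonneg (by positivity) (by norm_num), Real.rpow_ofNat]
  have main : ENNReal.ofReal ((k ^ m / 2) ^ 2) * volume.restrict (cyl Ω T) {z | k < |u z|}
      ≤ ENNReal.ofReal ((S * κ ^ (1 / N : ℝ)) ^ 2 * (2 * k ^ m * M)) := by
    rw [ENNReal.ofReal_mul (by positivity), hvol, ← lintegral_const_mul' _ _ (by simp)]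
    rw [e1, e2] at hs
    refine (lintegral_mono_ae hs).trans ?_
    rw [lintegral_const_mul' _ _ (by simp)]
    gcongr
  have hpos : 0 < (k ^ m / 2) ^ 2 := by positivity
  rw [mul_comm, ← ENNReal.le_div_iff_mul_le (Or.inl (by simpa using hpos.ne'))
    (Or.inl (by simp)), ← ENNReal.ofReal_div_of_pos hpos] at main
  refine main.trans (ENNReal.ofReal_le_ofReal ?_)
  have hκ2 : (κ ^ (1 / N : ℝ)) ^ 2
      = (4 ^ (1 / m)) ^ (2 / N : ℝ) * M ^ (2 / N : ℝ) * k ^ (-(2 / N : ℝ)) := by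
    rw [← Real.rpow_natCast (κ ^ (1 / N : ℝ)), ← Real.rpow_mul hκ0, hκ,
      Real.div_rpow (by positivity) hk.le, Real.mul_rpow (by positivity) hM0, Real.rpow_neg hk.le]
    rw [show (1 / N : ℝ) * ((2 : ℕ) : ℝ) = 2 / N by push_cast; ring]
    rfl
  have hk2 : k ^ (-(m + 2 / N : ℝ)) = (k ^ m)⁻¹ * k ^ (-(2 / N : ℝ)) := by
    rw [neg_add, Real.rpow_add hk, Real.rpow_neg hk.le]
  have hM2 : M ^ (1 + 2 / N : ℝ) = M * M ^ (2 / N : ℝ) := by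
    rw [Real.rpow_add' hM0 (by positivity), Real.rpow_one]
  rw [mul_pow, hκ2, hk2, hM2, levelConst]
  -- The factor 8 is 2 from the energy times 4 from (k^m/2)^{-2}. The extra 1 in `levelConst` is
  -- slack, added to make the constant positive.
  have hfin : S ^ 2 * ((4 ^ (1 / m)) ^ (2 / N : ℝ) * M ^ (2 / N : ℝ) * k ^ (-(2 / N : ℝ)))
      * (2 * k ^ m * M) / (k ^ m / 2) ^ 2
      = 8 * S ^ 2 * (4 ^ (1 / m)) ^ (2 / N : ℝ) * (M * M ^ (2 / N : ℝ))
        * ((k ^ m)⁻¹ * k ^ (-(2 / N : ℝ))) := by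
    field_simp
    ring
  rw [hfin]
  gcongr
  linarith

/-- The set is split at |u| = k: the large values are counted by the superlevel estimate, and on the
rest Chebyshev's inequality is applied to the energy of the sublevel set. -/
theorem measure_gradient_le (hN : 2 ≤ N) {k lam : ℝ} (hk : 0 < k) (hlam : 0 < lam) :
    volume.restrict (cyl Ω T) {z | lam < ‖G z‖}
      ≤ ENNReal.ofReal (levelConst N m * mass Ω T μ σ ^ (1 + 2 / N : ℝ)
        * k ^ (-(m + 2 / N : ℝ)) + 2 * k ^ m * mass Ω T μ σ / lam ^ 2) := by
  have hm := h.exp_pos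
  have hM0 : 0 ≤ mass Ω T μ σ := mass_nonneg μ σ
  have hC := (levelConst_pos N m).le
  have hset : MeasurableSet {z | |u z| ^ m ≤ k ^ m} :=
    measurableSet_le h.measurable_pow measurable_const
  set ν := (volume : Measure (Space N × ℝ)).restrict (cyl Ω T) with hν
  have hsub : {z | lam < ‖G z‖} ⊆ {z | k < |u z|}
      ∪ ({z | ENNReal.ofReal lam ^ 2 ≤ ‖G z‖ₑ ^ 2} ∩ {z | |u z| ^ m ≤ k ^ m}) := by
    intro z hz
    rcases lt_or_ge k |u z| with h1 | h1
    · exact Or.inl h1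
    · refine Or.inr ⟨?_, Real.rpow_le_rpow (abs_nonneg _) h1 hm.le⟩
      change ENNReal.ofReal lam ^ 2 ≤ ‖G z‖ₑ ^ 2
      rw [← ofReal_norm]
      gcongr
      exact le_of_lt hz
  have hcheb : ν ({z | ENNReal.ofReal lam ^ 2 ≤ ‖G z‖ₑ ^ 2} ∩ {z | |u z| ^ m ≤ k ^ m})
      ≤ ENNReal.ofReal (2 * k ^ m * mass Ω T μ σ / lam ^ 2) := by
    rw [← Measure.restrict_apply' hset]
    refine (meas_ge_le_lintegral_div (h.memLp_weak.1.restrict.enorm.pow_const 2)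
      (by simpa using hlam) (by simp)).trans ?_
    refine (ENNReal.div_le_div_right (h.lintegral_sublevel_le (by positivity)) _).trans
      (le_of_eq ?_)
    rw [← ENNReal.ofReal_pow hlam.le, ← ENNReal.ofReal_div_of_pos (by positivity)]
  rw [ENNReal.ofReal_add (by positivity) (by positivity)]
  exact (measure_mono hsub).trans ((measure_union_le _ _).trans
    (add_le_add (h.measure_superlevel_le hN hk) hcheb))

/-- The distribution function of the gradient. -/
theorem measure_gradient_le' (hN : 2 ≤ N) {lam : ℝ} (hlam : 0 < lam) :
    volume.restrict (cyl Ω T) {z | lam < ‖G z‖}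
      ≤ ENNReal.ofReal ((levelConst N m + 2)
        * mass Ω T μ σ ^ ((m * (N + 1) + 1) / (m * N + 1) : ℝ)
        * lam ^ (-((m * N + 2) / (m * N + 1) : ℝ))) := by
  have hm := h.exp_pos
  have hNpos : (0 : ℝ) < N := by exact_mod_cast (by omega : 0 < N)
  have hC := (levelConst_pos N m).le
  rcases (mass_nonneg (Ω := Ω) (T := T) μ σ).eq_or_lt with hM | hM
  -- Without mass the optimal k would be 0; any positive k makes both terms vanish.
  · refine (h.measure_gradient_le hN one_pos hlam).trans (ENNReal.ofReal_le_ofReal ?_)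
    rw [← hM, Real.zero_rpow (by positivity), Real.zero_rpow (by positivity)]
    simp
  set M := mass Ω T μ σ
  -- This k balances M^{1+2/N} k^{-(m+2/N)} against k^m M/λ², that is, k^{2(m+1/N)} = (M^{1/N} λ)².
  -- Both terms become the same power, with coefficients `levelConst N m` and 2.
  set k : ℝ := (M ^ (1 / N : ℝ) * lam) ^ (N / (m * N + 1) : ℝ) with hk
  have hk0 : 0 < k := by positivity
  refine (h.measure_gradient_le hN hk0 hlam).trans (ENNReal.ofReal_le_ofReal (le_of_eq ?_))
  have hkm : k ^ m = M ^ (m / (m * N + 1) : ℝ) * lam ^ (m * N / (m * N + 1) : ℝ) := by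
    rw [hk, ← Real.rpow_mul (by positivity), Real.mul_rpow (by positivity) hlam.le,
      ← Real.rpow_mul hM.le]
    congr 2
    · field_simp
    · field_simp
  have hk2 : k ^ (-(m + 2 / N : ℝ)) = M ^ (-((m * N + 2) / (N * (m * N + 1))) : ℝ)
      * lam ^ (-((m * N + 2) / (m * N + 1)) : ℝ) := by
    rw [hk, ← Real.rpow_mul (by positivity), Real.mul_rpow (by positivity) hlam.le,
      ← Real.rpow_mul hM.le]
    congr 2
    · field_simp
    · field_simp
  have a1 : M ^ (1 + 2 / N : ℝ) * M ^ (-((m * N + 2) / (N * (m * N + 1))) : ℝ)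
      = M ^ ((m * (N + 1) + 1) / (m * N + 1) : ℝ) := by
    rw [← Real.rpow_add hM]
    congr 1
    field_simp
    ring
  have a2 : M ^ (m / (m * N + 1) : ℝ) * M = M ^ ((m * (N + 1) + 1) / (m * N + 1) : ℝ) := by
    rw [← Real.rpow_add_one hM.ne']
    congr 1
    field_simp
    ring
  have a3 : lam ^ (m * N / (m * N + 1) : ℝ) / lam ^ 2 = lam ^ (-((m * N + 2) / (m * N + 1)) : ℝ) := by
    rw [← Real.rpow_natCast lam 2, ← Real.rpow_sub hlam]
    congr 1
    push_cast
    field_simp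
    ring
  rw [hkm, hk2]
  calc _ = levelConst N m * (M ^ (1 + 2 / N : ℝ) * M ^ (-((m * N + 2) / (N * (m * N + 1))) : ℝ))
        * lam ^ (-((m * N + 2) / (m * N + 1)) : ℝ)
        + 2 * (M ^ (m / (m * N + 1) : ℝ) * M)
          * (lam ^ (m * N / (m * N + 1) : ℝ) / lam ^ 2) := by ring
    _ = _ := by rw [a1, a2, a3]; ring

end IsRegularSolution

theorem weakNorm_le {F : Type*} [NormedAddCommGroup F] {f g : Space N × ℝ → F}
    {s : Set (Space N × ℝ)} (hs : MeasurableSet s) (hfg : f =ᵐ[volume.restrict s] g) {p D : ℝ}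
    (hp : 0 < p) (hD : 0 ≤ D) (h : ∀ k : ℝ, 0 < k →
      volume.restrict s {z | k < ‖g z‖} ≤ ENNReal.ofReal (D * k ^ (-p))) :
    weakNorm p s f ≤ ENNReal.ofReal (D ^ (1 / p)) := by
  refine iSup₂_le fun k hk => ?_
  have e : volume {z ∈ s | k < ‖f z‖} = volume.restrict s {z | k < ‖g z‖} := by
    rw [show {z ∈ s | k < ‖f z‖} = {z | k < ‖f z‖} ∩ s from inter_comm _ _,
      ← Measure.restrict_apply' hs]
    refine measure_congr ?_
    filter_upwards [hfg] with z hz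
    exact propext (by change k < ‖f z‖ ↔ k < ‖g z‖; rw [hz])
  rw [e]
  have hp' : 0 < 1 / p := one_div_pos.2 hp
  calc ENNReal.ofReal k * volume.restrict s {z | k < ‖g z‖} ^ (1 / p)
      ≤ ENNReal.ofReal k * ENNReal.ofReal (D * k ^ (-p)) ^ (1 / p) := by
        gcongr
        exact h k hk
    _ = ENNReal.ofReal (k * (D * k ^ (-p)) ^ (1 / p)) := by
        rw [ENNReal.ofReal_rpow_of_nonneg (by positivity) hp'.le, ← ENNReal.ofReal_mul hk.le]
    _ = _ := by
        rw [Real.mul_rpow hD (by positivity), ← Real.rpow_mul hk.le,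
          show -p * (1 / p) = -1 by field_simp, Real.rpow_neg_one]
        congr 1
        field_simp

end

/-! ### Bounded measurable representatives of weak solutions -/

section

variable {N : ℕ} {Ω : Set (Space N)} {T : ℝ}

theorem IsH10WithGradient.congr {f g : Space N → ℝ} {A : Space N → Space N}
    (h : IsH10WithGradient Ω f A) (hfg : f =ᵐ[volume.restrict Ω] g) :
    IsH10WithGradient Ω g A := by
  refine ⟨h.1.ae_eq hfg, h.2.1, fun ε hε => ?_⟩
  obtain ⟨φ, h1, h2, h3, h4, h5⟩ := h.2.2 ε hε
  refine ⟨φ, h1, h2, h3, ?_, h5⟩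
  rwa [eLpNorm_congr_ae (g := fun x => φ x - f x)]
  filter_upwards [hfg] with x hx
  rw [hx]

theorem HasWeakGradient.congr {w w' : Space N × ℝ → ℝ} {G : Space N × ℝ → Space N}
    (h : HasWeakGradient Ω T w G) (hw : w =ᵐ[volume.restrict (cyl Ω T)] w') :
    HasWeakGradient Ω T w' G := by
  refine ⟨?_, h.2.1, fun φ h1 h2 h3 e => ?_⟩
  · intro z hz
    obtain ⟨t, ht, hi⟩ := h.1 z hz
    have ht' : t ∩ cyl Ω T ∈ 𝓝[cyl Ω T] z := inter_mem ht self_mem_nhdsWithin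
    refine ⟨t ∩ cyl Ω T, ht', ?_⟩
    exact (hi.mono_set inter_subset_left).congr
      (ae_restrict_of_ae_restrict_of_subset inter_subset_right hw)
  · rw [← h.2.2 φ h1 h2 h3 e]
    refine integral_congr_ae ?_
    filter_upwards [hw] with z hz
    rw [hz]

theorem HasWeakGradient.ae_eq {w : Space N × ℝ → ℝ} {G G' : Space N × ℝ → Space N}
    (hΩ : IsOpen Ω) (h : HasWeakGradient Ω T w G) (h' : HasWeakGradient Ω T w G') :
    G =ᵐ[volume.restrict (cyl Ω T)] G' :=
  ae_space_of_coord fun i => (h.hasWeakDeriv i).ae_eq (isOpen_cyl hΩ)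
    (locallyIntegrableOn_coord h.2.1 i) (locallyIntegrableOn_coord h'.2.1 i) (h'.hasWeakDeriv i)

/-- A bounded weak solution coincides almost everywhere with a regular one. -/
theorem IsWeakSolution.exists_regular {m : ℝ} (hm : 0 < m) {μ : Space N × ℝ → ℝ} {σ : Space N → ℝ}
    {u : Space N × ℝ → ℝ} (hΩ : IsOpen Ω) (hb : Bornology.IsBounded Ω) (hT : 0 < T)
    (hμ : IsCb (cyl Ω T) μ) (hσ : IsCb Ω σ) (hu : MemLp u ⊤ (volume.restrict (cyl Ω T)))
    (h : IsWeakSolution m Ω T μ σ u) :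
    ∃ L u' A G v, u =ᵐ[volume.restrict (cyl Ω T)] u' ∧
      IsRegularSolution m L Ω T μ σ u' A G v := by
  obtain ⟨v, hvc, hv⟩ := h.cont
  obtain ⟨-, A, hA, hsl⟩ := h.energy
  obtain ⟨G, hG, heq⟩ := h.eqn
  set L : ℝ := (eLpNorm u ⊤ (volume.restrict (cyl Ω T))).toReal with hL
  have hL0 : 0 ≤ L := ENNReal.toReal_nonneg
  have hbd : ∀ᵐ z ∂volume.restrict (cyl Ω T), |u z| ≤ L := by
    have := ae_le_eLpNormEssSup (f := u) (μ := volume.restrict (cyl Ω T))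
    filter_upwards [this] with z hz
    rw [← eLpNorm_exponent_top] at hz
    have := ENNReal.toReal_mono hu.2.ne hz
    rwa [toReal_enorm] at this
  -- Truncating a measurable representative at the essential bound makes measurability and
  -- boundedness hold everywhere, without changing the almost everywhere class.
  have hmeas : Measurable fun z => max (-L) (min L (hu.1.mk u z)) :=
    measurable_const.max (measurable_const.min hu.1.stronglyMeasurable_mk.measurable)
  have hae : u =ᵐ[volume.restrict (cyl Ω T)] fun z => max (-L) (min L (hu.1.mk u z)) := by
    filter_upwards [hbd, hu.1.ae_eq_mk] with z h1 h2
    rw [← h2, min_eq_right (abs_le.1 h1).2, max_eq_right (abs_le.1 h1).1]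
  refine ⟨L, _, A, G, v, hae, ?_⟩
  refine { exp_pos := hm, isOpen := hΩ, isBounded := hb, measurable := hmeas, bound := ?_,
           memLp := hA, slices := ?_, weak := ?_, time_pos := hT, continuousOn := hvc,
           ae_eq := ?_, isCb_source := hμ, isCb_initial := hσ, eqn := ?_ }
  · intro z
    rw [abs_le]
    exact ⟨le_max_left _ _, max_le (by linarith) (min_le_left _ _)⟩
  · filter_upwards [hsl, ae_slice hae] with t h1 h2
    refine h1.congr ?_
    filter_upwards [h2] with x hx
    rw [hx]
  · refine hG.congr ?_
    filter_upwards [hae] with z hz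
    rw [hz]
  · filter_upwards [hv, ae_slice hae] with t h1 h2
    refine EventuallyEq.trans ?_ h1
    filter_upwards [h2] with x hx
    exact hx.symm
  · intro φ hφ
    rw [← heq φ hφ]
    congr 2
    refine integral_congr_ae ?_
    filter_upwards [hae] with z hz
    rw [hz]

end

end PorousMedium

end

/-! ### The estimates for the original solution -/

open PorousMedium in
theorem proposition110620146 (N : ℕ) (hN : 2 ≤ N) (m : ℝ) (hm : 0 < m) :
    ∃ C₁ C₂ : ℝ, 0 < C₁ ∧ 0 < C₂ ∧
      ∀ (Ω : Set (Space N)) (T : ℝ) (μ : Space N × ℝ → ℝ) (σ : Space N → ℝ)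
        (u : Space N × ℝ → ℝ),
        IsOpen Ω → Bornology.IsBounded Ω → 0 < T →
        IsCb (cyl Ω T) μ → IsCb Ω σ →
        MemLp u ⊤ (volume.restrict (cyl Ω T)) →
        IsWeakSolution m Ω T μ σ u →
        normLinftyL1 Ω T u ≤ ENNReal.ofReal (mass Ω T μ σ) ∧
        weakNorm (m + 2 / N) (cyl Ω T) u
          ≤ ENNReal.ofReal (C₁ * mass Ω T μ σ ^ (((N : ℝ) + 2) / (m * N + 2))) ∧
        ∀ G : Space N × ℝ → Space N,
          HasWeakGradient Ω T (fun z => sgnPow m (u z)) G →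
          weakNorm ((m * N + 2) / (m * N + 1)) (cyl Ω T) G
            ≤ ENNReal.ofReal (C₂ * mass Ω T μ σ ^ ((m * (N + 1) + 1) / (m * N + 2))) := by
  have hNpos : (0 : ℝ) < N := by exact_mod_cast (by omega : 0 < N)
  have hC := levelConst_pos N m
  -- A bound D k^{-p} on a distribution function gives the weak norm bound D^{1/p}, so the constants
  -- are the corresponding powers of those in the two distribution estimates.
  refine ⟨levelConst N m ^ (1 / (m + 2 / N)),
    (levelConst N m + 2) ^ (1 / ((m * N + 2) / (m * N + 1))), by positivity, by positivity, ?_⟩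
  intro Ω T μ σ u hΩ hb hT hμ hσ hu hsol
  obtain ⟨L, u', A, G₀, v, hae, h⟩ := hsol.exists_regular hm hΩ hb hT hμ hσ hu
  have hM0 : 0 ≤ mass Ω T μ σ := mass_nonneg μ σ
  have hcyl : MeasurableSet (cyl Ω T) := (isOpen_cyl hΩ).measurableSet
  refine ⟨?_, ?_, fun G hG => ?_⟩
  · refine essSup_le_of_ae_le _ ?_
    filter_upwards [h.lintegral_slice_le, ae_slice hae] with t h1 h2
    rw [eLpNorm_one_eq_lintegral_enorm]
    refine le_trans (le_of_eq (lintegral_congr_ae ?_)) h1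
    filter_upwards [h2] with x hx
    rw [hx]
  · refine (weakNorm_le hcyl hae (by positivity) (by positivity)
      fun k hk => h.measure_superlevel_le hN hk).trans (ENNReal.ofReal_le_ofReal (le_of_eq ?_))
    rw [Real.mul_rpow hC.le (by positivity), ← Real.rpow_mul hM0]
    congr 2
    field_simp
  -- The gradient bound is claimed for every weak gradient; by uniqueness each agrees almost
  -- everywhere with the one occurring in the equation.
  · have hG' : HasWeakGradient Ω T (fun z => sgnPow m (u' z)) G :=
      hG.congr (by filter_upwards [hae] with z hz; rw [hz])
    refine (weakNorm_le hcyl (hG'.ae_eq hΩ h.weak) (by positivity) (by positivity)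
      fun k hk => h.measure_gradient_le' hN hk).trans (ENNReal.ofReal_le_ofReal (le_of_eq ?_))
    rw [Real.mul_rpow (by positivity) (by positivity), ← Real.rpow_mul hM0]
    congr 2
    field_simp
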